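/- Let $\mathbb{B}^{i}=\{x\in\mathbb{R}^3:|x|<1\}$ and $\mathbb{B}^{e}=\{x\in\mathbb{R}^3:|x|>1\}$, and let $\mathcal{A}=\{a_0+a_1e_1+a_2e_2\}\subset\mathbb{H}$ be the reduced quaternions ($a_j\in\mathbb{R}$, $e_1^2=e_2^2=-1$, $e_1e_2=-e_2e_1$). Let $\Omega$ be $\mathbb{B}^{i}$ or $\mathbb{B}^{e}$. Let $\mathcal{M}(\Omega)$ be the real vector space of smooth functions $f\in L^2(\Omega,\mathcal{A})$ with $\overline\partial f=0$ in $\Omega$, where $\overline\partial=\partial/\partial x_0+e_1\,\partial/\partial x_1+e_2\,\partial/\partial x_2$, and let $\overline{\mathcal{M}}(\Omega)$ be the space of the quaternionic conjugates of its elements; the elements of $\mathcal{M}(\Omega)+\overline{\mathcal{M}}(\Omega)$ are called ambigenic. A function $f=f_0+f_1e_1+f_2e_2\in L^2(\Omega,\mathcal{A})$ with harmonic components $f_0,f_1,f_2$ is called contragenic in $\Omega$ if $\int_{\Omega}(f_0g_0+f_1g_1+f_2g_2)\,dV=0$ for every ambigenic $g$ in $\Omega$; its scalar part is $\operatorname{Sc}f=f_0$.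 For integers $n\le-2$ and $0\le m\le -n-1$ let $U_{n,m}^{\pm}(x)=\rho^{n}P_n^m(\cos\theta)\Phi_m^{\pm}(\varphi)$, where $x=(x_0,x_1,x_2)=(\rho\cos\theta,\rho\sin\theta\cos\varphi,\rho\sin\theta\sin\varphi)$, $\Phi_m^+(\varphi)=\cos m\varphi$, $\Phi_m^-(\varphi)=\sin m\varphi$, and $P_n^m=P_{-n-1}^m$ are the associated Legendre functions, with $P_k^m(t)=(-1)^m(1-t^2)^{m/2}\frac{d^m}{dt^m}P_k(t)$ for the Legendre polynomial $P_k$, $k\ge0$. (a) If $f$ is contragenic in $\mathbb{B}^{e}$, then $\operatorname{Sc}f$ lies in the closed linear subspace of $L^2(\mathbb{B}^{e})$ generated by the harmonic functions $U_{n,-n-1}^{+}$, $U_{n,-n-1}^{-}$, $n\le-2$. (b) If $f$ is contragenic in $\mathbb{B}^{i}$, then $\operatorname{Sc}f=0$ in $\mathbb{B}^{i}$. -/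

import Mathlib

namespace Contragenic

open MeasureTheory InnerProductSpace Quaternion
open scoped ContDiff

/-- Euclidean three-space, with coordinates `x 0, x 1, x 2`. -/
abbrev E3 : Type := EuclideanSpace ℝ (Fin 3)

/-- The interior `{|x| < 1}` of the unit ball. -/
def interiorBall : Set E3 := {x | ‖x‖ < 1}

/-- The exterior `{|x| > 1}` of the unit ball. -/
def exteriorBall : Set E3 := {x | 1 < ‖x‖}

/-! ### Solid spherical harmonics -/

/-- The Legendre polynomial of degree `n`, by Rodrigues' formula. -/
noncomputable def legendre (n : ℕ) : Polynomial ℝ :=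
  Polynomial.C (1 / (2 ^ n * (n.factorial : ℝ))) *
    Polynomial.derivative^[n] ((Polynomial.X ^ 2 - 1) ^ n)

/-- The associated Legendre function
`P_n^m(t) = (-1)^m (1 - t^2)^(m/2) (d/dt)^m P_n(t)` for natural `n`, on `[-1, 1]`. -/
noncomputable def assocLegendreNat (n m : ℕ) (t : ℝ) : ℝ :=
  (-1) ^ m * Real.sqrt (1 - t ^ 2) ^ m * (Polynomial.derivative^[m] (legendre n)).eval t

/-- The associated Legendre function of integer degree, where `P_{-n-1}^m = P_n^m`
(`Int.negSucc n` is the integer `-n-1`). -/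
noncomputable def assocLegendre : ℤ → ℕ → ℝ → ℝ
  | Int.ofNat n, m, t => assocLegendreNat n m t
  | Int.negSucc n, m, t => assocLegendreNat n m t

/-- The superscript `±` of a solid spherical harmonic. -/
inductive Parity where
  | plus : Parity
  | minus : Parity

/-- `Φ_m^+(φ) = cos (m φ)` and `Φ_m^-(φ) = sin (m φ)`. -/
noncomputable def angular : Parity → ℕ → ℝ → ℝ
  | Parity.plus, m, φ => Real.cos (m * φ)
  | Parity.minus, m, φ => Real.sin (m * φ)

/-- The solid spherical harmonic `U_{n,m}^± = ρ^n P_n^m(cos θ) Φ_m^±(φ)` in the coordinates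
`x = (ρ cos θ, ρ sin θ cos φ, ρ sin θ sin φ)`, so that `ρ = |x|`, `cos θ = x 0 / |x|` and
`φ` is the argument of `x 1 + i x 2`. -/
noncomputable def solidHarmonic (n : ℤ) (m : ℕ) (s : Parity) (x : E3) : ℝ :=
  ‖x‖ ^ n * assocLegendre n m (x 0 / ‖x‖) * angular s m (Complex.arg ⟨x 1, x 2⟩)

/-! ### Monogenic, ambigenic and contragenic functions -/

/-- The quaternion unit `e₁`. -/
def e₁ : ℍ[ℝ] := ⟨0, 1, 0, 0⟩

/-- The quaternion unit `e₂`. -/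
def e₂ : ℍ[ℝ] := ⟨0, 0, 1, 0⟩

/-- The reduced quaternions `a₀ + a₁ e₁ + a₂ e₂`. -/
def reduced : Set ℍ[ℝ] := {q | q.imK = 0}

/-- The partial derivative with respect to the coordinate `x i`. -/
noncomputable def partialDeriv (i : Fin 3) (f : E3 → ℍ[ℝ]) (x : E3) : ℍ[ℝ] :=
  fderiv ℝ f x (EuclideanSpace.single i 1)

/-- The Cauchy-Riemann (Fueter) operator `∂/∂x₀ + e₁ ∂/∂x₁ + e₂ ∂/∂x₂`, acting from the left. -/
noncomputable def cauchyRiemann (f : E3 → ℍ[ℝ]) (x : E3) : ℍ[ℝ] :=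
  partialDeriv 0 f x + e₁ * partialDeriv 1 f x + e₂ * partialDeriv 2 f x

/-- Square-integrable monogenic functions in `Ω` with values in the reduced quaternions.
Only the values of `f` on `Ω` matter (for open `Ω`); the same holds below. -/
structure IsMonogenicL2 (Ω : Set E3) (f : E3 → ℍ[ℝ]) : Prop where
  reduced : ∀ x ∈ Ω, f x ∈ Contragenic.reduced
  smooth : ContDiffOn ℝ ∞ f Ω
  cauchyRiemann_eq_zero : ∀ x ∈ Ω, cauchyRiemann f x = 0
  memLp : MemLp f 2 (volume.restrict Ω)

/-- Ambigenic functions in `Ω`: a square-integrable monogenic function plus the quaternionic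
conjugate of a square-integrable monogenic function. -/
def IsAmbigenic (Ω : Set E3) (g : E3 → ℍ[ℝ]) : Prop :=
  ∃ p q : E3 → ℍ[ℝ], IsMonogenicL2 Ω p ∧ IsMonogenicL2 Ω q ∧ ∀ x ∈ Ω, g x = p x + star (q x)

/-- The scalar-valued inner product `∫_Ω (f₀ g₀ + f₁ g₁ + f₂ g₂) dV`. -/
noncomputable def scalarProduct (Ω : Set E3) (f g : E3 → ℍ[ℝ]) : ℝ :=
  ∫ x in Ω, ((f x).re * (g x).re + (f x).imI * (g x).imI + (f x).imJ * (g x).imJ)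

/-- Contragenic functions in `Ω`: square-integrable functions with values in the reduced
quaternions whose components are harmonic, and which are orthogonal to all ambigenic functions. -/
structure IsContragenic (Ω : Set E3) (f : E3 → ℍ[ℝ]) : Prop where
  reduced : ∀ x ∈ Ω, f x ∈ Contragenic.reduced
  harmonic_re : HarmonicOnNhd (fun x => (f x).re) Ω
  harmonic_imI : HarmonicOnNhd (fun x => (f x).imI) Ω
  harmonic_imJ : HarmonicOnNhd (fun x => (f x).imJ) Ω
  memLp : MemLp f 2 (volume.restrict Ω)
  orthogonal : ∀ g, IsAmbigenic Ω g → scalarProduct Ω f g = 0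

/-- The closed subspace of `L²` of the exterior that is generated by the harmonics
`U_{n,-n-1}^±`, `n ≤ -2`. -/
noncomputable def extremalSpan : Submodule ℝ (Lp ℝ 2 (volume.restrict exteriorBall)) :=
  (Submodule.span ℝ {u : Lp ℝ 2 (volume.restrict exteriorBall) |
    ∃ (n : ℤ) (m : ℕ) (s : Parity), n ≤ -2 ∧ (m : ℤ) = -n - 1 ∧
      u =ᵐ[volume.restrict exteriorBall] solidHarmonic n m s}).topologicalClosure

end Contragenic

/-! If `h` is harmonic with square-integrable gradient, then `p = ∂₀h - e₁∂₁h - e₂∂₂h` is monogenic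
and `p + p̄ = 2∂₀h`. So the scalar part of a contragenic function is orthogonal to every such `∂₀h`
(`IsContragenic.integral_re_mul_pd_complex`). No other ambigenic function is needed. The question is
how much of the harmonic `L²` space these derivatives miss. The test functions are Newtonian kernels
`1/|x-y|` with pole `y` off the closure of the domain.

Interior. The kernel with pole `y` minus the kernel with pole `y + T e₀` is an integral of
`x₀`-derivatives of kernels over the segment between the poles. Moving the pole to infinity, away
from the ball, makes the second kernel vanish in the limit, so `f₀ = Sc f` is orthogonal to all
kernels with `|y| > 1` (`IsContragenic.integral_re_mul_pole_interior`). For `c < 1` the dilation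
`f₀(c·)` is harmonic beyond the closed ball, hence is there a superposition of kernels with poles in
a shell outside the ball (`newton_representation`, `integral_mul_eq_zero_of_poles`). Thus `f₀ ⟂
f₀(c·)`, and `c → 1` gives `∫ f₀² = 0`.

Exterior. Now the poles lie in the unit ball and cannot escape to infinity; the pole can only be
brought to the plane `y₀ = 0`. With `z = x₁ + i x₂` the kernel there is `N(s,t) = (x₀² +
(z-t)(z̄-s))^(-1/2)` at `t = ζ`, `s = ζ̄`, and `s` and `t` may be treated as independent complex
parameters. Laplace's equation becomes `∂ₛ∂ₜN = -¼ ∂₀²N`, so the mixed difference `N(ζ̄,ζ) - N(0,ζ)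
- N(ζ̄,0) + N(0,0)` is again a superposition of `x₀`-derivatives (`orth_mixed_difference`). What is
left, `N(ζ̄,0)` and `N(0,ζ)`, expands by the binomial series in `z^k/|x|^(2k+1)` and its conjugates
(`orth_newton_axis`). Those are exactly the sectorial harmonics `U_{n,-n-1}^±`, up to constants
(`exists_solidHarmonic_eq`).

Conversely the sectorial harmonics are themselves orthogonal to all `∂₀h` (`integral_sect_mul_pd`).
So decompose `f₀ = s + g` with `s` in the closed span and `g` orthogonal to it. Both `f₀` and `s`
are orthogonal to the `∂₀h`, hence so is `g`; by the kernel argument `g` is orthogonal to the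
dilations of `f₀` with `c > 1`, hence to `f₀`. As also `g ⟂ s`, it follows that `g = 0`. -/

namespace Contragenic

open MeasureTheory InnerProductSpace Quaternion Filter
open scoped ContDiff ComplexConjugate Topology

/-! ### Partial derivatives and the Laplacian in coordinates -/

section Calculus

variable {F : Type*} [NormedAddCommGroup F] [NormedSpace ℝ F]

/-- The partial derivative of a vector-valued function in the direction of the coordinate `x i`. -/
noncomputable def pd (i : Fin 3) (f : E3 → F) (x : E3) : F :=
  fderiv ℝ f x (EuclideanSpace.single i 1)

/-- The Laplacian as a sum of iterated partial derivatives. -/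
noncomputable def lap (f : E3 → F) (x : E3) : F := ∑ i, pd i (pd i f) x

theorem pd_congr {f g : E3 → F} {x : E3} (h : f =ᶠ[𝓝 x] g) (i : Fin 3) :
    pd i f x = pd i g x := by
  simp only [pd, h.fderiv_eq]

theorem pd_eventuallyEq {f g : E3 → F} {x : E3} (h : f =ᶠ[𝓝 x] g) (i : Fin 3) :
    pd i f =ᶠ[𝓝 x] pd i g :=
  h.eventually_nhds.mono fun _ hy => pd_congr hy i

theorem lap_congr {f g : E3 → F} {x : E3} (h : f =ᶠ[𝓝 x] g) : lap f x = lap g x :=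
  Finset.sum_congr rfl fun i _ => pd_congr (pd_eventuallyEq h i) i

theorem contDiffAt_pd {f : E3 → F} {x : E3} {m n : WithTop ℕ∞} (hf : ContDiffAt ℝ n f x)
    (hmn : m + 1 ≤ n) (i : Fin 3) : ContDiffAt ℝ m (pd i f) x :=
  (hf.fderiv_right hmn).clm_apply contDiffAt_const

theorem contDiff_pd {f : E3 → F} {m n : WithTop ℕ∞} (hf : ContDiff ℝ n f)
    (hmn : m + 1 ≤ n) (i : Fin 3) : ContDiff ℝ m (pd i f) :=
  contDiff_iff_contDiffAt.2 fun _ => contDiffAt_pd hf.contDiffAt hmn i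

theorem pd_pd_eq {f : E3 → F} {x : E3} (hf : ContDiffAt ℝ 2 f x) (i j : Fin 3) :
    pd i (pd j f) x =
      fderiv ℝ (fderiv ℝ f) x (EuclideanSpace.single i 1) (EuclideanSpace.single j 1) := by
  have h : DifferentiableAt ℝ (fderiv ℝ f) x :=
    (hf.fderiv_right (m := 1) (by norm_num)).differentiableAt (by norm_num)
  unfold pd
  rw [fderiv_clm_apply h (differentiableAt_const _)]
  simp

theorem pd_comm {f : E3 → F} {x : E3} (hf : ContDiffAt ℝ 2 f x) (i j : Fin 3) :
    pd i (pd j f) x = pd j (pd i f) x := by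
  rw [pd_pd_eq hf, pd_pd_eq hf]
  exact (hf.isSymmSndFDerivAt (by simp)).eq _ _

theorem laplacian_eq_lap {f : E3 → F} {x : E3} (hf : ContDiffAt ℝ 2 f x) :
    Laplacian.laplacian f x = lap f x := by
  rw [laplacian_eq_iteratedFDeriv_orthonormalBasis f (EuclideanSpace.basisFun (Fin 3) ℝ)]
  simp [lap, pd_pd_eq hf, iteratedFDeriv_two_apply]

theorem lap_eq_zero_of_harmonicAt {f : E3 → F} {x : E3} (hf : HarmonicAt f x) : lap f x = 0 := by
  rw [← laplacian_eq_lap hf.1]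
  exact hf.2.self_of_nhds

theorem pd_clm_comp {G : Type*} [NormedAddCommGroup G] [NormedSpace ℝ G] (l : F →L[ℝ] G)
    {f : E3 → F} {x : E3} (hf : DifferentiableAt ℝ f x) (i : Fin 3) :
    pd i (fun y => l (f y)) x = l (pd i f x) := by
  have : HasFDerivAt (fun y => l (f y)) (l.comp (fderiv ℝ f x)) x :=
    l.hasFDerivAt.comp x hf.hasFDerivAt
  simp [pd, this.fderiv]

theorem lap_clm_comp {G : Type*} [NormedAddCommGroup G] [NormedSpace ℝ G] (l : F →L[ℝ] G)
    {f : E3 → F} {x : E3} (hf : ContDiffAt ℝ 2 f x) :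
    lap (fun y => l (f y)) x = l (lap f x) := by
  simp only [lap, map_sum]
  refine Finset.sum_congr rfl fun i _ => ?_
  have h1 : pd i (fun y => l (f y)) =ᶠ[𝓝 x] fun y => l (pd i f y) := by
    filter_upwards [hf.eventually (by simp)] with y hy
    exact pd_clm_comp l (hy.differentiableAt (by norm_num)) i
  rw [pd_congr h1]
  exact pd_clm_comp l ((contDiffAt_pd hf (m := 1) (by norm_num) i).differentiableAt (by norm_num)) i

end Calculus

/-! ### Contragenic functions against `x₀`-derivatives of harmonic functions -/

section Orthogonality

@[simp] theorem re_e₁ : e₁.re = 0 := rfl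
@[simp] theorem imI_e₁ : e₁.imI = 1 := rfl
@[simp] theorem imJ_e₁ : e₁.imJ = 0 := rfl
@[simp] theorem imK_e₁ : e₁.imK = 0 := rfl
@[simp] theorem re_e₂ : e₂.re = 0 := rfl
@[simp] theorem imI_e₂ : e₂.imI = 0 := rfl
@[simp] theorem imJ_e₂ : e₂.imJ = 1 := rfl
@[simp] theorem imK_e₂ : e₂.imK = 0 := rfl

variable {Ω : Set E3} {f : E3 → ℍ[ℝ]}

/-- The conjugate of the gradient of a harmonic function is monogenic. -/
theorem isMonogenicL2_gradient (hΩ : IsOpen Ω) {h : E3 → ℝ} (hh : ContDiffOn ℝ ∞ h Ω)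
    (hlap : ∀ x ∈ Ω, lap h x = 0) (hL : ∀ i, MemLp (pd i h) 2 (volume.restrict Ω)) :
    IsMonogenicL2 Ω (fun x => pd 0 h x • (1 : ℍ[ℝ]) - pd 1 h x • e₁ - pd 2 h x • e₂) := by
  have hsm : ∀ x ∈ Ω, ContDiffAt ℝ ∞ h x := fun x hx => hh.contDiffAt (hΩ.mem_nhds hx)
  have hpd : ∀ i, ∀ x ∈ Ω, ContDiffAt ℝ ∞ (pd i h) x := fun i x hx =>
    contDiffAt_pd (hsm x hx) (by simp) i
  refine ⟨fun x _ => by simp [Contragenic.reduced], fun x hx => ?_, fun x hx => ?_, ?_⟩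
  · exact ((((hpd 0 x hx).smul contDiffAt_const).sub ((hpd 1 x hx).smul contDiffAt_const)).sub
      ((hpd 2 x hx).smul contDiffAt_const)).contDiffWithinAt
  · have hd : ∀ i, DifferentiableAt ℝ (pd i h) x := fun i =>
      (hpd i x hx).differentiableAt (by simp)
    have key : ∀ j, partialDeriv j
        (fun x => pd 0 h x • (1 : ℍ[ℝ]) - pd 1 h x • e₁ - pd 2 h x • e₂) x =
        pd j (pd 0 h) x • (1 : ℍ[ℝ]) - pd j (pd 1 h) x • e₁ - pd j (pd 2 h) x • e₂ := by
      intro j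
      have := (((hd 0).hasFDerivAt.smul_const (1 : ℍ[ℝ])).sub
        ((hd 1).hasFDerivAt.smul_const e₁)).sub ((hd 2).hasFDerivAt.smul_const e₂)
      unfold partialDeriv
      erw [this.fderiv]
      simp [pd]
    have h2 : ContDiffAt ℝ 2 h x := (hsm x hx).of_le (by norm_cast)
    have hl := hlap x hx
    simp only [lap, Fin.sum_univ_three] at hl
    have c1 := pd_comm h2 1 0
    have c2 := pd_comm h2 2 0
    have c3 := pd_comm h2 2 1
    simp only [cauchyRiemann, key]
    ext
    · simp; linarith
    · simp; linarith
    · simp; linarith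
    · simp; linarith
  · have hs : ∀ i (c : ℍ[ℝ]), MemLp (fun x => pd i h x • c) 2 (volume.restrict Ω) := fun i c =>
      (ContinuousLinearMap.smulRight (1 : ℝ →L[ℝ] ℝ) c).comp_memLp' (hL i)
    exact ((hs 0 1).sub (hs 1 e₁)).sub (hs 2 e₂)

/-- The conjugate gradient `p` of `h` is monogenic and `p + p̄ = 2∂₀h` has only a scalar part, so
testing against this ambigenic function sees only `Sc f`. -/
theorem IsContragenic.integral_re_mul_pd (hΩ : IsOpen Ω) (hf : IsContragenic Ω f) {h : E3 → ℝ}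
    (hh : ContDiffOn ℝ ∞ h Ω) (hlap : ∀ x ∈ Ω, lap h x = 0)
    (hL : ∀ i, MemLp (pd i h) 2 (volume.restrict Ω)) :
    ∫ x in Ω, (f x).re * pd 0 h x = 0 := by
  have hm := isMonogenicL2_gradient hΩ hh hlap hL
  have := hf.orthogonal _ ⟨_, _, hm, hm, fun x _ => rfl⟩
  simp only [scalarProduct] at this
  have e : ∀ x, (f x).re * pd 0 h x = (1 / 2 : ℝ) * ((f x).re * (pd 0 h x + pd 0 h x)) := by
    intro x; ring
  simp_rw [e]
  rw [integral_const_mul]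
  simp at this
  simp [this]

theorem IsContragenic.memLp_re (hf : IsContragenic Ω f) :
    MemLp (fun x => (f x).re) 2 (volume.restrict Ω) := by
  refine hf.memLp.mono ?_ (ae_of_all _ fun x => ?_)
  · exact (Quaternion.continuous_re.comp_aestronglyMeasurable hf.memLp.1)
  · refine abs_le_of_sq_le_sq ?_ (norm_nonneg _)
    rw [← real_inner_self_eq_norm_sq, Quaternion.inner_self, Quaternion.normSq_def']
    nlinarith [sq_nonneg (f x).imI, sq_nonneg (f x).imJ, sq_nonneg (f x).imK]

/-- The scalar part of a contragenic function is orthogonal to `∂h/∂x₀` for complex harmonic `h`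
with square-integrable gradient. -/
theorem IsContragenic.integral_re_mul_pd_complex (hΩ : IsOpen Ω) (hf : IsContragenic Ω f)
    {h : E3 → ℂ} (hh : ContDiffOn ℝ ∞ h Ω) (hlap : ∀ x ∈ Ω, lap h x = 0)
    (hL : ∀ i, MemLp (pd i h) 2 (volume.restrict Ω)) :
    ∫ x in Ω, ((f x).re : ℂ) * pd 0 h x = 0 := by
  have hsm : ∀ x ∈ Ω, ContDiffAt ℝ ∞ h x := fun x hx => hh.contDiffAt (hΩ.mem_nhds hx)
  have aux : ∀ l : ℂ →L[ℝ] ℝ, ∫ x in Ω, (f x).re * l (pd 0 h x) = 0 := by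
    intro l
    have hp : ∀ i, ∀ x ∈ Ω, pd i (fun y => l (h y)) x = l (pd i h x) := fun i x hx =>
      pd_clm_comp l ((hsm x hx).differentiableAt (by simp)) i
    have := hf.integral_re_mul_pd hΩ (h := fun y => l (h y)) (l.contDiff.comp_contDiffOn hh)
      (fun x hx => by
        rw [lap_clm_comp l ((hsm x hx).of_le (by norm_cast)), hlap x hx, map_zero])
      (fun i => (l.comp_memLp' (hL i)).ae_eq
        (((ae_restrict_mem hΩ.measurableSet).mono fun x hx => (hp i x hx).symm)))
    refine Eq.trans ?_ this
    exact setIntegral_congr_fun hΩ.measurableSet fun x hx => by simp only [hp 0 x hx]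
  have hint : Integrable (fun x => ((f x).re : ℂ) * pd 0 h x) (volume.restrict Ω) :=
    MemLp.integrable_mul (p := 2) (q := 2) hf.memLp_re.ofReal (hL 0)
  apply Complex.ext
  · have := integral_re hint
    simp only [RCLike.re_eq_complex_re] at this
    rw [← this]
    simpa using aux Complex.reCLM
  · have := integral_im hint
    simp only [RCLike.im_eq_complex_im] at this
    rw [← this]
    simpa using aux Complex.imCLM

end Orthogonality

/-! ### A derivative calculus for complex-valued functions on three-space -/

section PartialDerivatives

/-- `f` is differentiable at `x` with partial derivatives `f' i`. -/
def HasPD (f : E3 → ℂ) (f' : Fin 3 → ℂ) (x : E3) : Prop :=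
  DifferentiableAt ℝ f x ∧ ∀ i, pd i f x = f' i

variable {f g : E3 → ℂ} {f' g' : Fin 3 → ℂ} {x : E3}

theorem HasPD.congr (h : HasPD f f' x) (he : ∀ i, f' i = g' i) : HasPD f g' x :=
  ⟨h.1, fun i => (h.2 i).trans (he i)⟩

theorem hasPD_of_differentiableAt (h : DifferentiableAt ℝ f x) : HasPD f (fun i => pd i f x) x :=
  ⟨h, fun _ => rfl⟩

theorem HasPD.const (c : ℂ) : HasPD (fun _ => c) (fun _ => 0) x :=
  ⟨differentiableAt_const c, fun i => by simp [pd]⟩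

theorem HasPD.add (hf : HasPD f f' x) (hg : HasPD g g' x) :
    HasPD (fun y => f y + g y) (fun i => f' i + g' i) x :=
  ⟨hf.1.add hg.1, fun i => by
    simp only [← hf.2, ← hg.2]; simp [pd, fderiv_fun_add hf.1 hg.1]⟩

theorem HasPD.sub (hf : HasPD f f' x) (hg : HasPD g g' x) :
    HasPD (fun y => f y - g y) (fun i => f' i - g' i) x :=
  ⟨hf.1.sub hg.1, fun i => by
    simp only [← hf.2, ← hg.2]; simp [pd, fderiv_fun_sub hf.1 hg.1]⟩

theorem HasPD.mul (hf : HasPD f f' x) (hg : HasPD g g' x) :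
    HasPD (fun y => f y * g y) (fun i => f' i * g x + f x * g' i) x :=
  ⟨hf.1.mul hg.1, fun i => by
    simp only [← hf.2, ← hg.2]; simp [pd, fderiv_fun_mul hf.1 hg.1]; ring⟩

theorem HasPD.const_mul (c : ℂ) (hf : HasPD f f' x) :
    HasPD (fun y => c * f y) (fun i => c * f' i) x :=
  ((HasPD.const c).mul hf).congr fun i => by ring

theorem HasPD.comp {φ : ℂ → ℂ} {φ' : ℂ} (hφ : HasDerivAt φ φ' (f x)) (hf : HasPD f f' x) :
    HasPD (fun y => φ (f y)) (fun i => φ' * f' i) x := by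
  have h := (hφ.hasFDerivAt.restrictScalars ℝ).comp x hf.1.hasFDerivAt
  refine ⟨h.differentiableAt, fun i => ?_⟩
  simp only [← hf.2]
  unfold pd
  erw [h.fderiv]
  simp [mul_comm]

theorem HasPD.pow (n : ℕ) (hf : HasPD f f' x) :
    HasPD (fun y => f y ^ n) (fun i => n * f x ^ (n - 1) * f' i) x :=
  HasPD.comp (hasDerivAt_pow n (f x)) hf

theorem HasPD.coord (j : Fin 3) :
    HasPD (fun y => (y j : ℂ)) (fun i => if i = j then 1 else 0) x := by
  have h : HasFDerivAt (fun y : E3 => (y j : ℂ))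
      (Complex.ofRealCLM.comp (EuclideanSpace.proj j : E3 →L[ℝ] ℝ)) x :=
    (Complex.ofRealCLM.comp
      (EuclideanSpace.proj j : E3 →L[ℝ] ℝ)).hasFDerivAt
  refine ⟨h.differentiableAt, fun i => ?_⟩
  unfold pd
  rw [h.fderiv]
  by_cases hij : i = j
  · subst hij; simp
  · have : j ≠ i := fun e => hij e.symm
    simp [hij, this]

theorem HasPD.comp_normSq {β : ℝ → ℂ} {β' : ℂ} (hβ : HasDerivAt β β' (‖x‖ ^ 2)) :
    HasPD (fun y => β (‖y‖ ^ 2)) (fun i => β' * (2 * x i)) x := by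
  have h := hβ.hasFDerivAt.comp x (hasStrictFDerivAt_norm_sq x).hasFDerivAt
  refine ⟨h.differentiableAt, fun i => ?_⟩
  unfold pd
  erw [h.fderiv]
  simp [EuclideanSpace.inner_single_right]
  ring

theorem pd_pd_of_hasPD {h : Fin 3 → E3 → ℂ} {h' : Fin 3 → ℂ} {i : Fin 3}
    (hf : ∀ᶠ y in 𝓝 x, HasPD f (fun i => h i y) y) (hh : HasPD (h i) h' x) (j : Fin 3) :
    pd j (pd i f) x = h' j := by
  rw [← hh.2 j]
  exact pd_congr (hf.mono fun y hy => hy.2 i) j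

theorem HasPD.eventually_pd (hf : ContDiffAt ℝ 2 f x) (i : Fin 3) :
    HasPD (pd i f) (fun j => pd j (pd i f) x) x :=
  hasPD_of_differentiableAt
    ((contDiffAt_pd hf (m := 1) (by norm_num) i).differentiableAt (by norm_num))

/-- The complex coordinate `x₁ + i x₂`. -/
noncomputable def zc (x : E3) : ℂ := x 1 + x 2 * Complex.I

theorem HasPD.zc : HasPD zc ![0, 1, Complex.I] x := by
  refine ((HasPD.coord 1).add ((HasPD.coord 2).mul (HasPD.const Complex.I))).congr fun i => ?_
  fin_cases i <;> simp

theorem HasPD.conj_zc : HasPD (fun y => conj (Contragenic.zc y)) ![0, 1, -Complex.I] x := by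
  have e : (fun y : E3 => conj (Contragenic.zc y)) =
      fun y : E3 => (y 1 : ℂ) + y 2 * (-Complex.I) := by
    funext y; simp [Contragenic.zc]
  rw [e]
  refine ((HasPD.coord 1).add ((HasPD.coord 2).mul (HasPD.const (-Complex.I)))).congr fun i => ?_
  fin_cases i <;> simp

theorem contDiff_zc {n : WithTop ℕ∞} : ContDiff ℝ n zc := by
  have h : ∀ j : Fin 3, ContDiff ℝ n (fun y : E3 => (y j : ℂ)) := fun j =>
    (Complex.ofRealCLM.comp
      (EuclideanSpace.proj j : E3 →L[ℝ] ℝ)).contDiff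
  exact (h 1).add ((h 2).mul contDiff_const)

theorem norm_sq_eq (x : E3) : ‖x‖ ^ 2 = x 0 ^ 2 + x 1 ^ 2 + x 2 ^ 2 := by
  rw [EuclideanSpace.norm_sq_eq, Fin.sum_univ_three]; simp

theorem norm_sq_eq_zc (x : E3) : ‖x‖ ^ 2 = x 0 ^ 2 + ‖zc x‖ ^ 2 := by
  rw [norm_sq_eq, Complex.sq_norm, Complex.normSq_apply]
  simp [zc]; ring

theorem norm_zc_le (x : E3) : ‖zc x‖ ≤ ‖x‖ := by
  refine le_of_sq_le_sq ?_ (norm_nonneg x)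
  rw [norm_sq_eq_zc]
  nlinarith [sq_nonneg (x 0)]

theorem abs_coord_le (x : E3) (i : Fin 3) : |x i| ≤ ‖x‖ := by
  simpa using PiLp.norm_apply_le x i

end PartialDerivatives

/-! ### The complexified Newtonian kernel -/

section Kernel

/-- The principal branch of `w ↦ w^(-1/2)`. -/
noncomputable def invSqrt (w : ℂ) : ℂ := w ^ (-(1 / 2) : ℂ)

theorem invSqrt_sq_mul {w : ℂ} (hw : w ≠ 0) : invSqrt w ^ 2 * w = 1 := by
  rw [invSqrt, ← Complex.cpow_nat_mul]
  have : ((2 : ℕ) : ℂ) * (-(1 / 2) : ℂ) = -1 := by push_cast; ring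
  rw [this, Complex.cpow_neg_one, inv_mul_cancel₀ hw]

theorem hasDerivAt_invSqrt {w : ℂ} (hw : w ∈ Complex.slitPlane) :
    HasDerivAt invSqrt (-(1 / 2) * invSqrt w ^ 3) w := by
  have h0 : w ≠ 0 := Complex.slitPlane_ne_zero hw
  have h := (hasDerivAt_id w).cpow_const (c := (-(1 / 2) : ℂ)) hw
  simp only [id, mul_one, Complex.cpow_sub _ _ h0, Complex.cpow_one] at h
  refine h.congr_deriv ?_
  have := invSqrt_sq_mul h0
  change -(1 / 2) * (invSqrt w / w) = _
  field_simp
  linear_combination invSqrt w * this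

theorem contDiffAt_invSqrt {w : ℂ} (hw : w ∈ Complex.slitPlane) {n : WithTop ℕ∞} :
    ContDiffAt ℝ n invSqrt w := by
  have : AnalyticAt ℂ invSqrt w := analyticAt_id.cpow analyticAt_const hw
  exact this.contDiffAt.restrict_scalars ℝ

theorem norm_invSqrt {w : ℂ} (hw : w ≠ 0) : ‖invSqrt w‖ = (Real.sqrt ‖w‖)⁻¹ := by
  have h := congrArg norm (invSqrt_sq_mul hw)
  rw [norm_mul, norm_pow, norm_one] at h
  have hp : 0 < ‖w‖ := norm_pos_iff.2 hw
  refine eq_inv_of_mul_eq_one_left ?_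
  have h1 : (‖invSqrt w‖ * Real.sqrt ‖w‖) ^ 2 = 1 := by
    rw [mul_pow, Real.sq_sqrt hp.le, h]
  exact (pow_eq_one_iff_of_nonneg (by positivity) two_ne_zero).1 h1

theorem invSqrt_ofReal {r : ℝ} (hr : 0 < r) : invSqrt (r : ℂ) = ((Real.sqrt r)⁻¹ : ℝ) := by
  rw [invSqrt, Real.sqrt_eq_rpow, ← Real.rpow_neg hr.le]
  rw [Complex.ofReal_cpow hr.le]
  push_cast; rfl

variable {a e s t : ℂ} {x : E3}

/-- The complexified squared distance `(x₀ - a)² + (z - t)(z̄ - s) + e`. -/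
noncomputable def cdist (a s t e : ℂ) (x : E3) : ℂ :=
  ((x 0 : ℂ) - a) ^ 2 + (zc x - t) * (conj (zc x) - s) + e

/-- The partial derivatives of `cdist`. -/
noncomputable def cdistGrad (a s t : ℂ) (i : Fin 3) (x : E3) : ℂ :=
  (![2 * ((x 0 : ℂ) - a), (conj (zc x) - s) + (zc x - t),
    Complex.I * (conj (zc x) - s) - Complex.I * (zc x - t)] : Fin 3 → ℂ) i

theorem hasPD_cdist : HasPD (cdist a s t e) (fun i => cdistGrad a s t i x) x := by
  refine (((((HasPD.coord 0).sub (HasPD.const a)).pow 2).add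
    ((HasPD.zc.sub (HasPD.const t)).mul (HasPD.conj_zc.sub (HasPD.const s)))).add
    (HasPD.const e)).congr fun i => ?_
  fin_cases i <;> simp [cdistGrad]
  ring

theorem hasPD_cdistGrad (i : Fin 3) :
    HasPD (cdistGrad a s t i) (fun j => if j = i then 2 else 0) x := by
  fin_cases i
  · refine (((HasPD.coord 0).sub (HasPD.const a)).const_mul 2).congr fun j => ?_
    fin_cases j <;> simp
  · refine ((HasPD.conj_zc.sub (HasPD.const s)).add (HasPD.zc.sub (HasPD.const t))).congr
      fun j => ?_
    fin_cases j <;> simp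
    norm_num
  · refine (((HasPD.conj_zc.sub (HasPD.const s)).const_mul Complex.I).sub
      ((HasPD.zc.sub (HasPD.const t)).const_mul Complex.I)).congr fun j => ?_
    fin_cases j <;> simp
    norm_num

theorem sum_cdistGrad_sq : cdistGrad a s t 0 x ^ 2 + cdistGrad a s t 1 x ^ 2 +
    cdistGrad a s t 2 x ^ 2 = 4 * (cdist a s t e x - e) := by
  simp only [cdistGrad, cdist]
  simp
  linear_combination ((conj (zc x) - s) - (zc x - t)) ^ 2 * Complex.I_sq

theorem contDiff_cdist {n : WithTop ℕ∞} : ContDiff ℝ n (cdist a s t e) := by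
  have h : ContDiff ℝ n (fun y : E3 => (y 0 : ℂ)) :=
    (Complex.ofRealCLM.comp
      (EuclideanSpace.proj 0 : E3 →L[ℝ] ℝ)).contDiff
  have hc : ContDiff ℝ n (fun y : E3 => conj (zc y)) :=
    Complex.conjCLE.contDiff.comp contDiff_zc
  exact (((h.sub contDiff_const).pow 2).add
    ((contDiff_zc.sub contDiff_const).mul (hc.sub contDiff_const))).add contDiff_const

/-- The (complexified, regularized) Newtonian kernel `cdist^(-1/2)`. -/
noncomputable def newton (a s t e : ℂ) (x : E3) : ℂ := invSqrt (cdist a s t e x)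

theorem contDiffAt_newton (hx : cdist a s t e x ∈ Complex.slitPlane) {n : WithTop ℕ∞} :
    ContDiffAt ℝ n (newton a s t e) x :=
  ContDiffAt.comp x (contDiffAt_invSqrt hx) contDiff_cdist.contDiffAt

theorem eventually_cdist_mem_slitPlane (hx : cdist a s t e x ∈ Complex.slitPlane) :
    ∀ᶠ y in 𝓝 x, cdist a s t e y ∈ Complex.slitPlane :=
  (contDiff_cdist (n := 1)).continuous.continuousAt.eventually
    (Complex.isOpen_slitPlane.mem_nhds hx)

theorem hasPD_newton (hx : cdist a s t e x ∈ Complex.slitPlane) :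
    HasPD (newton a s t e) (fun i => -(1 / 2) * newton a s t e x ^ 3 * cdistGrad a s t i x) x :=
  HasPD.comp (hasDerivAt_invSqrt hx) hasPD_cdist

/-- The squared gradient of `cdist` is `4(cdist - e)` as a polynomial identity, so the computation
for `|x|² + e` carries over to complex `a`, `s`, `t`. For `e = 0` the kernel is harmonic; for `e =
ε² > 0` and a real pole the right side concentrates at the pole as `ε → 0`. -/
theorem lap_newton (hx : cdist a s t e x ∈ Complex.slitPlane) :
    lap (newton a s t e) x = -3 * e * newton a s t e x ^ 5 := by
  have h2 : ∀ i, HasPD (fun y => -(1 / 2) * newton a s t e y ^ 3 * cdistGrad a s t i y) _ x :=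
    fun i => (((hasPD_newton hx).pow 3).const_mul (-(1 / 2))).mul (hasPD_cdistGrad i)
  have h1 := (eventually_cdist_mem_slitPlane hx).mono fun y hy => hasPD_newton hy
  simp only [lap, pd_pd_of_hasPD h1 (h2 _), Fin.sum_univ_three]
  have hq := sum_cdistGrad_sq (a := a) (s := s) (t := t) (e := e) (x := x)
  have hS := invSqrt_sq_mul (Complex.slitPlane_ne_zero hx)
  change newton a s t e x ^ 2 * cdist a s t e x = 1 at hS
  simp
  linear_combination (3 / 4) * newton a s t e x ^ 5 * hq + 3 * newton a s t e x ^ 3 * hS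

theorem pd_zero_newton (hx : cdist a s t e x ∈ Complex.slitPlane) :
    pd 0 (newton a s t e) x = -((x 0 : ℂ) - a) * newton a s t e x ^ 3 := by
  rw [(hasPD_newton hx).2]; simp [cdistGrad]; ring

/-- The first partial derivatives of `∂/∂x₀` of the Newtonian kernel. -/
theorem hasPD_pd_newton (hx : cdist a s t 0 x ∈ Complex.slitPlane) :
    HasPD (pd 0 (newton a s t 0)) (fun i => -(if i = 0 then 1 else 0) * newton a s t 0 x ^ 3 +
      (3 / 2) * ((x 0 : ℂ) - a) * newton a s t 0 x ^ 5 * cdistGrad a s t i x) x := by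
  have h : HasPD (fun y => -(1 / 2) * newton a s t 0 y ^ 3 * cdistGrad a s t 0 y) _ x :=
    (((hasPD_newton hx).pow 3).const_mul (-(1 / 2))).mul (hasPD_cdistGrad 0)
  have h1 : pd 0 (newton a s t 0) =ᶠ[𝓝 x]
      fun y => -(1 / 2) * newton a s t 0 y ^ 3 * cdistGrad a s t 0 y :=
    (eventually_cdist_mem_slitPlane hx).mono fun y hy => (hasPD_newton hy).2 0
  refine ⟨h.1.congr_of_eventuallyEq h1, fun i => ?_⟩
  rw [pd_congr h1, h.2 i]
  fin_cases i <;> simp [cdistGrad] <;> ring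

/-- Needed so that `∂₀N` may itself serve as the harmonic function `h`, which brings `∂₀²N` among
the admissible test functions. -/
theorem lap_pd_newton (hx : cdist a s t 0 x ∈ Complex.slitPlane) :
    lap (pd 0 (newton a s t 0)) x = 0 := by
  have hN := hasPD_newton hx
  have h2 : ∀ i : Fin 3, HasPD (fun y : E3 => -(if i = 0 then 1 else 0) * newton a s t 0 y ^ 3 +
      (3 / 2) * ((y 0 : ℂ) - a) * newton a s t 0 y ^ 5 * cdistGrad a s t i y) _ x := fun i =>
    ((hN.pow 3).const_mul (-(if i = 0 then 1 else 0))).add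
      (((((HasPD.coord 0).sub (HasPD.const a)).const_mul (3 / 2)).mul (hN.pow 5)).mul
        (hasPD_cdistGrad i))
  have h1 := (eventually_cdist_mem_slitPlane hx).mono fun y hy => hasPD_pd_newton hy
  simp only [lap, pd_pd_of_hasPD h1 (h2 _), Fin.sum_univ_three]
  have hq := sum_cdistGrad_sq (a := a) (s := s) (t := t) (e := 0) (x := x)
  have hS := invSqrt_sq_mul (Complex.slitPlane_ne_zero hx)
  change newton a s t 0 x ^ 2 * cdist a s t 0 x = 1 at hS
  have h0 : cdistGrad a s t 0 x = 2 * ((x 0 : ℂ) - a) := by simp [cdistGrad]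
  simp
  linear_combination (-(15 / 4)) * ((x 0 : ℂ) - a) * newton a s t 0 x ^ 7 * hq
    + (-15) * ((x 0 : ℂ) - a) * newton a s t 0 x ^ 5 * hS + 3 * newton a s t 0 x ^ 5 * h0

end Kernel

/-! ### The divergence theorem for compactly supported fields -/

section Divergence

theorem integral_pd_eq_zero {F : E3 → ℂ} (hF : ContDiff ℝ 1 F) (hc : HasCompactSupport F)
    (i : Fin 3) : ∫ x, pd i F x = 0 := by
  have hcd : HasCompactSupport (pd i F) :=
    (hc.fderiv (𝕜 := ℝ)).comp_left (g := fun L : E3 →L[ℝ] ℂ => L (EuclideanSpace.single i 1)) rfl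
  have hcont : Continuous (pd i F) := (contDiff_pd hF (m := 0) (by norm_num) i).continuous
  have hint : Integrable (fun x => pd i F x) := hcont.integrable_of_hasCompactSupport hcd
  have := integral_smul_fderiv_eq_neg_fderiv_smul_of_integrable (𝕜 := ℝ) (μ := volume)
    (f := fun _ : E3 => (1 : ℝ)) (g := F) (v := EuclideanSpace.single i 1)
    (by simp) (by simpa [pd] using hint)
    (by simpa using hF.continuous.integrable_of_hasCompactSupport hc)
    (fun x _ => by fun_prop) (fun x _ => hF.differentiable (by norm_num) x)
  simpa [pd] using this

theorem integral_sum_pd_eq_zero {F : Fin 3 → E3 → ℂ} (hF : ∀ i, ContDiff ℝ 1 (F i))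
    (hc : ∀ i, HasCompactSupport (F i)) : ∫ x, ∑ i, pd i (F i) x = 0 := by
  rw [integral_finsetSum]
  · exact Finset.sum_eq_zero fun i _ => integral_pd_eq_zero (hF i) (hc i) i
  · intro i _
    exact (contDiff_pd (hF i) (m := 0) (by norm_num) i).continuous.integrable_of_hasCompactSupport
      (((hc i).fderiv (𝕜 := ℝ)).comp_left
        (g := fun L : E3 →L[ℝ] ℂ => L (EuclideanSpace.single i 1)) rfl)

end Divergence

/-! ### Green's identity for radially modified sectorial harmonics -/

section Sectorial

theorem isOpen_exteriorBall : IsOpen exteriorBall := isOpen_lt continuous_const continuous_norm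

theorem isOpen_interiorBall : IsOpen interiorBall := isOpen_lt continuous_norm continuous_const

theorem HasPD.zc_pow_mul_comp_normSq {β : ℝ → ℂ} {β' : ℂ} {x : E3} (k : ℕ)
    (hβ : HasDerivAt β β' (‖x‖ ^ 2)) :
    HasPD (fun y => Contragenic.zc y ^ k * β (‖y‖ ^ 2)) (fun i =>
      (k * Contragenic.zc x ^ (k - 1) * (![0, 1, Complex.I] : Fin 3 → ℂ) i) * β (‖x‖ ^ 2) +
      Contragenic.zc x ^ k * (β' * (2 * x i))) x :=
  (HasPD.zc.pow k).mul (HasPD.comp_normSq hβ)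

/-- The polynomial `z^(k+1) x₀` is harmonic and homogeneous of degree `k+2`, so with `q = |x|²` the
Laplacian of its product with `β(q)` is `z^(k+1) x₀ (4qβ'' + (4k+14)β')`. This is `2 x₀ z^(k+1)
γ'(q)` for `γ = 2qβ' + (2k+5)β`, that is, the `x₀`-derivative of `z^(k+1) γ(q)`. -/
theorem lap_zc_pow_mul {β β₁ β₂ : ℝ → ℂ} (k : ℕ) (h1 : ∀ q, HasDerivAt β (β₁ q) q)
    (h2 : ∀ q, HasDerivAt β₁ (β₂ q) q) (x : E3) :
    lap (fun y : E3 => zc y ^ (k + 1) * β (‖y‖ ^ 2) * y 0) x =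
      pd 0 (fun y : E3 => zc y ^ (k + 1) *
        (2 * (‖y‖ ^ 2 : ℝ) * β₁ (‖y‖ ^ 2) + (2 * k + 5) * β (‖y‖ ^ 2))) x := by
  have hW := fun y : E3 => (HasPD.zc_pow_mul_comp_normSq (k + 1) (h1 (‖y‖ ^ 2))).mul
    (HasPD.coord 0 (x := y))
  have hγ : HasDerivAt (fun q : ℝ => 2 * (q : ℂ) * β₁ q + (2 * k + 5) * β q)
      (2 * β₁ (‖x‖ ^ 2) + 2 * (‖x‖ ^ 2 : ℝ) * β₂ (‖x‖ ^ 2) + (2 * k + 5) * β₁ (‖x‖ ^ 2))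
      (‖x‖ ^ 2) := by
    have hid : HasDerivAt (fun q : ℝ => 2 * (q : ℂ)) 2 (‖x‖ ^ 2) := by
      simpa using (Complex.ofRealCLM.hasDerivAt (x := ‖x‖ ^ 2)).const_mul 2
    exact (hid.mul (h2 _)).add ((h1 _).const_mul _)
  have hG := HasPD.zc_pow_mul_comp_normSq (k + 1) hγ
  have hWi : ∀ i : Fin 3, HasPD (fun y : E3 =>
      (((k + 1 : ℕ) * zc y ^ (k + 1 - 1) * (![0, 1, Complex.I] : Fin 3 → ℂ) i) * β (‖y‖ ^ 2) +
      zc y ^ (k + 1) * (β₁ (‖y‖ ^ 2) * (2 * y i))) * y 0 +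
      zc y ^ (k + 1) * β (‖y‖ ^ 2) * (if i = 0 then 1 else 0)) _ x := fun i =>
    (((((HasPD.zc.pow (k + 1 - 1)).const_mul (k + 1 : ℕ)).mul (HasPD.const _)).mul
      (HasPD.comp_normSq (h1 _))).add ((HasPD.zc.pow (k + 1)).mul
        ((HasPD.comp_normSq (h2 _)).mul ((HasPD.coord i).const_mul 2))) |>.mul
        (HasPD.coord 0)).add ((HasPD.zc_pow_mul_comp_normSq (k + 1) (h1 _)).mul (HasPD.const _))
  rw [hG.2]
  simp only [lap, pd_pd_of_hasPD (Eventually.of_forall hW) (hWi _), Fin.sum_univ_three]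
  have hz : zc x = x 1 + x 2 * Complex.I := rfl
  have hq : ((‖x‖ ^ 2 : ℝ) : ℂ) = x 0 ^ 2 + x 1 ^ 2 + x 2 ^ 2 := by
    rw [norm_sq_eq]; push_cast; ring
  simp only [hq]
  simp
  generalize β (‖x‖ ^ 2) = b
  generalize β₁ (‖x‖ ^ 2) = b1
  generalize β₂ (‖x‖ ^ 2) = b2
  rw [pow_succ (zc x) k]
  generalize zc x ^ (k - 1) = zk
  generalize zc x ^ k = zk1
  rw [hz]
  linear_combination ((k + 1) * k * zk * b * (x 0 : ℂ)) * Complex.I_sq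

/-- A function that vanishes for `‖x‖² ∉ [A, B]`, `1 < A`, and is smooth in the exterior of the unit
ball is smooth with compact support. -/
theorem contDiff_of_shell {F : E3 → ℂ} {A B : ℝ} {n : WithTop ℕ∞} (hA : 1 < A)
    (h0 : ∀ x, ‖x‖ ^ 2 ∉ Set.Icc A B → F x = 0) (hF : ∀ x ∈ exteriorBall, ContDiffAt ℝ n F x) :
    ContDiff ℝ n F ∧ HasCompactSupport F := by
  have hcl : IsClosed {x : E3 | ‖x‖ ^ 2 ∈ Set.Icc A B} :=
    isClosed_Icc.preimage (by fun_prop : Continuous fun x : E3 => ‖x‖ ^ 2)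
  have hts : tsupport F ⊆ {x : E3 | ‖x‖ ^ 2 ∈ Set.Icc A B} :=
    closure_minimal (fun x hx => by_contra fun hn => hx (h0 x hn)) hcl
  refine ⟨contDiff_iff_contDiffAt.2 fun x => ?_, ?_⟩
  · by_cases hx : x ∈ tsupport F
    swap
    · exact contDiffAt_const.congr_of_eventuallyEq (notMem_tsupport_iff_eventuallyEq.1 hx)
    refine hF x ?_
    have := (hts hx).1
    change 1 < ‖x‖
    by_contra! hle
    nlinarith [norm_nonneg x]
  · refine HasCompactSupport.of_support_subset_isCompact
      (isCompact_closedBall (0 : E3) (|B| + 1)) fun x hx => ?_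
    have := (hts (subset_tsupport _ hx)).2
    simp only [Metric.mem_closedBall, dist_zero_right]
    by_contra! hlt
    nlinarith [norm_nonneg x, le_abs_self B, abs_nonneg B]

/-- Put `G = z^(k+1)(2qβ' + (2k+5)β)` and `W = z^(k+1)β x₀`, so that `ΔW = ∂₀G`. The field `G h e₀ +
W∇h - h∇W` has divergence `G ∂₀h`, because `Δh = 0` and the two remaining terms cancel. -/
theorem integral_zc_pow_mul_pd_eq_zero {h : E3 → ℂ} (hh : ContDiffOn ℝ ∞ h exteriorBall)
    (hlap : ∀ x ∈ exteriorBall, lap h x = 0) (k : ℕ) {β : ℝ → ℂ} (hβ : ContDiff ℝ ∞ β) {A B : ℝ}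
    (hA : 1 < A) (h0 : ∀ q, q ∉ Set.Icc A B → β q = 0) :
    ∫ x : E3, zc x ^ (k + 1) *
      (2 * (‖x‖ ^ 2 : ℝ) * deriv β (‖x‖ ^ 2) + (2 * k + 5) * β (‖x‖ ^ 2)) * pd 0 h x = 0 := by
  have hβ' : ContDiff ℝ ∞ (deriv β) := ((contDiff_infty_iff_deriv).1 hβ).2
  have h1 : ∀ q, HasDerivAt β (deriv β q) q := fun q =>
    (hβ.differentiable (by simp) q).hasDerivAt
  have h2 : ∀ q, HasDerivAt (deriv β) (deriv (deriv β) q) q := fun q =>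
    (hβ'.differentiable (by simp) q).hasDerivAt
  have h0' : ∀ q, q ∉ Set.Icc A B → deriv β q = 0 := by
    intro q hq
    have : β =ᶠ[𝓝 q] fun _ => 0 :=
      (isClosed_Icc.isOpen_compl.mem_nhds hq : (Set.Icc A B)ᶜ ∈ 𝓝 q) |> fun hm =>
        Filter.mem_of_superset hm fun y hy => h0 y hy
    rw [this.deriv_eq, deriv_const]
  set G : E3 → ℂ := fun x => zc x ^ (k + 1) *
    (2 * (‖x‖ ^ 2 : ℝ) * deriv β (‖x‖ ^ 2) + (2 * k + 5) * β (‖x‖ ^ 2)) with hG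
  set W : E3 → ℂ := fun x => zc x ^ (k + 1) * β (‖x‖ ^ 2) * x 0 with hW
  have hnsq : ContDiff ℝ ∞ fun x : E3 => ‖x‖ ^ 2 := contDiff_norm_sq ℝ
  have hGs : ContDiff ℝ ∞ G :=
    (contDiff_zc.pow _).mul (((contDiff_const.mul (Complex.ofRealCLM.contDiff.comp hnsq)).mul
      (hβ'.comp hnsq)).add (contDiff_const.mul (hβ.comp hnsq)))
  have hx0 : ContDiff ℝ ∞ (fun y : E3 => (y 0 : ℂ)) :=
    (Complex.ofRealCLM.comp (EuclideanSpace.proj 0 : E3 →L[ℝ] ℝ)).contDiff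
  have hWs : ContDiff ℝ ∞ W := ((contDiff_zc.pow _).mul (hβ.comp hnsq)).mul hx0
  have hG0 : ∀ x : E3, ‖x‖ ^ 2 ∉ Set.Icc A B → G x = 0 := fun x hx => by
    simp [hG, h0 _ hx, h0' _ hx]
  have hW0 : ∀ x : E3, ‖x‖ ^ 2 ∉ Set.Icc A B → W =ᶠ[𝓝 x] fun _ => 0 := fun x hx => by
    have ho : IsOpen {y : E3 | ‖y‖ ^ 2 ∉ Set.Icc A B} :=
      isClosed_Icc.isOpen_compl.preimage (by fun_prop : Continuous fun x : E3 => ‖x‖ ^ 2)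
    filter_upwards [ho.mem_nhds hx] with y hy
    simp [hW, h0 _ hy]
  have hsm : ∀ x ∈ exteriorBall, ContDiffAt ℝ ∞ h x := fun x hx =>
    hh.contDiffAt (isOpen_exteriorBall.mem_nhds hx)
  have hpd : ∀ i, ∀ x ∈ exteriorBall, ContDiffAt ℝ ∞ (pd i h) x := fun i x hx =>
    contDiffAt_pd (hsm x hx) (by simp) i
  -- The support of `β` keeps this field away from the unit sphere and from infinity, so no boundary
  -- behaviour of `h` enters.
  set F : Fin 3 → E3 → ℂ := fun i x =>
    (if i = 0 then 1 else 0) * (G x * h x) + W x * pd i h x - h x * pd i W x with hF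
  have hF0 : ∀ i, ∀ x : E3, ‖x‖ ^ 2 ∉ Set.Icc A B → F i x = 0 := fun i x hx => by
    have e : pd i W x = 0 := by rw [pd_congr (hW0 x hx)]; simp [pd]
    simp only [hF, hG0 x hx, e, (hW0 x hx).self_of_nhds]
    simp
  have hFs := fun i => contDiff_of_shell hA (hF0 i) (n := 1) fun x hx =>
    (((contDiffAt_const.mul (hGs.contDiffAt.mul (hsm x hx))).add
      (hWs.contDiffAt.mul (hpd i x hx))).sub
      ((hsm x hx).mul (contDiff_pd hWs (m := ∞) (by simp) i).contDiffAt)).of_le (by norm_cast)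
  have key := integral_sum_pd_eq_zero (fun i => (hFs i).1) (fun i => (hFs i).2)
  rw [← key]
  refine integral_congr_ae (ae_of_all _ fun x => ?_)
  change G x * pd 0 h x = _
  by_cases hx : ‖x‖ ^ 2 ∈ Set.Icc A B
  · have hxe : x ∈ exteriorBall := by
      have := hx.1
      change 1 < ‖x‖
      by_contra! hle
      nlinarith [norm_nonneg x]
    have hG1 := hasPD_of_differentiableAt (hGs.differentiable (by simp) x)
    have hW1 := hasPD_of_differentiableAt (hWs.differentiable (by simp) x)
    have hh1 := hasPD_of_differentiableAt ((hsm x hxe).differentiableAt (by simp))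
    have hh2 := fun i => HasPD.eventually_pd ((hsm x hxe).of_le (by norm_cast)) i
    have hW2 := fun i => HasPD.eventually_pd (hWs.contDiffAt.of_le (by norm_cast) :
      ContDiffAt ℝ 2 W x) i
    have hFi := fun i : Fin 3 => ((((hG1.mul hh1).const_mul (if i = 0 then 1 else 0)).add
      (hW1.mul (hh2 i))).sub (hh1.mul (hW2 i))).2 i
    have hl := hlap x hxe
    have hWl := lap_zc_pow_mul k h1 h2 x
    change lap W x = pd 0 G x at hWl
    simp only [lap, Fin.sum_univ_three] at hl hWl
    simp only [hF, hFi, Fin.sum_univ_three]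
    simp
    linear_combination h x * hWl - W x * hl
  · rw [hG0 x hx, zero_mul, eq_comm]
    refine Finset.sum_eq_zero fun i _ => ?_
    have ho : IsOpen {y : E3 | ‖y‖ ^ 2 ∉ Set.Icc A B} :=
      isClosed_Icc.isOpen_compl.preimage (by fun_prop : Continuous fun x : E3 => ‖x‖ ^ 2)
    have : F i =ᶠ[𝓝 x] fun _ => 0 := by
      filter_upwards [ho.mem_nhds hx] with y hy using hF0 i y hy
    rw [pd_congr this]; simp [pd]

end Sectorial

/-! ### Smooth steps and the radial profiles exhausting the exterior -/

section Cutoff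

/-- A smooth step function: `0` for `t ≤ 1` and `1` for `t ≥ 2`. -/
noncomputable def step (t : ℝ) : ℝ := Real.smoothTransition (t - 1)

theorem contDiff_step : ContDiff ℝ ∞ step :=
  Real.smoothTransition.contDiff.comp (contDiff_id.sub contDiff_const)

theorem step_of_le {t : ℝ} (ht : t ≤ 1) : step t = 0 :=
  Real.smoothTransition.zero_of_nonpos (by linarith)

theorem step_of_ge {t : ℝ} (ht : 2 ≤ t) : step t = 1 :=
  Real.smoothTransition.one_of_one_le (by linarith)

theorem step_nonneg (t : ℝ) : 0 ≤ step t := Real.smoothTransition.nonneg _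

theorem step_le_one (t : ℝ) : step t ≤ 1 := Real.smoothTransition.le_one _

theorem contDiff_deriv_step : ContDiff ℝ ∞ (deriv step) :=
  ((contDiff_infty_iff_deriv).1 contDiff_step).2

theorem contDiff_deriv_deriv_step : ContDiff ℝ ∞ (deriv (deriv step)) :=
  ((contDiff_infty_iff_deriv).1 contDiff_deriv_step).2

theorem hasDerivAt_step (t : ℝ) : HasDerivAt step (deriv step t) t :=
  (contDiff_step.differentiable (by simp) t).hasDerivAt

theorem hasDerivAt_deriv_step (t : ℝ) : HasDerivAt (deriv step) (deriv (deriv step) t) t :=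
  (contDiff_deriv_step.differentiable (by simp) t).hasDerivAt

theorem step_eventuallyEq_const {t : ℝ} (ht : t ∉ Set.Icc (1 : ℝ) 2) :
    ∃ c : ℝ, step =ᶠ[𝓝 t] fun _ => c := by
  rcases lt_or_ge t 1 with h | h
  · exact ⟨0, by filter_upwards [Iio_mem_nhds h] with y hy using step_of_le (le_of_lt hy)⟩
  · have h2 : 2 < t := by
      by_contra! h2
      exact ht ⟨h, h2⟩
    exact ⟨1, by filter_upwards [Ioi_mem_nhds h2] with y hy using step_of_ge (le_of_lt hy)⟩

theorem deriv_step_eq_zero {t : ℝ} (ht : t ∉ Set.Icc (1 : ℝ) 2) : deriv step t = 0 := by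
  obtain ⟨c, hc⟩ := step_eventuallyEq_const ht
  rw [hc.deriv_eq, deriv_const]

theorem deriv_deriv_step_eq_zero {t : ℝ} (ht : t ∉ Set.Icc (1 : ℝ) 2) :
    deriv (deriv step) t = 0 := by
  obtain ⟨c, hc⟩ := step_eventuallyEq_const ht
  rw [hc.deriv.deriv_eq]; simp

theorem exists_step_bound : ∃ M : ℝ, 0 ≤ M ∧ ∀ t, |deriv step t| ≤ M ∧ |deriv (deriv step) t| ≤ M := by
  have h : ∀ g : ℝ → ℝ, Continuous g → (∀ t, t ∉ Set.Icc (1 : ℝ) 2 → g t = 0) →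
      ∃ M : ℝ, 0 ≤ M ∧ ∀ t, |g t| ≤ M := by
    intro g hg h0
    obtain ⟨C, hC⟩ := (isCompact_Icc (a := (1 : ℝ)) (b := 2)).exists_bound_of_continuousOn
      hg.continuousOn
    refine ⟨|C|, abs_nonneg C, fun t => ?_⟩
    by_cases ht : t ∈ Set.Icc (1 : ℝ) 2
    · exact (hC t ht).trans (le_abs_self C)
    · rw [h0 t ht, abs_zero]; exact abs_nonneg C
  obtain ⟨M₁, h₁, H₁⟩ := h _ contDiff_deriv_step.continuous fun t => deriv_step_eq_zero
  obtain ⟨M₂, h₂, H₂⟩ := h _ contDiff_deriv_deriv_step.continuous fun t => deriv_deriv_step_eq_zero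
  exact ⟨max M₁ M₂, le_max_of_le_left h₁, fun t =>
    ⟨(H₁ t).trans (le_max_left _ _), (H₂ t).trans (le_max_right _ _)⟩⟩

/-- A smooth function with compact support in `(1, ∞)` whose derivative tends to `1` there. -/
noncomputable def profile (n : ℝ) (q : ℝ) : ℝ := (q - 1) * step (n * (q - 1)) * (1 - step (q / n))

theorem contDiff_profile (n : ℝ) : ContDiff ℝ ∞ (profile n) :=
  ((contDiff_id.sub contDiff_const).mul (contDiff_step.comp
    (contDiff_const.mul (contDiff_id.sub contDiff_const)))).mul
    (contDiff_const.sub (contDiff_step.comp (contDiff_id.div_const n)))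

theorem profile_eq_zero {n q : ℝ} (hn : 0 < n) (hq : q ∉ Set.Icc (1 + 1 / n) (2 * n)) :
    profile n q = 0 := by
  rcases lt_or_ge q (1 + 1 / n) with h | h
  · have : n * (q - 1) ≤ 1 := by
      have := mul_le_mul_of_nonneg_left h.le hn.le
      rw [mul_add, mul_one_div_cancel hn.ne'] at this
      linarith
    simp [profile, step_of_le this]
  · have h2 : 2 * n < q := by
      by_contra! h2
      exact hq ⟨h, h2⟩
    have : 2 ≤ q / n := by rw [le_div_iff₀ hn]; exact h2.le
    simp [profile, step_of_ge this]

theorem hasDerivAt_profile (n q : ℝ) : HasDerivAt (profile n)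
    ((step (n * (q - 1)) + n * (q - 1) * deriv step (n * (q - 1))) * (1 - step (q / n)) -
      (q - 1) / n * step (n * (q - 1)) * deriv step (q / n)) q := by
  have h1 : HasDerivAt (fun q => step (n * (q - 1))) (deriv step (n * (q - 1)) * (n * 1)) q :=
    (hasDerivAt_step _).comp q (((hasDerivAt_id q).sub_const 1).const_mul n)
  have h2 : HasDerivAt (fun q => step (q / n)) (deriv step (q / n) * (1 / n)) q :=
    (hasDerivAt_step _).comp q ((hasDerivAt_id q).div_const n)
  have := ((((hasDerivAt_id q).sub_const 1).mul h1).mul (h2.const_sub 1))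
  refine this.congr_deriv ?_
  simp only [id, Pi.mul_apply]
  ring

/-- The factor `q - 1` compensates the steepness `n` of the inner cutoff: differentiating the steps
only produces terms controlled by `t · step' t`, which is bounded because `step'` lives on `[1, 2]`.
A uniform bound is what dominated convergence in `n` requires. -/
theorem exists_deriv_profile_bound :
    ∃ M : ℝ, ∀ n q : ℝ, 1 ≤ n → 1 < q → |deriv (profile n) q| ≤ M := by
  obtain ⟨M, hM, H⟩ := exists_step_bound
  have key : ∀ t, |t * deriv step t| ≤ 2 * M := by
    intro t
    by_cases ht : t ∈ Set.Icc (1 : ℝ) 2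
    · rw [abs_mul, abs_of_nonneg (by linarith [ht.1])]
      exact mul_le_mul ht.2 (H t).1 (abs_nonneg _) (by norm_num)
    · rw [deriv_step_eq_zero ht]; simpa using hM
  refine ⟨1 + 2 * M + 2 * M, fun n q hn hq => ?_⟩
  have hn0 : 0 < n := by linarith
  rw [(hasDerivAt_profile n q).deriv]
  refine (abs_sub _ _).trans (add_le_add ?_ ?_)
  · rw [abs_mul, abs_of_nonneg (sub_nonneg.2 (step_le_one _))]
    refine (mul_le_of_le_one_right (abs_nonneg _) (by linarith [step_nonneg (q / n)])).trans ?_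
    refine (abs_add_le _ _).trans (add_le_add ?_ (key _))
    rw [abs_of_nonneg (step_nonneg _)]; exact step_le_one _
  · have e : |(q - 1) / n * step (n * (q - 1)) * deriv step (q / n)| ≤
        |q / n * deriv step (q / n)| := by
      rw [abs_mul, abs_mul, abs_mul, abs_of_nonneg (step_nonneg _)]
      refine mul_le_mul_of_nonneg_right ?_ (abs_nonneg _)
      have h1 : |(q - 1) / n| ≤ |q / n| := by
        rw [abs_of_nonneg (div_nonneg (by linarith) hn0.le),
          abs_of_nonneg (div_nonneg (by linarith) hn0.le)]
        gcongr; linarith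
      exact (mul_le_of_le_one_right (abs_nonneg _) (step_le_one _)).trans h1
    exact e.trans (key _)

theorem tendsto_deriv_profile {q : ℝ} (hq : 1 < q) :
    Tendsto (fun n : ℕ => deriv (profile n) q) atTop (𝓝 1) := by
  refine tendsto_const_nhds.congr' ?_
  have h1 : ∀ᶠ n : ℕ in atTop, (2 / (q - 1) + q + 1 : ℝ) < n :=
    tendsto_natCast_atTop_atTop.eventually_gt_atTop _
  filter_upwards [h1] with n hn
  have hq1 : 0 < q - 1 := by linarith
  have hp : 0 < 2 / (q - 1) := by positivity
  have hn0 : (0 : ℝ) < n := by linarith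
  have e1 : 2 < (n : ℝ) * (q - 1) := by
    rw [← div_lt_iff₀ hq1]; linarith
  have e2 : q / n < 1 := by rw [div_lt_one hn0]; linarith
  rw [(hasDerivAt_profile n q).deriv, step_of_ge e1.le, step_of_le e2.le,
    deriv_step_eq_zero (fun h => by linarith [h.2]), deriv_step_eq_zero (fun h => by linarith [h.1])]
  ring

end Cutoff

/-! ### Square integrability in the exterior -/

section SquareIntegrable

theorem integrable_norm_inv_pow : IntegrableOn (fun x : E3 => (‖x‖ ^ 4)⁻¹) exteriorBall := by
  have h : Integrable (fun x : E3 => (1 + ‖x‖) ^ (-(4 : ℝ))) :=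
    integrable_one_add_norm (by simp; norm_num)
  refine (h.integrableOn.const_mul 16).mono' (by fun_prop) ?_
  filter_upwards [ae_restrict_mem isOpen_exteriorBall.measurableSet] with x hx
  have hx : 1 < ‖x‖ := hx
  have e : (1 + ‖x‖) ^ (-(4 : ℝ)) = ((1 + ‖x‖) ^ 4)⁻¹ := by
    rw [Real.rpow_neg (by positivity)]; norm_cast
  rw [e, Real.norm_of_nonneg (by positivity), ← div_eq_mul_inv, ← one_div,
    div_le_div_iff₀ (by positivity) (by positivity)]
  have : (1 + ‖x‖) ^ 4 ≤ (2 * ‖x‖) ^ 4 := by gcongr; linarith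
  nlinarith

theorem memLp_norm_inv_sq :
    MemLp (fun x : E3 => (‖x‖ ^ 2)⁻¹) 2 (volume.restrict exteriorBall) := by
  rw [memLp_two_iff_integrable_sq (by fun_prop)]
  refine integrable_norm_inv_pow.congr (ae_of_all _ fun x => ?_)
  simp only [inv_pow]; ring_nf

/-- In dimension three `|x|⁻⁴` is integrable at infinity while `|x|⁻²` is not. So decay of order
`|x|⁻²` suffices for `L²`, and `1/|x|` itself is not in the space. -/
theorem memLp_exterior_of_bound {F : Type*} [NormedAddCommGroup F] {f : E3 → F} {C : ℝ}
    (hm : ContinuousOn f exteriorBall) (hf : ∀ x ∈ exteriorBall, ‖f x‖ ≤ C * (‖x‖ ^ 2)⁻¹) :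
    MemLp f 2 (volume.restrict exteriorBall) := by
  refine (memLp_norm_inv_sq.const_mul C).mono
    (hm.aestronglyMeasurable isOpen_exteriorBall.measurableSet) ?_
  filter_upwards [ae_restrict_mem isOpen_exteriorBall.measurableSet] with x hx
  exact (hf x hx).trans (le_abs_self _)

end SquareIntegrable

/-! ### Sectorial harmonics are orthogonal to `x₀`-derivatives -/

section SectorialOrthogonality

/-- The sectorial exterior harmonic `z^k / |x|^(2k+1)`. -/
noncomputable def sect (k : ℕ) (x : E3) : ℂ := zc x ^ k * (((‖x‖ ^ (2 * k + 1))⁻¹ : ℝ) : ℂ)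

theorem norm_sect_le (k : ℕ) {x : E3} (hx : x ≠ 0) : ‖sect k x‖ ≤ (‖x‖ ^ (k + 1))⁻¹ := by
  have h : 0 < ‖x‖ := norm_pos_iff.2 hx
  rw [sect, norm_mul, norm_pow, Complex.norm_real, Real.norm_of_nonneg (by positivity)]
  calc ‖zc x‖ ^ k * (‖x‖ ^ (2 * k + 1))⁻¹ ≤ ‖x‖ ^ k * (‖x‖ ^ (2 * k + 1))⁻¹ := by
        gcongr; exact norm_zc_le x
    _ = (‖x‖ ^ (k + 1))⁻¹ := by field_simp; ring

theorem ne_zero_of_mem_exteriorBall {x : E3} (hx : x ∈ exteriorBall) : x ≠ 0 := by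
  have h : 1 < ‖x‖ := hx
  exact norm_pos_iff.1 (by linarith)

theorem continuousOn_sect (k : ℕ) : ContinuousOn (sect k) exteriorBall := by
  have hz : Continuous zc := (contDiff_zc (n := 0)).continuous
  refine (hz.pow k).continuousOn.mul ?_
  refine Complex.continuous_ofReal.comp_continuousOn ?_
  refine ContinuousOn.inv₀ (by fun_prop) fun x hx => ?_
  exact pow_ne_zero _ (norm_ne_zero_iff.2 (ne_zero_of_mem_exteriorBall hx))

/-- The shift to `k + 1` excludes `sect 0 = 1/|x|`, which fails to be square integrable; this
matches the condition `n ≤ -2`. -/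
theorem memLp_sect (k : ℕ) : MemLp (sect (k + 1)) 2 (volume.restrict exteriorBall) := by
  refine memLp_exterior_of_bound (C := 1) (continuousOn_sect _) fun x hx => ?_
  refine (norm_sect_le (k + 1) (ne_zero_of_mem_exteriorBall hx)).trans ?_
  have hx : 1 < ‖x‖ := hx
  rw [one_mul]
  gcongr
  · exact hx.le
  · omega

variable {h : E3 → ℂ}

/-- Take `β = q^p · profile n` in Green's identity and let `n → ∞`. No boundary term survives,
because the derivatives of the profiles are uniformly bounded and tend to `1` pointwise. -/
theorem integral_sect_mul_pd (hh : ContDiffOn ℝ ∞ h exteriorBall)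
    (hlap : ∀ x ∈ exteriorBall, lap h x = 0)
    (hL : MemLp (pd 0 h) 2 (volume.restrict exteriorBall)) (k : ℕ) :
    ∫ x in exteriorBall, sect (k + 1) x * pd 0 h x = 0 := by
  obtain ⟨M, hM⟩ := exists_deriv_profile_bound
  -- This exponent solves `2qβ' + (2k+5)β = 0` for `β = q^p`. Hence only the derivative of the
  -- profile remains, multiplied by `2 q^(p+1) = 2|x|^(-(2k+3))`, the radial factor of `sect (k +
  -- 1)`.
  set p : ℝ := -((k : ℝ) + 5 / 2) with hp
  set β : ℕ → ℝ → ℝ := fun n q => q ^ p * profile n q with hβ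
  have hint : Integrable (fun x => sect (k + 1) x * pd 0 h x) (volume.restrict exteriorBall) :=
    MemLp.integrable_mul (p := 2) (q := 2) (memLp_sect k) hL
  have hβs : ∀ n : ℕ, 1 ≤ n → ContDiff ℝ ∞ (β n) := by
    intro n hn
    have hn0 : (0 : ℝ) < n := by exact_mod_cast hn
    refine contDiff_iff_contDiffAt.2 fun q => ?_
    rcases lt_or_ge q 1 with hq | hq
    · refine contDiffAt_const (c := (0 : ℝ)) |>.congr_of_eventuallyEq ?_
      filter_upwards [Iio_mem_nhds hq] with y hy
      have : profile n y = 0 := profile_eq_zero hn0 fun h => by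
        have h1 := h.1
        have : (0 : ℝ) < 1 / n := by positivity
        have hy : y < 1 := hy
        linarith
      simp [hβ, this]
    · exact (contDiffAt_id.rpow_const_of_ne (by simp; linarith)).mul
        (contDiff_profile n).contDiffAt
  have hz : ∀ n : ℕ, 1 ≤ n → ∫ x in exteriorBall, sect (k + 1) x *
      (deriv (profile n) (‖x‖ ^ 2) : ℝ) * pd 0 h x = 0 := by
    intro n hn
    have hn0 : (0 : ℝ) < n := by exact_mod_cast hn
    have hn1 : (0 : ℝ) < 1 / n := by positivity
    have hbc : ContDiff ℝ ∞ (fun q => (β n q : ℂ)) := Complex.ofRealCLM.contDiff.comp (hβs n hn)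
    have hd : ∀ q, deriv (fun q => (β n q : ℂ)) q = (deriv (β n) q : ℝ) := fun q =>
      (((hβs n hn).differentiable (by simp) q).hasDerivAt.ofReal_comp).deriv
    have h0 := integral_zc_pow_mul_pd_eq_zero hh hlap k hbc (A := 1 + 1 / n) (B := 2 * n)
      (by linarith) fun q hq => by simp [hβ, profile_eq_zero hn0 hq]
    rw [← setIntegral_eq_integral_of_forall_compl_eq_zero (s := exteriorBall)] at h0
    · have e : ∀ x ∈ exteriorBall, zc x ^ (k + 1) * (2 * (‖x‖ ^ 2 : ℝ) *
          deriv (fun q => (β n q : ℂ)) (‖x‖ ^ 2) + (2 * k + 5) * (β n (‖x‖ ^ 2) : ℂ)) * pd 0 h x =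
          2 * (sect (k + 1) x * (deriv (profile n) (‖x‖ ^ 2) : ℝ) * pd 0 h x) := by
        intro x hx
        have hx1 : 1 < ‖x‖ := hx
        have hq : (0 : ℝ) < ‖x‖ ^ 2 := by positivity
        have hx0 : 0 < ‖x‖ := by linarith
        have h1 : deriv (β n) (‖x‖ ^ 2) = p * (‖x‖ ^ 2) ^ (p - 1) * profile n (‖x‖ ^ 2) +
            (‖x‖ ^ 2) ^ p * deriv (profile n) (‖x‖ ^ 2) :=
          ((Real.hasDerivAt_rpow_const (Or.inl hq.ne')).mul
            ((contDiff_profile n).differentiable (by simp) _).hasDerivAt).deriv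
        have h2 : (‖x‖ ^ 2) ^ (p - 1) = (‖x‖ ^ 2) ^ p / ‖x‖ ^ 2 := by
          rw [Real.rpow_sub hq, Real.rpow_one]
        have h3 : (‖x‖ ^ 2) ^ p * ‖x‖ ^ 2 = (‖x‖ ^ (2 * (k + 1) + 1))⁻¹ := by
          nth_rewrite 2 [← Real.rpow_one (‖x‖ ^ 2)]
          rw [← Real.rpow_add hq, ← Real.rpow_natCast, ← Real.rpow_natCast, ← Real.rpow_mul hx0.le,
            ← Real.rpow_neg hx0.le]
          congr 1
          push_cast
          rw [hp]; ring
        have hreal : 2 * ‖x‖ ^ 2 * deriv (β n) (‖x‖ ^ 2) + (2 * k + 5) * β n (‖x‖ ^ 2) =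
            2 * ((‖x‖ ^ (2 * (k + 1) + 1))⁻¹ * deriv (profile n) (‖x‖ ^ 2)) := by
          rw [h1, h2, ← h3, hβ, hp]
          field_simp
          ring
        have hc := congrArg (Complex.ofReal) hreal
        push_cast at hc
        rw [hd, sect]
        push_cast
        rw [hc]
        ring
      rw [setIntegral_congr_fun isOpen_exteriorBall.measurableSet e, integral_const_mul] at h0
      simpa using h0
    · intro x hx
      have hx : ‖x‖ ≤ 1 := not_lt.1 hx
      have hq : ‖x‖ ^ 2 < 1 + 1 / n := by nlinarith [norm_nonneg x]
      have hev : (fun q => (β n q : ℂ)) =ᶠ[𝓝 (‖x‖ ^ 2)] fun _ => 0 := by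
        filter_upwards [Iio_mem_nhds hq] with y hy
        have : profile n y = 0 := profile_eq_zero hn0 fun h => by
          have := h.1
          have hy : y < 1 + 1 / n := hy
          linarith
        simp [hβ, this]
      have e0 : (β n (‖x‖ ^ 2) : ℂ) = 0 := hev.self_of_nhds
      rw [hev.deriv_eq, e0]
      simp
  have hlim : Tendsto (fun n : ℕ => ∫ x in exteriorBall, sect (k + 1) x *
      (deriv (profile n) (‖x‖ ^ 2) : ℝ) * pd 0 h x) atTop
      (𝓝 (∫ x in exteriorBall, sect (k + 1) x * (1 : ℝ) * pd 0 h x)) := by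
    refine tendsto_integral_filter_of_dominated_convergence
      (fun x => M * ‖sect (k + 1) x * pd 0 h x‖) ?_ ?_ (hint.norm.const_mul M) ?_
    · refine Eventually.of_forall fun n => ?_
      refine ((memLp_sect k).1.mul ?_).mul hL.1
      refine Continuous.aestronglyMeasurable ?_
      exact Complex.continuous_ofReal.comp (((contDiff_infty_iff_deriv).1
        (contDiff_profile n)).2.continuous.comp (by fun_prop))
    · filter_upwards [eventually_ge_atTop 1] with n hn
      filter_upwards [ae_restrict_mem isOpen_exteriorBall.measurableSet] with x hx
      have hx : 1 < ‖x‖ := hx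
      have := hM n (‖x‖ ^ 2) (by exact_mod_cast hn) (by nlinarith)
      rw [norm_mul, norm_mul, Complex.norm_real, norm_mul, Real.norm_eq_abs]
      calc _ = |deriv (profile n) (‖x‖ ^ 2)| * (‖sect (k + 1) x‖ * ‖pd 0 h x‖) := by ring
        _ ≤ _ := by gcongr
    · filter_upwards [ae_restrict_mem isOpen_exteriorBall.measurableSet] with x hx
      have hx : 1 < ‖x‖ := hx
      have := tendsto_deriv_profile (q := ‖x‖ ^ 2) (by nlinarith)
      exact ((((Complex.continuous_ofReal.tendsto _).comp this).const_mul _).mul_const _)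
  have h0 : Tendsto (fun n : ℕ => ∫ x in exteriorBall, sect (k + 1) x *
      (deriv (profile n) (‖x‖ ^ 2) : ℝ) * pd 0 h x) atTop (𝓝 0) :=
    tendsto_const_nhds.congr' (by filter_upwards [eventually_ge_atTop 1] with n hn using (hz n hn).symm)
  have := tendsto_nhds_unique hlim h0
  simpa using this

/-- Applying the complex statement to both `h` and its conjugate separates the real and imaginary
parts of `sect`, since `∂₀` commutes with conjugation. -/
theorem integral_re_im_sect_mul_pd (hh : ContDiffOn ℝ ∞ h exteriorBall)
    (hlap : ∀ x ∈ exteriorBall, lap h x = 0)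
    (hL : MemLp (pd 0 h) 2 (volume.restrict exteriorBall)) (k : ℕ) :
    ∫ x in exteriorBall, ((sect (k + 1) x).re : ℂ) * pd 0 h x = 0 ∧
    ∫ x in exteriorBall, ((sect (k + 1) x).im : ℂ) * pd 0 h x = 0 := by
  have h1 := integral_sect_mul_pd hh hlap hL k
  set l : ℂ →L[ℝ] ℂ := (Complex.conjCLE : ℂ →L[ℝ] ℂ) with hl
  have hsm : ∀ x ∈ exteriorBall, ContDiffAt ℝ ∞ h x := fun x hx =>
    hh.contDiffAt (isOpen_exteriorBall.mem_nhds hx)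
  have hp : ∀ x ∈ exteriorBall, pd 0 (fun y => l (h y)) x = conj (pd 0 h x) := fun x hx =>
    pd_clm_comp l ((hsm x hx).differentiableAt (by simp)) 0
  have h2 := integral_sect_mul_pd (h := fun y => l (h y)) (l.contDiff.comp_contDiffOn hh)
    (fun x hx => by
      rw [lap_clm_comp l ((hsm x hx).of_le (by norm_cast)), hlap x hx, map_zero])
    ((l.comp_memLp' hL).ae_eq ((ae_restrict_mem isOpen_exteriorBall.measurableSet).mono
      fun x hx => (hp x hx).symm)) k
  have h3 : ∫ x in exteriorBall, conj (sect (k + 1) x) * pd 0 h x = 0 := by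
    have e : ∫ x in exteriorBall, conj (sect (k + 1) x) * pd 0 h x =
        conj (∫ x in exteriorBall, sect (k + 1) x * pd 0 (fun y => l (h y)) x) := by
      rw [← integral_conj]
      exact setIntegral_congr_fun isOpen_exteriorBall.measurableSet fun x hx => by
        simp only [hp x hx, map_mul, Complex.conj_conj]
    rw [e, h2, map_zero]
  have i1 : Integrable (fun x => sect (k + 1) x * pd 0 h x) (volume.restrict exteriorBall) :=
    MemLp.integrable_mul (p := 2) (q := 2) (memLp_sect k) hL
  have i2 : Integrable (fun x => conj (sect (k + 1) x) * pd 0 h x)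
      (volume.restrict exteriorBall) :=
    MemLp.integrable_mul (p := 2) (q := 2) (l.comp_memLp' (memLp_sect k)) hL
  constructor
  · have e : ∀ x, ((sect (k + 1) x).re : ℂ) * pd 0 h x = (1 / 2 : ℂ) *
        (sect (k + 1) x * pd 0 h x + conj (sect (k + 1) x) * pd 0 h x) := fun x => by
      rw [Complex.re_eq_add_conj]; ring
    simp_rw [e]
    rw [integral_const_mul, integral_add i1 i2, h1, h3]; simp
  · have e : ∀ x, ((sect (k + 1) x).im : ℂ) * pd 0 h x = (1 / (2 * Complex.I) : ℂ) *
        (sect (k + 1) x * pd 0 h x - conj (sect (k + 1) x) * pd 0 h x) := fun x => by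
      rw [Complex.im_eq_sub_conj]; ring
    simp_rw [e]
    rw [integral_const_mul, integral_sub i1 i2, h1, h3]; simp

end SectorialOrthogonality

/-! ### Poles, regularized kernels and Green's identity with a cutoff -/

section Representation

/-- The Newtonian kernel with pole `x`, regularized by `e`. -/
noncomputable def pole (x : E3) (e : ℂ) : E3 → ℂ := newton (x 0) (conj (zc x)) (zc x) e

theorem cdist_pole (x y : E3) (e : ℂ) :
    cdist (x 0) (conj (zc x)) (zc x) e y = ((‖y - x‖ ^ 2 : ℝ) : ℂ) + e := by
  have h : zc y - zc x = zc (y - x) := by simp [zc]; ring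
  rw [cdist, norm_sq_eq_zc, ← map_sub, h, Complex.mul_conj, Complex.normSq_eq_norm_sq]
  simp

theorem cdistGrad_pole (x y : E3) (i : Fin 3) :
    cdistGrad (x 0) (conj (zc x)) (zc x) i y = 2 * (((y - x) i : ℝ) : ℂ) := by
  fin_cases i
  · simp [cdistGrad]
  · simp [cdistGrad, zc]; ring
  · simp [cdistGrad, zc]; linear_combination (-2 * ((y 2 : ℂ) - x 2)) * Complex.I_sq

theorem cdist_pole_mem {x y : E3} {e : ℝ} (h : 0 < ‖y - x‖ ^ 2 + e) :
    cdist (x 0) (conj (zc x)) (zc x) e y ∈ Complex.slitPlane := by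
  rw [cdist_pole, ← Complex.ofReal_add]
  exact Complex.ofReal_mem_slitPlane.2 h

theorem pole_eq {x y : E3} {e : ℝ} (h : 0 < ‖y - x‖ ^ 2 + e) :
    pole x e y = ((Real.sqrt (‖y - x‖ ^ 2 + e))⁻¹ : ℝ) := by
  rw [pole, newton, cdist_pole, ← Complex.ofReal_add, invSqrt_ofReal h]

theorem norm_pole_le {x y : E3} {e : ℝ} (he : 0 ≤ e) (h : y ≠ x) :
    ‖pole x e y‖ ≤ ‖y - x‖⁻¹ := by
  have h0 : 0 < ‖y - x‖ := norm_pos_iff.2 (sub_ne_zero.2 h)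
  rw [pole_eq (by positivity), Complex.norm_real, Real.norm_of_nonneg (by positivity)]
  gcongr
  exact Real.le_sqrt_of_sq_le (by linarith)

theorem norm_pd_pole_le {x y : E3} {e : ℝ} (he : 0 ≤ e) (h : y ≠ x) (i : Fin 3) :
    ‖pd i (pole x e) y‖ ≤ (‖y - x‖ ^ 2)⁻¹ := by
  have h0 : 0 < ‖y - x‖ := norm_pos_iff.2 (sub_ne_zero.2 h)
  have := (hasPD_newton (cdist_pole_mem (x := x) (y := y) (e := e) (by positivity))).2 i
  change pd i (pole x e) y = -(1 / 2) * pole x e y ^ 3 * _ at this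
  rw [this, cdistGrad_pole, norm_mul, norm_mul, norm_mul, norm_pow, Complex.norm_real]
  calc _ ≤ ‖(-(1 / 2) : ℂ)‖ * (‖y - x‖⁻¹) ^ 3 * (‖(2 : ℂ)‖ * ‖y - x‖) := by
        gcongr
        · exact norm_pole_le he h
        · exact abs_coord_le _ i
    _ = (‖y - x‖ ^ 2)⁻¹ := by
        simp; field_simp

theorem contDiffAt_pole {x y : E3} {e : ℝ} (h : 0 < ‖y - x‖ ^ 2 + e) {n : WithTop ℕ∞} :
    ContDiffAt ℝ n (pole x e) y := contDiffAt_newton (cdist_pole_mem h)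

theorem lap_pole {x y : E3} {e : ℝ} (h : 0 < ‖y - x‖ ^ 2 + e) :
    lap (pole x e) y = -3 * e * pole x e y ^ 5 := lap_newton (cdist_pole_mem h)

/-- Green's identity with a cutoff function `ψ`. -/
theorem integral_green {φ ψ E : E3 → ℂ} (hφ : ContDiff ℝ 2 φ) (hψ : ContDiff ℝ 2 ψ)
    (hE : ContDiff ℝ 2 E) (hc : HasCompactSupport ψ) :
    ∫ y, (ψ y * (φ y * lap E y - E y * lap φ y) +
      φ y * (2 * ∑ i, pd i E y * pd i ψ y + E y * lap ψ y)) = 0 := by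
  have hp : ∀ {g : E3 → ℂ}, ContDiff ℝ 2 g → ∀ i, ContDiff ℝ 1 (pd i g) := fun hg i =>
    contDiff_pd hg (by norm_num) i
  -- The term `Eφ∇ψ` is added to cancel the gradient of `φ` against `∇ψ`. The cutoff errors then
  -- contain `φ` but not its derivatives, so `φ ∈ L²` is enough to control them.
  set F : Fin 3 → E3 → ℂ := fun i y => ψ y * (φ y * pd i E y - E y * pd i φ y) +
    E y * φ y * pd i ψ y with hF
  have one : ∀ {g : E3 → ℂ}, ContDiff ℝ 2 g → ContDiff ℝ 1 g := fun hg => hg.of_le (by norm_num)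
  have key := integral_sum_pd_eq_zero (F := F) (fun i =>
    ((one hψ).mul (((one hφ).mul (hp hE i)).sub ((one hE).mul (hp hφ i)))).add
      (((one hE).mul (one hφ)).mul (hp hψ i))) (fun i => by
      have hcd : HasCompactSupport (pd i ψ) :=
        (hc.fderiv (𝕜 := ℝ)).comp_left
          (g := fun L : E3 →L[ℝ] ℂ => L (EuclideanSpace.single i 1)) rfl
      exact (hc.mul_right).add (hcd.mul_left))
  rw [← key]
  refine integral_congr_ae (ae_of_all _ fun y => ?_)
  have d1 : ∀ {g : E3 → ℂ}, ContDiff ℝ 2 g → HasPD g (fun i => pd i g y) y := fun hg =>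
    hasPD_of_differentiableAt (hg.differentiable (by norm_num) y)
  have d2 : ∀ {g : E3 → ℂ}, ContDiff ℝ 2 g → ∀ i, HasPD (pd i g) (fun j => pd j (pd i g) y) y :=
    fun hg i => HasPD.eventually_pd hg.contDiffAt i
  have hFi := fun i : Fin 3 => (((d1 hψ).mul (((d1 hφ).mul (d2 hE i)).sub
    ((d1 hE).mul (d2 hφ i)))).add (((d1 hE).mul (d1 hφ)).mul (d2 hψ i))).2 i
  simp only [hF, hFi, lap, Fin.sum_univ_three]
  ring

/-- The constant `3 ∫ (1 + |u|²)^(-5/2) du` (that is, `4π`). -/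
noncomputable def newtonConst : ℝ := ∫ u : E3, 3 * ((Real.sqrt (1 + ‖u‖ ^ 2))⁻¹) ^ 5

theorem integrable_newtonConst :
    Integrable fun u : E3 => 3 * ((Real.sqrt (1 + ‖u‖ ^ 2))⁻¹) ^ 5 := by
  have h : Integrable (fun x : E3 => (1 + ‖x‖) ^ (-(5 : ℝ))) :=
    integrable_one_add_norm (by simp; norm_num)
  refine (h.const_mul (3 * 2 ^ 5)).mono' (by fun_prop) (ae_of_all _ fun x => ?_)
  have e : (1 + ‖x‖) ^ (-(5 : ℝ)) = ((1 + ‖x‖)⁻¹) ^ 5 := by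
    rw [Real.rpow_neg (by positivity), inv_pow]; norm_cast
  rw [e, Real.norm_of_nonneg (by positivity), mul_assoc, ← mul_pow]
  gcongr
  rw [← div_eq_mul_inv, ← one_div, div_le_div_iff₀ (by positivity) (by positivity)]
  have : (1 + ‖x‖) / 2 ≤ Real.sqrt (1 + ‖x‖ ^ 2) := by
    apply Real.le_sqrt_of_sq_le
    nlinarith [norm_nonneg x, sq_nonneg (‖x‖ - 1)]
  linarith

theorem newtonConst_pos : 0 < newtonConst := by
  refine (integral_pos_iff_support_of_nonneg (fun u => by positivity) integrable_newtonConst).2 ?_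
  have : (Function.support fun u : E3 => 3 * ((Real.sqrt (1 + ‖u‖ ^ 2))⁻¹) ^ 5) = Set.univ := by
    ext u
    simp only [Function.mem_support, Set.mem_univ, iff_true]
    have : 0 < 1 + ‖u‖ ^ 2 := by positivity
    positivity
  rw [this]
  simp

/-- The regularized kernels have Laplacian `-3ε²(|y-x|² + ε²)^(-5/2)`, an approximate identity times
`-newtonConst`. The substitution `y = x + εu` removes `ε` from the density, leaving it only in the
argument of `g`. -/
theorem tendsto_integral_mul_lap_pole {g : E3 → ℂ} (hg : Continuous g) (hc : HasCompactSupport g)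
    (x : E3) {ε : ℕ → ℝ} (hε : ∀ m, 0 < ε m) (hlim : Tendsto ε atTop (𝓝 0)) :
    Tendsto (fun m => ∫ y, g y * lap (pole x ((ε m ^ 2 : ℝ) : ℂ)) y) atTop
      (𝓝 (-(newtonConst * g x))) := by
  have hsub : ∀ m, ∫ y, g y * lap (pole x ((ε m ^ 2 : ℝ) : ℂ)) y =
      ∫ u, g (x + ε m • u) * ((-(3 * ((Real.sqrt (1 + ‖u‖ ^ 2))⁻¹) ^ 5) : ℝ) : ℂ) := by
    intro m
    have he := hε m
    have h1 := Measure.integral_comp_smul (volume : Measure E3)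
      (fun v => g (x + v) * lap (pole x ((ε m ^ 2 : ℝ) : ℂ)) (x + v)) (ε m)
    rw [integral_add_left_eq_self (fun y => g y * lap (pole x ((ε m ^ 2 : ℝ) : ℂ)) y)] at h1
    have hfr : Module.finrank ℝ E3 = 3 := by simp
    rw [hfr, abs_of_pos (by positivity)] at h1
    have h2 : ∫ y, g y * lap (pole x ((ε m ^ 2 : ℝ) : ℂ)) y = (ε m ^ 3 : ℝ) •
        ∫ u, g (x + ε m • u) * lap (pole x ((ε m ^ 2 : ℝ) : ℂ)) (x + ε m • u) := by
      rw [h1, smul_smul, mul_inv_cancel₀ (by positivity), one_smul]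
    rw [h2, ← integral_smul]
    refine integral_congr_ae (ae_of_all _ fun u => ?_)
    have hn : ‖x + ε m • u - x‖ ^ 2 + ε m ^ 2 = ε m ^ 2 * (1 + ‖u‖ ^ 2) := by
      rw [add_sub_cancel_left, norm_smul, Real.norm_of_nonneg he.le]; ring
    have hpos : 0 < ‖x + ε m • u - x‖ ^ 2 + ε m ^ 2 := by positivity
    simp only
    rw [lap_pole hpos, pole_eq hpos, hn, Real.sqrt_mul (by positivity), Real.sqrt_sq he.le]
    have hs : 0 < Real.sqrt (1 + ‖u‖ ^ 2) := Real.sqrt_pos.2 (by positivity)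
    rw [Complex.real_smul]
    have : (ε m ^ 3 : ℝ) * (-3 * (ε m ^ 2) * ((ε m * Real.sqrt (1 + ‖u‖ ^ 2))⁻¹) ^ 5) =
        -(3 * ((Real.sqrt (1 + ‖u‖ ^ 2))⁻¹) ^ 5) := by
      field_simp
    rw [← this]
    push_cast
    ring
  simp_rw [hsub]
  have htarget : -((newtonConst : ℂ) * g x) =
      ∫ u : E3, g x * ((-(3 * ((Real.sqrt (1 + ‖u‖ ^ 2))⁻¹) ^ 5) : ℝ) : ℂ) := by
    rw [integral_const_mul, integral_complex_ofReal, integral_neg]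
    simp only [newtonConst]; push_cast; ring
  rw [htarget]
  obtain ⟨C, hC⟩ := hc.exists_bound_of_continuous hg
  refine tendsto_integral_filter_of_dominated_convergence
    (fun u => C * (3 * ((Real.sqrt (1 + ‖u‖ ^ 2))⁻¹) ^ 5)) ?_ ?_
    (integrable_newtonConst.const_mul C) ?_
  · exact Eventually.of_forall fun m => by
      have : Continuous fun u : E3 => g (x + ε m • u) := by fun_prop
      exact this.aestronglyMeasurable.mul (by fun_prop)
  · refine Eventually.of_forall fun m => ae_of_all _ fun u => ?_
    rw [norm_mul, Complex.norm_real, norm_neg, Real.norm_of_nonneg (by positivity)]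
    gcongr
    exact hC _
  · refine ae_of_all _ fun u => ?_
    refine Tendsto.mul_const _ ?_
    have : Tendsto (fun m => x + ε m • u) atTop (𝓝 (x + (0 : ℝ) • u)) :=
      tendsto_const_nhds.add (hlim.smul_const u)
    rw [zero_smul, add_zero] at this
    exact (hg.tendsto x).comp this

end Representation

/-! ### Radial cutoffs at scale `n` and their derivative bounds -/

section RadialCutoff

/-- A radial cutoff function equal to `1` for `‖y‖ ≤ n` and `0` for `‖y‖² ≥ 2 n²`. -/
noncomputable def cutoff (n : ℝ) (y : E3) : ℂ := ((1 - step (‖y‖ ^ 2 / n ^ 2) : ℝ) : ℂ)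

theorem contDiff_cutoff (n : ℝ) {k : ℕ∞} : ContDiff ℝ k (cutoff n) := by
  have h : ContDiff ℝ ∞ (cutoff n) :=
    Complex.ofRealCLM.contDiff.comp
      (contDiff_const.sub (contDiff_step.comp ((contDiff_norm_sq ℝ).div_const _)))
  exact h.of_le (by exact_mod_cast le_top)

theorem hasPD_cutoff (n : ℝ) (y : E3) : HasPD (cutoff n)
    (fun i => ((-(deriv step (‖y‖ ^ 2 / n ^ 2)) * (1 / n ^ 2) : ℝ) : ℂ) * (2 * y i)) y := by
  have h : HasDerivAt (fun q : ℝ => ((1 - step (q / n ^ 2) : ℝ) : ℂ))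
      ((-(deriv step (‖y‖ ^ 2 / n ^ 2)) * (1 / n ^ 2) : ℝ) : ℂ) (‖y‖ ^ 2) := by
    refine HasDerivAt.ofReal_comp ?_
    refine ((((hasDerivAt_step _).comp _ ((hasDerivAt_id _).div_const (n ^ 2)))).const_sub
      1).congr_deriv ?_
    simp
  exact HasPD.comp_normSq h

theorem lap_cutoff (n : ℝ) (y : E3) : lap (cutoff n) y =
    ((-(deriv (deriv step) (‖y‖ ^ 2 / n ^ 2) * (1 / n ^ 2) * (1 / n ^ 2)) * 4 * ‖y‖ ^ 2 -
      deriv step (‖y‖ ^ 2 / n ^ 2) * (1 / n ^ 2) * 6 : ℝ) : ℂ) := by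
  have h : HasDerivAt (fun q : ℝ => ((-(deriv step (q / n ^ 2)) * (1 / n ^ 2) : ℝ) : ℂ))
      ((-(deriv (deriv step) (‖y‖ ^ 2 / n ^ 2) * (1 / n ^ 2)) * (1 / n ^ 2) : ℝ) : ℂ)
      (‖y‖ ^ 2) := by
    refine HasDerivAt.ofReal_comp ?_
    exact ((((hasDerivAt_deriv_step _).comp _ ((hasDerivAt_id _).div_const (n ^ 2)))).neg).mul_const
      (1 / n ^ 2)
  have h2 : ∀ i : Fin 3, HasPD (fun y : E3 =>
      ((-(deriv step (‖y‖ ^ 2 / n ^ 2)) * (1 / n ^ 2) : ℝ) : ℂ) * (2 * y i)) _ y := fun i =>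
    (HasPD.comp_normSq h).mul ((HasPD.coord i).const_mul 2)
  simp only [lap, pd_pd_of_hasPD (Eventually.of_forall (hasPD_cutoff n)) (h2 _),
    Fin.sum_univ_three, norm_sq_eq]
  push_cast
  simp
  ring

theorem hasCompactSupport_cutoff {n : ℝ} (hn : 0 < n) : HasCompactSupport (cutoff n) := by
  refine HasCompactSupport.of_support_subset_isCompact
    (isCompact_closedBall (0 : E3) (2 * n)) fun y hy => ?_
  simp only [Metric.mem_closedBall, dist_zero_right]
  by_contra! hlt
  refine hy ?_
  have : 2 ≤ ‖y‖ ^ 2 / n ^ 2 := by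
    rw [le_div_iff₀ (by positivity)]
    nlinarith
  simp [cutoff, step_of_ge this]

theorem cutoff_eq_one {n : ℝ} (hn : 0 < n) {y : E3} (hy : ‖y‖ ≤ n) : cutoff n y = 1 := by
  have : ‖y‖ ^ 2 / n ^ 2 ≤ 1 := by
    rw [div_le_one (by positivity)]
    gcongr
  simp [cutoff, step_of_le this]

/-- Derivatives of the cutoff live where `n² ≤ |y|² ≤ 2n²`, so each factor `1/n` may be traded for a
multiple of `1/|y|`. This gives bounds independent of `n`. -/
theorem exists_cutoff_bound : ∃ C : ℝ, 0 ≤ C ∧ ∀ n : ℝ, 0 < n → ∀ y : E3, y ≠ 0 →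
    (∀ i, ‖pd i (cutoff n) y‖ ≤ C * ‖y‖⁻¹) ∧ ‖lap (cutoff n) y‖ ≤ C * (‖y‖ ^ 2)⁻¹ ∧
    (‖y‖ < n → (∀ i, pd i (cutoff n) y = 0) ∧ lap (cutoff n) y = 0) := by
  obtain ⟨M, hM, H⟩ := exists_step_bound
  refine ⟨28 * M, by positivity, fun n hn y hy => ?_⟩
  have h0 : 0 < ‖y‖ := norm_pos_iff.2 hy
  set t := ‖y‖ ^ 2 / n ^ 2 with ht
  -- Writing `1/n² = t |y|⁻²` leaves powers of `t` multiplying derivatives of `step` at `t`, and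
  -- these vanish unless `1 ≤ t ≤ 2`.
  have hn2 : 1 / n ^ 2 = t * (‖y‖ ^ 2)⁻¹ := by rw [ht]; field_simp
  have ht0 : 0 ≤ t := by positivity
  have htt : ∀ g : ℝ → ℝ, (∀ t, |g t| ≤ M) → (∀ t, t ∉ Set.Icc (1 : ℝ) 2 → g t = 0) →
      |g t| * t ≤ 2 * M ∧ |g t| * t * t ≤ 4 * M := by
    intro g h1 h2
    by_cases h : t ∈ Set.Icc (1 : ℝ) 2
    · have hg := abs_nonneg (g t)
      have a1 : |g t| * t ≤ M * 2 := mul_le_mul (h1 t) h.2 ht0 hM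
      have a2 : |g t| * t * t ≤ M * 2 * 2 := mul_le_mul a1 h.2 ht0 (by positivity)
      exact ⟨by linarith, by linarith⟩
    · rw [h2 t h]; simp [hM]
  have b1 := htt _ (fun t => (H t).1) fun t => deriv_step_eq_zero
  have b2 := htt _ (fun t => (H t).2) fun t => deriv_deriv_step_eq_zero
  refine ⟨fun i => ?_, ?_, fun hyn => ?_⟩
  · rw [(hasPD_cutoff n y).2 i, ← ht, hn2]
    rw [norm_mul, norm_mul, Complex.norm_real, Complex.norm_real, Real.norm_eq_abs, abs_mul,
      abs_neg, abs_mul, abs_of_nonneg ht0, abs_of_nonneg (by positivity : 0 ≤ (‖y‖ ^ 2)⁻¹)]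
    calc |deriv step t| * (t * (‖y‖ ^ 2)⁻¹) * (‖(2 : ℂ)‖ * |y i|)
        ≤ |deriv step t| * (t * (‖y‖ ^ 2)⁻¹) * (‖(2 : ℂ)‖ * ‖y‖) := by
          gcongr; exact abs_coord_le y i
      _ = (|deriv step t| * t) * 2 * ‖y‖⁻¹ := by simp; field_simp
      _ ≤ (2 * M) * 2 * ‖y‖⁻¹ := by
          have := b1.1
          gcongr ?_ * 2 * _
      _ ≤ 28 * M * ‖y‖⁻¹ := by gcongr ?_ * _; linarith
  · rw [lap_cutoff, ← ht, hn2, Complex.norm_real, Real.norm_eq_abs]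
    have e : -(deriv (deriv step) t * (t * (‖y‖ ^ 2)⁻¹) * (t * (‖y‖ ^ 2)⁻¹)) * 4 * ‖y‖ ^ 2 -
        deriv step t * (t * (‖y‖ ^ 2)⁻¹) * 6 =
        (-(deriv (deriv step) t * t * t) * 4 - deriv step t * t * 6) * (‖y‖ ^ 2)⁻¹ := by
      field_simp
    rw [e, abs_mul, abs_of_nonneg (by positivity : 0 ≤ (‖y‖ ^ 2)⁻¹)]
    gcongr
    refine (abs_sub _ _).trans ?_
    rw [abs_mul, abs_mul, abs_neg, abs_mul, abs_mul, abs_mul, abs_of_nonneg ht0]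
    norm_num
    linarith [b1.1, b2.2]
  · have ht1 : t ∉ Set.Icc (1 : ℝ) 2 := fun h => by
      have : t < 1 := by
        rw [ht, div_lt_one (by positivity)]
        gcongr
      linarith [h.1]
    refine ⟨fun i => ?_, ?_⟩
    · rw [(hasPD_cutoff n y).2 i, ← ht, deriv_step_eq_zero ht1]; simp
    · rw [lap_cutoff, ← ht, deriv_step_eq_zero ht1, deriv_deriv_step_eq_zero ht1]; simp

end RadialCutoff

/-! ### The Newtonian potential representation -/

section RepresentationFormula

theorem continuous_lap {φ : E3 → ℂ} (hφ : ContDiff ℝ 2 φ) : Continuous (lap φ) :=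
  continuous_finsetSum _ fun i _ =>
    (contDiff_pd (contDiff_pd hφ (m := 1) (by norm_num) i) (m := 0) (by norm_num) i).continuous

/-- Representation of a function by the Newtonian potential of its Laplacian. -/
theorem newton_representation {φ : E3 → ℂ} (hφ : ContDiff ℝ 2 φ)
    (hL : MemLp φ 2 (volume.restrict exteriorBall)) (hw : HasCompactSupport (lap φ)) {x : E3}
    (hx : x ∉ tsupport (lap φ)) (κ : ℂ) :
    newtonConst * φ x = -∫ y, (((‖y - x‖⁻¹ : ℝ) : ℂ) - κ) * lap φ y := by
  obtain ⟨C, hC, HC⟩ := exists_cutoff_bound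
  set ε : ℕ → ℝ := fun m => 1 / ((m : ℝ) + 1) with hεdef
  have hε : ∀ m, 0 < ε m := fun m => by positivity
  have hεlim : Tendsto ε atTop (𝓝 0) := tendsto_one_div_add_atTop_nhds_zero_nat
  -- Subtracting an arbitrary constant `κ` from the kernel is harmless: square integrability of `φ`
  -- at infinity forces its total flux to vanish. In the exterior case this makes room for the value
  -- of `1/|x|`, without which the kernel is not square integrable.
  have hsm : ∀ m, ContDiff ℝ 2 fun y => pole x ((ε m ^ 2 : ℝ) : ℂ) y - κ := fun m =>
    (contDiff_iff_contDiffAt.2 fun y => contDiffAt_pole (by have := hε m; positivity)).sub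
      contDiff_const
  have hpd : ∀ m i y, pd i (fun y => pole x ((ε m ^ 2 : ℝ) : ℂ) y - κ) y =
      pd i (pole x ((ε m ^ 2 : ℝ) : ℂ)) y := fun m i y => by
    unfold pd
    rw [fderiv_sub_const]
  have hlap : ∀ m y, lap (fun y => pole x ((ε m ^ 2 : ℝ) : ℂ) y - κ) y =
      lap (pole x ((ε m ^ 2 : ℝ) : ℂ)) y := fun m y => by
    unfold lap
    refine Finset.sum_congr rfl fun i _ => pd_congr (Eventually.of_forall fun y => hpd m i y) i
  obtain ⟨R, hR⟩ : ∃ R : ℝ, ∀ y ∈ tsupport (lap φ), ‖y‖ ≤ R := by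
    obtain ⟨R, hR⟩ := hw.isCompact.isBounded.subset_closedBall (0 : E3)
    exact ⟨R, fun y hy => by simpa using hR hy⟩
  have hwc := continuous_lap hφ
  -- The constant collects `2 · 3 · 4C` from `2∇E·∇ψ` and `(2 + |κ|)C` from `EΔψ`, both of order
  -- `|y|⁻²` for large `|y|`.
  set K : ℝ := 6 * 4 * C + (2 + ‖κ‖) * C with hK
  have hint : Integrable (fun y => K * (‖φ y‖ * (‖y‖ ^ 2)⁻¹)) (volume.restrict exteriorBall) :=
    (MemLp.integrable_mul (p := 2) (q := 2) hL.norm memLp_norm_inv_sq).const_mul K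
  -- The tail of an integrable product of two `L²` functions; it majorizes the cutoff error
  -- uniformly in the regularization.
  set τ : ℕ → ℝ := fun n => ∫ y in exteriorBall,
    Set.indicator {y : E3 | (n : ℝ) ≤ ‖y‖} (fun y => K * (‖φ y‖ * (‖y‖ ^ 2)⁻¹)) y with hτ
  have hms : ∀ n : ℕ, MeasurableSet {y : E3 | (n : ℝ) ≤ ‖y‖} := fun n =>
    measurableSet_le measurable_const measurable_norm
  have hτlim : Tendsto τ atTop (𝓝 0) := by
    have : Tendsto τ atTop (𝓝 (∫ y in exteriorBall, (0 : ℝ))) := by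
      refine tendsto_integral_filter_of_dominated_convergence
        (fun y => K * (‖φ y‖ * (‖y‖ ^ 2)⁻¹)) ?_ ?_ hint ?_
      · exact Eventually.of_forall fun n => hint.1.indicator (hms n)
      · refine Eventually.of_forall fun n => ae_of_all _ fun y => ?_
        refine (norm_indicator_le_norm_self _ _).trans ?_
        rw [Real.norm_of_nonneg (by positivity)]
      · refine ae_of_all _ fun y => ?_
        refine tendsto_const_nhds.congr' ?_
        filter_upwards [tendsto_natCast_atTop_atTop.eventually_gt_atTop ‖y‖] with n hn
        rw [Set.indicator_of_notMem]
        simpa using hn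
    simpa using this
  have hT2 : Tendsto (fun m => ∫ y, (pole x ((ε m ^ 2 : ℝ) : ℂ) y - κ) * lap φ y) atTop
      (𝓝 (∫ y, (((‖y - x‖⁻¹ : ℝ) : ℂ) - κ) * lap φ y)) := by
    obtain ⟨δ, hδ, hδ'⟩ : ∃ δ > 0, ∀ y ∈ tsupport (lap φ), δ ≤ ‖y - x‖ := by
      obtain ⟨δ, hδ, hb⟩ := Metric.isOpen_iff.1 (isClosed_tsupport (lap φ)).isOpen_compl x hx
      refine ⟨δ, hδ, fun y hy => ?_⟩
      by_contra! hlt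
      exact hb (by simpa [dist_eq_norm] using hlt) hy
    refine tendsto_integral_filter_of_dominated_convergence
      (fun y => (δ⁻¹ + ‖κ‖) * ‖lap φ y‖) ?_ ?_
      ((hwc.integrable_of_hasCompactSupport hw).norm.const_mul _) ?_
    · exact Eventually.of_forall fun m => ((hsm m).continuous.mul hwc).aestronglyMeasurable
    · refine Eventually.of_forall fun m => ae_of_all _ fun y => ?_
      by_cases hy : y ∈ tsupport (lap φ)
      · have hd := hδ' y hy
        have hne : y ≠ x := fun h => by rw [h, sub_self, norm_zero] at hd; linarith
        rw [norm_mul]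
        gcongr
        refine (norm_sub_le _ _).trans ?_
        gcongr
        exact (norm_pole_le (by positivity) hne).trans (inv_anti₀ hδ hd)
      · rw [image_eq_zero_of_notMem_tsupport hy]; simp
    · refine ae_of_all _ fun y => ?_
      by_cases hy : y ∈ tsupport (lap φ)
      · have hd := hδ' y hy
        have hp : 0 < ‖y - x‖ := by linarith
        refine Tendsto.mul_const _ (Tendsto.sub_const ?_ _)
        have e : ∀ m, pole x ((ε m ^ 2 : ℝ) : ℂ) y =
            ((Real.sqrt (‖y - x‖ ^ 2 + ε m ^ 2))⁻¹ : ℝ) := fun m => pole_eq (by positivity)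
        simp_rw [e]
        refine (Complex.continuous_ofReal.tendsto _).comp ?_
        have h1 : Tendsto (fun m => Real.sqrt (‖y - x‖ ^ 2 + ε m ^ 2)) atTop (𝓝 ‖y - x‖) := by
          have := (Real.continuous_sqrt.tendsto _).comp
            ((tendsto_const_nhds (x := ‖y - x‖ ^ 2)).add (hεlim.pow 2))
          simpa [Real.sqrt_sq hp.le, Function.comp_def] using this
        exact h1.inv₀ hp.ne'
      · rw [image_eq_zero_of_notMem_tsupport hy]; simp
  -- For fixed `n` the regularization parameter goes to zero first. The error from the cutoff is
  -- still at most the tail `τ n`, which disappears when `n → ∞`.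
  have main : ∀ᶠ n : ℕ in atTop,
      ‖-(newtonConst * φ x) - ∫ y, (((‖y - x‖⁻¹ : ℝ) : ℂ) - κ) * lap φ y‖ ≤ τ n := by
    filter_upwards [tendsto_natCast_atTop_atTop.eventually_gt_atTop (|R| + 2 * ‖x‖ + 2)] with n hn
    have hnR : R ≤ n := by linarith [le_abs_self R, norm_nonneg x]
    have hnx : ‖x‖ ≤ n := by linarith [abs_nonneg R, norm_nonneg x]
    have hn2 : (2 : ℝ) < n := by linarith [abs_nonneg R, norm_nonneg x]
    have hnxx : 2 * ‖x‖ < n := by linarith [abs_nonneg R]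
    have hn0 : (0 : ℝ) < n := by linarith
    have hψc := hasCompactSupport_cutoff hn0
    have hψs : ContDiff ℝ 2 (cutoff n) := by exact_mod_cast contDiff_cutoff n (k := 2)
    have hT1 := tendsto_integral_mul_lap_pole (g := fun y => cutoff n y * φ y)
      (hψs.continuous.mul hφ.continuous) hψc.mul_right x hε hεlim
    rw [cutoff_eq_one hn0 hnx, one_mul] at hT1
    refine le_of_tendsto (hT1.sub hT2).norm (Eventually.of_forall fun m => ?_)
    have hEc := (hsm m).continuous
    have hg := integral_green hφ hψs (hsm m) hψc
    set E := fun y => pole x ((ε m ^ 2 : ℝ) : ℂ) y - κ with hE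
    have hψw : ∀ y, cutoff n y * (E y * lap φ y) = E y * lap φ y := fun y => by
      by_cases hy : y ∈ tsupport (lap φ)
      · rw [cutoff_eq_one hn0 ((hR y hy).trans hnR), one_mul]
      · rw [image_eq_zero_of_notMem_tsupport hy]; simp
    have i1 : Integrable fun y => cutoff n y * φ y * lap (pole x ((ε m ^ 2 : ℝ) : ℂ)) y := by
      refine Continuous.integrable_of_hasCompactSupport ?_ (hψc.mul_right.mul_right)
      have := continuous_lap (hsm m)
      rw [funext (hlap m)] at this
      exact (hψs.continuous.mul hφ.continuous).mul this
    have i2 : Integrable fun y => E y * lap φ y :=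
      (hEc.mul hwc).integrable_of_hasCompactSupport hw.mul_left
    set T : E3 → ℂ := fun y => φ y * (2 * ∑ i, pd i E y * pd i (cutoff n) y +
      E y * lap (cutoff n) y) with hT
    -- The bounds on the cutoff exclude the origin, which is treated separately: there the cutoff is
    -- locally constant.
    have hcutoff0 : ∀ y, ‖y‖ < n → T y = 0 := by
      intro y hy
      by_cases hy0 : y = 0
      · have e : cutoff n =ᶠ[𝓝 y] fun _ => 1 := by
          filter_upwards [(isOpen_lt continuous_norm continuous_const).mem_nhds hy] with v hv
          exact cutoff_eq_one hn0 (le_of_lt hv)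
        have e1 : ∀ i, pd i (cutoff n) y = 0 := fun i => by rw [pd_congr e]; simp [pd]
        have e2 : lap (cutoff n) y = 0 := by
          rw [lap_congr e]
          have : ∀ i, pd i (fun _ : E3 => (1 : ℂ)) = fun _ => 0 := fun i => by funext v; simp [pd]
          simp only [lap, this]; simp [pd]
        simp [hT, e1, e2]
      · obtain ⟨e1, e2⟩ := (HC n hn0 y hy0).2.2 hy
        simp [hT, e1, e2]
    have eqT : (∫ y, cutoff n y * φ y * lap (pole x ((ε m ^ 2 : ℝ) : ℂ)) y) -
        ∫ y, E y * lap φ y = -∫ y, T y := by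
      have iT : Integrable T := by
        refine Continuous.integrable_of_hasCompactSupport ?_ ?_
        · refine hφ.continuous.mul ((continuous_const.mul (continuous_finsetSum _ fun i _ => ?_)).add
            (hEc.mul (continuous_lap hψs)))
          exact (contDiff_pd (hsm m) (m := 1) (by norm_num) i).continuous.mul
            (contDiff_pd hψs (m := 1) (by norm_num) i).continuous
        · have hcd : ∀ {g : E3 → ℂ}, HasCompactSupport g → ∀ i, HasCompactSupport (pd i g) :=
            fun hg i => (hg.fderiv (𝕜 := ℝ)).comp_left
              (g := fun L : E3 →L[ℝ] ℂ => L (EuclideanSpace.single i 1)) rfl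
          have hcl : HasCompactSupport (lap (cutoff n)) := by
            have : lap (cutoff n) = fun y => pd 0 (pd 0 (cutoff n)) y + pd 1 (pd 1 (cutoff n)) y +
              pd 2 (pd 2 (cutoff n)) y := by funext y; simp [lap, Fin.sum_univ_three]
            rw [this]
            exact ((hcd (hcd hψc 0) 0).add (hcd (hcd hψc 1) 1)).add (hcd (hcd hψc 2) 2)
          refine HasCompactSupport.mul_left (HasCompactSupport.add ?_ hcl.mul_left)
          simp only [Fin.sum_univ_three]
          exact HasCompactSupport.mul_left (((hcd hψc 0).mul_left.add (hcd hψc 1).mul_left).add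
            (hcd hψc 2).mul_left)
      have hg' : ∫ y, ((cutoff n y * φ y * lap (pole x ((ε m ^ 2 : ℝ) : ℂ)) y - E y * lap φ y) +
          T y) = 0 := by
        rw [← hg]
        refine integral_congr_ae (ae_of_all _ fun y => ?_)
        have h1 := hψw y
        have h2 := hlap m y
        change lap E y = _ at h2
        change _ = cutoff n y * (φ y * lap E y - E y * lap φ y) + T y
        linear_combination h1 - cutoff n y * φ y * h2
      have h3 := integral_add (i1.sub i2) iT
      have h4 := integral_sub i1 i2
      simp only [Pi.sub_apply] at h3
      rw [hg', h4] at h3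
      linear_combination -h3
    rw [eqT, norm_neg, ← setIntegral_eq_integral_of_forall_compl_eq_zero (s := exteriorBall)]
    · refine norm_integral_le_of_norm_le (hint.indicator (hms n)) ?_
      filter_upwards [ae_restrict_mem isOpen_exteriorBall.measurableSet] with y hy
      by_cases hyn : (n : ℝ) ≤ ‖y‖
      · rw [Set.indicator_of_mem (by exact hyn)]
        have hy1 : 1 < ‖y‖ := hy
        have hy0 : 0 < ‖y‖ := by linarith
        have hd : ‖y‖ / 2 ≤ ‖y - x‖ := by
          have := norm_sub_norm_le y x
          linarith
        have hne : y ≠ x := fun h => by rw [h, sub_self, norm_zero, ← h] at hd; linarith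
        obtain ⟨b1, b2, -⟩ := HC n hn0 y (norm_pos_iff.1 hy0)
        have hEb : ‖E y‖ ≤ 2 + ‖κ‖ := by
          refine (norm_sub_le _ _).trans ?_
          gcongr
          refine (norm_pole_le (by positivity) hne).trans ?_
          rw [inv_le_comm₀ (by linarith) (by norm_num)]
          linarith
        have hEp : ∀ i, ‖pd i E y‖ ≤ 4 * ‖y‖⁻¹ := fun i => by
          rw [hpd m i y]
          refine (norm_pd_pole_le (by positivity) hne i).trans ?_
          have : (‖y - x‖ ^ 2)⁻¹ ≤ ((‖y‖ / 2) ^ 2)⁻¹ := by gcongr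
          refine this.trans ?_
          rw [← div_eq_mul_inv, ← one_div, div_le_div_iff₀ (by positivity) hy0]
          nlinarith
        rw [hT, norm_mul]
        have hsum : ‖∑ i, pd i E y * pd i (cutoff n) y‖ ≤ 3 * (4 * ‖y‖⁻¹ * (C * ‖y‖⁻¹)) := by
          refine (norm_sum_le _ _).trans ?_
          refine (Finset.sum_le_sum (g := fun _ => 4 * ‖y‖⁻¹ * (C * ‖y‖⁻¹)) fun i _ => ?_).trans
            (by simp)
          rw [norm_mul]
          exact mul_le_mul (hEp i) (b1 i) (norm_nonneg _) (by positivity)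
        calc ‖φ y‖ * ‖2 * ∑ i, pd i E y * pd i (cutoff n) y + E y * lap (cutoff n) y‖
            ≤ ‖φ y‖ * (2 * (3 * (4 * ‖y‖⁻¹ * (C * ‖y‖⁻¹))) + (2 + ‖κ‖) * (C * (‖y‖ ^ 2)⁻¹)) := by
              gcongr
              refine (norm_add_le _ _).trans (add_le_add ?_ ?_)
              · rw [norm_mul]; simp only [Complex.norm_ofNat]; gcongr
              · rw [norm_mul]; gcongr
          _ = K * (‖φ y‖ * (‖y‖ ^ 2)⁻¹) := by rw [hK]; field_simp; ring
      · rw [hcutoff0 y (not_le.1 hyn), norm_zero]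
        exact Set.indicator_nonneg (fun y _ => by positivity) y
    · intro y hy
      have hy : ‖y‖ ≤ 1 := not_lt.1 hy
      exact hcutoff0 y (by linarith)
  have hz : ‖-(newtonConst * φ x) - ∫ y, (((‖y - x‖⁻¹ : ℝ) : ℂ) - κ) * lap φ y‖ ≤ 0 :=
    ge_of_tendsto hτlim main
  have := norm_le_zero_iff.1 hz
  linear_combination -this

end RepresentationFormula

/-! ### Orthogonality passes to superpositions -/

section Fubini

/-- `v` is orthogonal to `G` in `Ω`, the product being integrable. -/
def Orth (Ω : Set E3) (G v : E3 → ℂ) : Prop :=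
  Integrable (fun x => G x * v x) (volume.restrict Ω) ∧ ∫ x in Ω, G x * v x = 0

theorem Orth.add {Ω : Set E3} {G v w : E3 → ℂ} (hv : Orth Ω G v) (hw : Orth Ω G w) :
    Orth Ω G fun x => v x + w x := by
  have e : (fun x => G x * (v x + w x)) = fun x => G x * v x + G x * w x := by
    funext x; ring
  refine ⟨by rw [e]; exact hv.1.add hw.1, ?_⟩
  rw [e, integral_add hv.1 hw.1, hv.2, hw.2, add_zero]

theorem Orth.neg {Ω : Set E3} {G v : E3 → ℂ} (hv : Orth Ω G v) : Orth Ω G fun x => -v x := by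
  have e : (fun x => G x * -v x) = fun x => -(G x * v x) := by
    funext x; ring
  refine ⟨by rw [e]; exact hv.1.neg, ?_⟩
  rw [e, integral_neg, hv.2, neg_zero]

theorem Orth.congr {Ω : Set E3} {G v w : E3 → ℂ} (hv : Orth Ω G v) (hΩ : MeasurableSet Ω)
    (h : ∀ x ∈ Ω, v x = w x) : Orth Ω G w := by
  have e : ∀ x ∈ Ω, G x * v x = G x * w x := fun x hx => by rw [h x hx]
  refine ⟨hv.1.congr ((ae_restrict_mem hΩ).mono e), ?_⟩
  rw [← setIntegral_congr_fun hΩ e, hv.2]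

/-- Fubini: orthogonality to every member of a parametrized family passes to its average. The bound
`b`, uniform in the parameter and integrable against `‖G‖`, supplies joint integrability. -/
theorem orth_integral {α : Type*} [TopologicalSpace α] [SecondCountableTopology α]
    [MeasurableSpace α] [OpensMeasurableSpace α] {ν : Measure α} [SFinite ν] {Ω : Set E3}
    {A : Set α} (hΩ : MeasurableSet Ω) (hA : MeasurableSet A) (hνA : ν A ≠ ⊤) {G : E3 → ℂ}
    {k : E3 → α → ℂ} {b : E3 → ℝ} (hG : AEStronglyMeasurable G (volume.restrict Ω))
    (hk : ContinuousOn (fun p : E3 × α => k p.1 p.2) (Ω ×ˢ A))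
    (hb : ∀ x ∈ Ω, ∀ a ∈ A, ‖k x a‖ ≤ b x)
    (hGb : Integrable (fun x => ‖G x‖ * b x) (volume.restrict Ω))
    (h0 : ∀ a ∈ A, ∫ x in Ω, G x * k x a = 0) :
    Orth Ω G fun x => ∫ a in A, k x a ∂ν := by
  have hfin : IsFiniteMeasure (ν.restrict A) := ⟨by simpa using lt_top_iff_ne_top.2 hνA⟩
  have hint : Integrable (fun p : E3 × α => G p.1 * k p.1 p.2)
      ((volume.restrict Ω).prod (ν.restrict A)) := by
    have hbd : Integrable (fun p : E3 × α => (‖G p.1‖ * b p.1) * (1 : ℝ))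
        ((volume.restrict Ω).prod (ν.restrict A)) := hGb.mul_prod (integrable_const (1 : ℝ))
    refine hbd.mono' (hG.comp_fst.mul ?_) ?_
    · rw [Measure.prod_restrict]
      exact hk.aestronglyMeasurable (hΩ.prod hA)
    · rw [Measure.prod_restrict]
      filter_upwards [ae_restrict_mem (hΩ.prod hA)] with p hp
      rw [norm_mul, mul_one]
      exact mul_le_mul_of_nonneg_left (hb _ hp.1 _ hp.2) (norm_nonneg _)
  refine ⟨?_, ?_⟩
  · have := hint.integral_prod_left
    simpa only [integral_const_mul] using this
  calc ∫ x in Ω, G x * ∫ a in A, k x a ∂ν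
      = ∫ x in Ω, ∫ a in A, G x * k x a ∂ν := by simp_rw [integral_const_mul]
    _ = ∫ a in A, (∫ x in Ω, G x * k x a) ∂ν := integral_integral_swap hint
    _ = ∫ a in A, (0 : ℂ) ∂ν := setIntegral_congr_fun hA fun a ha => h0 a ha
    _ = 0 := by simp

/-- The difference `Φ x 1 - Φ x 0` is the average of the derivatives `k x t`. This turns
orthogonality to derivatives along a path of test functions into orthogonality to the difference of
the end points, even if neither end point is integrable against `G`. -/
theorem orth_sub_of_hasDerivAt {Ω : Set E3} (hΩ : MeasurableSet Ω) {G : E3 → ℂ}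
    {Φ k : E3 → ℝ → ℂ} {b : E3 → ℝ} (hG : AEStronglyMeasurable G (volume.restrict Ω))
    (hΦ : ∀ t ∈ Set.Icc (0 : ℝ) 1, ∀ x ∈ Ω, HasDerivAt (Φ x) (k x t) t)
    (hk : ContinuousOn (fun p : E3 × ℝ => k p.1 p.2) (Ω ×ˢ Set.Icc (0 : ℝ) 1))
    (hb : ∀ t ∈ Set.Icc (0 : ℝ) 1, ∀ x ∈ Ω, ‖k x t‖ ≤ b x)
    (hGb : Integrable (fun x => ‖G x‖ * b x) (volume.restrict Ω))
    (h0 : ∀ t ∈ Set.Icc (0 : ℝ) 1, ∫ x in Ω, G x * k x t = 0) :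
    Orth Ω G fun x => Φ x 1 - Φ x 0 := by
  have hsub : Set.Ioc (0 : ℝ) 1 ⊆ Set.Icc 0 1 := Set.Ioc_subset_Icc_self
  refine (orth_integral (ν := volume) (A := Set.Ioc (0 : ℝ) 1) (k := k) (b := b) hΩ
    measurableSet_Ioc (by simp) hG (hk.mono (Set.prod_mono le_rfl hsub))
    (fun x hx t ht => hb t (hsub ht) x hx) hGb fun t ht => h0 t (hsub ht)).congr hΩ fun x hx => ?_
  rw [← intervalIntegral.integral_of_le zero_le_one,
    intervalIntegral.integral_eq_sub_of_hasDerivAt (f := Φ x)]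
  · intro t ht
    rw [Set.uIcc_of_le zero_le_one] at ht
    exact hΦ t ht x hx
  · refine ContinuousOn.intervalIntegrable ?_
    rw [Set.uIcc_of_le zero_le_one]
    exact hk.comp (f := fun t : ℝ => (x, t)) (by fun_prop) fun t ht => ⟨hx, ht⟩

end Fubini

/-! ### Weak continuity of dilations in `L²` -/

section Dilation

/-- Dilations by factors near `1` are uniformly bounded on `L²`, so it suffices to prove convergence
for a dense class. For continuous compactly supported functions dominated convergence applies. -/
theorem tendsto_integral_mul_dilation {f g : E3 → ℝ} (hf : MemLp f 2) (hg : MemLp g 2)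
    {c : ℕ → ℝ} (hc : Tendsto c atTop (𝓝 1)) :
    Tendsto (fun n => ∫ x, g x * f (c n • x)) atTop (𝓝 (∫ x, g x * f x)) := by
  have hg2 : Integrable fun x => g x ^ 2 := hg.integrable_sq
  set A : ℝ := ∫ x, g x ^ 2 with hA
  have hA0 : 0 ≤ A := integral_nonneg fun x => sq_nonneg _
  have hdil : ∀ {u : E3 → ℝ}, MemLp u 2 → ∀ {a : ℝ}, a ≠ 0 → MemLp (fun x => u (a • x)) 2 := by
    intro u hu a ha
    have hm : AEStronglyMeasurable (fun x => u (a • x)) (volume : Measure E3) := by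
      refine hu.1.comp_quasiMeasurePreserving ⟨measurable_const_smul a, ?_⟩
      have := Measure.map_addHaar_smul (volume : Measure E3) ha
      rw [this]
      exact Measure.smul_absolutelyContinuous
    rw [memLp_two_iff_integrable_sq hm]
    exact (integrable_comp_smul_iff volume (fun x => u x ^ 2) ha).2 hu.integrable_sq
  -- A weighted arithmetic-geometric mean inequality in place of Cauchy-Schwarz: with `∫u²` of order
  -- `d²`, both terms are of order `d`.
  have amgm : ∀ {u : E3 → ℝ}, MemLp u 2 → ∀ {d : ℝ}, 0 < d →
      |∫ x, g x * u x| ≤ d * A + d⁻¹ * ∫ x, u x ^ 2 := by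
    intro u hu d hd
    have h1 : |∫ x, g x * u x| ≤ ∫ x, (d * g x ^ 2 + d⁻¹ * u x ^ 2) := by
      rw [← Real.norm_eq_abs]
      refine norm_integral_le_of_norm_le ((hg2.const_mul d).add (hu.integrable_sq.const_mul d⁻¹))
        (ae_of_all _ fun x => ?_)
      rw [Real.norm_eq_abs, abs_mul]
      have e : d * g x ^ 2 + d⁻¹ * u x ^ 2 - |g x| * |u x| =
          d⁻¹ * ((d * |g x| - |u x| / 2) ^ 2 + (3 / 4) * |u x| ^ 2) := by
        rw [← sq_abs (g x), ← sq_abs (u x)]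
        field_simp
        ring
      have : 0 ≤ d⁻¹ * ((d * |g x| - |u x| / 2) ^ 2 + (3 / 4) * |u x| ^ 2) := by positivity
      linarith
    rwa [integral_add (hg2.const_mul d) (hu.integrable_sq.const_mul d⁻¹), integral_const_mul,
      integral_const_mul] at h1
  rw [Metric.tendsto_atTop']
  -- The total `d(2A + 10)` is made of `d` from the compactly supported part, `dA + 8d` from the
  -- dilated remainder and `dA + d` from the undilated one.
  have hconc : ∀ d : ℝ, 0 < d → ∀ᶠ n in atTop,
      |(∫ x, g x * f (c n • x)) - ∫ x, g x * f x| ≤ d * (2 * A + 10) := by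
    intro d hd
    obtain ⟨φ, hφc, hφ, hφcont, hφL⟩ := MemLp.exists_hasCompactSupport_integral_rpow_sub_le
      (p := 2) (by norm_num) (by simpa using hf) (ε := d ^ 2) (by positivity)
    have hφL : MemLp φ 2 := by simpa using hφL
    have hu : MemLp (fun x => f x - φ x) 2 := hf.sub hφL
    have hu2 : ∫ x, (f x - φ x) ^ 2 ≤ d ^ 2 := by
      refine le_trans (le_of_eq ?_) hφ
      refine integral_congr_ae (ae_of_all _ fun x => ?_)
      simp
    have hφlim : Tendsto (fun n => ∫ x, g x * φ (c n • x)) atTop (𝓝 (∫ x, g x * φ x)) := by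
      obtain ⟨C, hC⟩ := hφc.exists_bound_of_continuous hφcont
      obtain ⟨R, hR⟩ := hφc.isCompact.isBounded.subset_closedBall (0 : E3)
      have hC0 : 0 ≤ C := (norm_nonneg _).trans (hC 0)
      have hgi : IntegrableOn g (Metric.closedBall (0 : E3) (2 * |R|)) := by
        have : IsFiniteMeasure (volume.restrict (Metric.closedBall (0 : E3) (2 * |R|))) :=
          ⟨by
            rw [Measure.restrict_apply_univ]
            exact (isCompact_closedBall (0 : E3) (2 * |R|)).measure_lt_top⟩
        exact (hg.restrict _).integrable (by norm_num)
      refine tendsto_integral_filter_of_dominated_convergence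
        (fun x => Set.indicator (Metric.closedBall (0 : E3) (2 * |R|)) (fun x => C * ‖g x‖) x)
        ?_ ?_ ?_ ?_
      · exact Eventually.of_forall fun n =>
          hg.1.mul (hφcont.comp (continuous_const_smul _)).aestronglyMeasurable
      · filter_upwards [hc.eventually (lt_mem_nhds (by norm_num : (1 / 2 : ℝ) < 1))] with n hn
        refine ae_of_all _ fun x => ?_
        by_cases hx : x ∈ Metric.closedBall (0 : E3) (2 * |R|)
        · rw [Set.indicator_of_mem hx, norm_mul, mul_comm]
          gcongr
          exact hC _
        · have : φ (c n • x) = 0 := by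
            by_contra hne
            have h1 := hR (subset_tsupport _ hne)
            simp only [Metric.mem_closedBall, dist_zero_right, norm_smul, not_le] at h1 hx
            rw [Real.norm_of_nonneg (by linarith)] at h1
            nlinarith [le_abs_self R, norm_nonneg x]
          rw [this, Set.indicator_of_notMem hx]; simp
      · exact (integrable_indicator_iff Metric.isClosed_closedBall.measurableSet).2
          (hgi.norm.const_mul C)
      · refine ae_of_all _ fun x => ?_
        refine Tendsto.const_mul _ ?_
        have h1 : Tendsto (fun n => c n • x) atTop (𝓝 ((1 : ℝ) • x)) := hc.smul_const x
        rw [one_smul] at h1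
        exact (hφcont.tendsto x).comp h1
    filter_upwards [Metric.tendsto_atTop'.1 hφlim d hd |>.choose_spec |> fun h =>
      eventually_gt_atTop _ |>.mono h, hc.eventually (lt_mem_nhds (by norm_num : (1 / 2 : ℝ) < 1))]
      with n hn hcn
    have hcn0 : c n ≠ 0 := by linarith
    have i1 : Integrable fun x => g x * φ (c n • x) :=
      MemLp.integrable_mul (p := 2) (q := 2) hg (hdil hφL hcn0)
    have i2 : Integrable fun x => g x * (f (c n • x) - φ (c n • x)) :=
      MemLp.integrable_mul (p := 2) (q := 2) hg (hdil hu hcn0)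
    have i3 : Integrable fun x => g x * φ x := MemLp.integrable_mul (p := 2) (q := 2) hg hφL
    have i4 : Integrable fun x => g x * (f x - φ x) := MemLp.integrable_mul (p := 2) (q := 2) hg hu
    have e1 : ∫ x, g x * f (c n • x) =
        (∫ x, g x * φ (c n • x)) + ∫ x, g x * (f (c n • x) - φ (c n • x)) := by
      rw [← integral_add i1 i2]
      exact integral_congr_ae (ae_of_all _ fun x => by simp only; ring)
    have e2 : ∫ x, g x * f x = (∫ x, g x * φ x) + ∫ x, g x * (f x - φ x) := by
      rw [← integral_add i3 i4]
      exact integral_congr_ae (ae_of_all _ fun x => by simp only; ring)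
    have b1 := amgm (hdil hu hcn0) hd
    have b2 := amgm hu hd
    have hs := Measure.integral_comp_smul (volume : Measure E3) (fun x => (f x - φ x) ^ 2) (c n)
    have hfr : Module.finrank ℝ E3 = 3 := by simp
    rw [hfr, smul_eq_mul] at hs
    rw [hs] at b1
    -- The Jacobian of the dilation in dimension three, with `c n > 1/2`.
    have hc8 : |(c n ^ 3)⁻¹| ≤ 8 := by
      rw [abs_of_nonneg (by positivity), inv_le_comm₀ (by positivity) (by norm_num)]
      have : (1 / 2 : ℝ) ^ 3 ≤ c n ^ 3 := by gcongr
      norm_num at this ⊢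
      linarith
    have hu0 : 0 ≤ ∫ x, (f x - φ x) ^ 2 := integral_nonneg fun x => sq_nonneg _
    have b3 : d⁻¹ * (|(c n ^ 3)⁻¹| * ∫ x, (f x - φ x) ^ 2) ≤ 8 * d := by
      calc _ ≤ d⁻¹ * (8 * d ^ 2) := by gcongr
        _ = 8 * d := by field_simp
    have b4 : d⁻¹ * ∫ x, (f x - φ x) ^ 2 ≤ d := by
      calc _ ≤ d⁻¹ * d ^ 2 := by gcongr
        _ = d := by field_simp
    rw [Real.dist_eq] at hn
    rw [e1, e2]
    rw [abs_le] at b1 b2 ⊢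
    rw [abs_lt] at hn
    constructor <;> linarith [b1.1, b1.2, b2.1, b2.2, hn.1, hn.2]
  intro e he
  have hK : 0 < 2 * A + 10 := by linarith
  obtain ⟨N, hN⟩ := eventually_atTop.1 (hconc (e / (2 * (2 * A + 10))) (by positivity))
  refine ⟨N, fun n hn => ?_⟩
  rw [Real.dist_eq]
  refine (hN n hn.le).trans_lt ?_
  have : e / (2 * (2 * A + 10)) * (2 * A + 10) = e / 2 := by field_simp
  rw [this]; linarith

end Dilation

/-! ### Moving the pole in the `x₀`-direction -/

section Poles

theorem pole_zero_eq {y x : E3} (h : x ≠ y) : pole y 0 x = ((‖x - y‖⁻¹ : ℝ) : ℂ) := by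
  have h0 : 0 < ‖x - y‖ := norm_pos_iff.2 (sub_ne_zero.2 h)
  have := pole_eq (x := y) (y := x) (e := 0) (by positivity)
  simpa [Real.sqrt_sq h0.le] using this

theorem cdist_pole_zero_mem {y x : E3} (h : x ≠ y) :
    cdist (y 0) (conj (zc y)) (zc y) 0 x ∈ Complex.slitPlane := by
  have h0 : 0 < ‖x - y‖ := norm_pos_iff.2 (sub_ne_zero.2 h)
  have := cdist_pole_mem (x := y) (y := x) (e := 0) (by positivity)
  simpa using this

theorem norm_pole_zero {y x : E3} (h : x ≠ y) : ‖pole y 0 x‖ = ‖x - y‖⁻¹ := by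
  rw [pole_zero_eq h, Complex.norm_real, Real.norm_of_nonneg (by positivity)]

theorem norm_pd_pole_zero_le {y x : E3} (h : x ≠ y) (i : Fin 3) :
    ‖pd i (pole y 0) x‖ ≤ (‖x - y‖ ^ 2)⁻¹ := by
  simpa using norm_pd_pole_le (x := y) (y := x) (e := 0) le_rfl h i

theorem contDiffAt_pole_zero {y x : E3} (h : x ≠ y) {n : WithTop ℕ∞} :
    ContDiffAt ℝ n (pole y 0) x := contDiffAt_newton (cdist_pole_zero_mem h)

theorem lap_pole_zero {y x : E3} (h : x ≠ y) : lap (pole y 0) x = 0 := by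
  rw [pole, lap_newton (cdist_pole_zero_mem h)]; simp

/-- If `G` is orthogonal to the `x₀`-derivatives of the Newtonian kernels with poles on a segment in
the `x₀`-direction, it is orthogonal to the difference of the kernels at the end points. -/
theorem orth_pole_sub {Ω : Set E3} (hΩ : MeasurableSet Ω) {G : E3 → ℂ}
    (hG : AEStronglyMeasurable G (volume.restrict Ω)) {y : E3} {T : ℝ} {b : E3 → ℝ}
    (hout : ∀ t ∈ Set.Icc (0 : ℝ) 1, ∀ x ∈ Ω, x ≠ y + (t * T) • EuclideanSpace.single 0 1)
    (hb : ∀ t ∈ Set.Icc (0 : ℝ) 1, ∀ x ∈ Ω,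
      ‖pd 0 (pole (y + (t * T) • EuclideanSpace.single 0 1) 0) x‖ ≤ b x)
    (hGb : Integrable (fun x => ‖G x‖ * b x) (volume.restrict Ω))
    (h0 : ∀ t ∈ Set.Icc (0 : ℝ) 1,
      ∫ x in Ω, G x * pd 0 (pole (y + (t * T) • EuclideanSpace.single 0 1) 0) x = 0) :
    Orth Ω G fun x => pole (y + T • EuclideanSpace.single 0 1) 0 x - pole y 0 x := by
  set yt : ℝ → E3 := fun t => y + (t * T) • EuclideanSpace.single 0 1 with hyt
  have hp : ∀ t, pole (yt t) 0 =
      newton ((y 0 + t * T : ℝ) : ℂ) (conj (zc y)) (zc y) 0 := fun t => by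
    have h1 : (yt t) 0 = y 0 + t * T := by simp [hyt]
    have h2 : zc (yt t) = zc y := by simp [hyt, zc]
    rw [pole, h1, h2]
  have hmem : ∀ t ∈ Set.Icc (0 : ℝ) 1, ∀ x ∈ Ω,
      cdist ((y 0 + t * T : ℝ) : ℂ) (conj (zc y)) (zc y) 0 x ∈ Complex.slitPlane := by
    intro t ht x hx
    have h1 : (yt t) 0 = y 0 + t * T := by simp [hyt]
    have h2 : zc (yt t) = zc y := by simp [hyt, zc]
    have := cdist_pole_zero_mem (hout t ht x hx)
    change cdist ((yt t) 0) (conj (zc (yt t))) (zc (yt t)) 0 x ∈ _ at this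
    rwa [h1, h2] at this
  set k : E3 → ℝ → ℂ := fun x t => T * (((x 0 : ℂ) - ((y 0 + t * T : ℝ) : ℂ)) *
    invSqrt (cdist ((y 0 + t * T : ℝ) : ℂ) (conj (zc y)) (zc y) 0 x) ^ 3) with hk
  -- The kernel depends on `x₀` and the pole only through their difference, so moving the pole with
  -- velocity `T` gives `-T ∂₀`.
  have hkp : ∀ t ∈ Set.Icc (0 : ℝ) 1, ∀ x ∈ Ω, k x t = -(T : ℂ) * pd 0 (pole (yt t) 0) x := by
    intro t ht x hx
    rw [hp t, pd_zero_newton (hmem t ht x hx), hk, newton]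
    ring
  have hcd : Continuous fun p : E3 × ℝ =>
      cdist ((y 0 + p.2 * T : ℝ) : ℂ) (conj (zc y)) (zc y) 0 p.1 := by
    simp only [cdist, zc]; fun_prop
  have hkc : ContinuousOn (fun p : E3 × ℝ => k p.1 p.2) (Ω ×ˢ Set.Icc (0 : ℝ) 1) := by
    intro p hp'
    refine ContinuousAt.continuousWithinAt ?_
    refine continuousAt_const.mul (ContinuousAt.mul ?_ (ContinuousAt.pow ?_ 3))
    · fun_prop
    · exact ContinuousAt.comp (f := fun p : E3 × ℝ =>
        cdist ((y 0 + p.2 * T : ℝ) : ℂ) (conj (zc y)) (zc y) 0 p.1)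
        (hasDerivAt_invSqrt (hmem _ hp'.2 _ hp'.1)).continuousAt hcd.continuousAt
  have hd : ∀ t ∈ Set.Icc (0 : ℝ) 1, ∀ x ∈ Ω,
      HasDerivAt (fun t => pole (yt t) 0 x) (k x t) t := by
    intro t ht x hx
    have e : (fun t => pole (yt t) 0 x) = fun t : ℝ =>
        invSqrt (cdist ((y 0 + t * T : ℝ) : ℂ) (conj (zc y)) (zc y) 0 x) := by
      funext t; rw [hp t]; rfl
    rw [e]
    have h1 : HasDerivAt (fun t : ℝ => cdist ((y 0 + t * T : ℝ) : ℂ) (conj (zc y)) (zc y) 0 x)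
        (2 * ((x 0 : ℂ) - ((y 0 + t * T : ℝ) : ℂ)) * (-T)) t := by
      have h2 : HasDerivAt (fun t : ℝ => ((y 0 + t * T : ℝ) : ℂ)) ((1 * T : ℝ) : ℂ) t :=
        (((hasDerivAt_id t).mul_const T).const_add (y 0)).ofReal_comp
      have h3 := (((h2.const_sub (x 0 : ℂ)).pow 2).add_const
        ((zc x - zc y) * (conj (zc x) - conj (zc y)))).add_const (0 : ℂ)
      refine h3.congr_deriv ?_
      push_cast; ring
    refine ((hasDerivAt_invSqrt (hmem t ht x hx)).comp t h1).congr_deriv ?_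
    simp only [hk]; ring
  have key := orth_sub_of_hasDerivAt (k := k) (b := fun x => |T| * b x) hΩ hG hd hkc
    (fun t ht x hx => by
      rw [hkp t ht x hx, norm_mul, norm_neg, Complex.norm_real, Real.norm_eq_abs]
      exact mul_le_mul_of_nonneg_left (hb t ht x hx) (abs_nonneg T))
    ((hGb.const_mul |T|).congr (ae_of_all _ fun x => by simp only; ring))
    (fun t ht => by
      have e : ∀ x ∈ Ω, G x * k x t = -(T : ℂ) * (G x * pd 0 (pole (yt t) 0) x) := fun x hx => by
        rw [hkp t ht x hx]; ring
      rw [setIntegral_congr_fun hΩ e, integral_const_mul, h0 t ht, mul_zero])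
  simpa [hyt] using key

end Poles

/-! ### Harmonic functions as superpositions of poles in a shell -/

section Gluing

theorem pd_comp_smul {f : E3 → ℂ} {c : ℝ} {x : E3} (hf : DifferentiableAt ℝ f (c • x))
    (i : Fin 3) : pd i (fun y => f (c • y)) x = c * pd i f (c • x) := by
  have h := hf.hasFDerivAt.comp x ((hasFDerivAt_id x).const_smul c)
  unfold pd
  erw [h.fderiv]
  simp

theorem lap_comp_smul {f : E3 → ℂ} {c : ℝ} {x : E3} (hf : ContDiffAt ℝ 2 f (c • x)) :
    lap (fun y => f (c • y)) x = c ^ 2 * lap f (c • x) := by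
  simp only [lap, Finset.mul_sum]
  refine Finset.sum_congr rfl fun i _ => ?_
  have h1 : pd i (fun y => f (c • y)) =ᶠ[𝓝 x] fun y => (c : ℂ) * pd i f (c • y) := by
    have hc : ContinuousAt (fun y : E3 => c • y) x := by fun_prop
    filter_upwards [hc.eventually (hf.eventually (by simp))] with y hy
    exact pd_comp_smul (hy.differentiableAt (by norm_num)) i
  rw [pd_congr h1]
  have hd : DifferentiableAt ℝ (pd i f) (c • x) :=
    (contDiffAt_pd hf (m := 1) (by norm_num) i).differentiableAt (by norm_num)
  have hd' : DifferentiableAt ℝ (fun y => pd i f (c • y)) x :=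
    hd.comp x (by fun_prop : DifferentiableAt ℝ (fun y : E3 => c • y) x)
  refine (((hasPD_of_differentiableAt hd').const_mul (c : ℂ)).2 i).trans ?_
  beta_reduce
  rw [pd_comp_smul hd]
  ring

/-- The smooth cutoff of `u` to `{σ (‖y‖² - 1) < 2}`, unchanged on `{σ (‖y‖² - 1) ≤ 1}`. -/
noncomputable def glue (σ : ℝ) (u : E3 → ℂ) (y : E3) : ℂ :=
  ((1 - step (σ * (‖y‖ ^ 2 - 1)) : ℝ) : ℂ) * u y

variable {σ : ℝ} {u : E3 → ℂ}

theorem glue_of_le {y : E3} (hy : σ * (‖y‖ ^ 2 - 1) ≤ 1) : glue σ u y = u y := by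
  simp [glue, step_of_le hy]

theorem glue_of_ge {y : E3} (hy : 2 ≤ σ * (‖y‖ ^ 2 - 1)) : glue σ u y = 0 := by
  simp [glue, step_of_ge hy]

theorem norm_glue_le (y : E3) : ‖glue σ u y‖ ≤ ‖u y‖ := by
  rw [glue, norm_mul, Complex.norm_real, Real.norm_of_nonneg (sub_nonneg.2 (step_le_one _))]
  exact mul_le_of_le_one_left (norm_nonneg _) (by linarith [step_nonneg (σ * (‖y‖ ^ 2 - 1))])

theorem continuous_shell : Continuous fun y : E3 => σ * (‖y‖ ^ 2 - 1) := by fun_prop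

theorem contDiff_glue (hu : ∀ y : E3, σ * (‖y‖ ^ 2 - 1) ≤ 2 → ContDiffAt ℝ 2 u y) :
    ContDiff ℝ 2 (glue σ u) := by
  refine contDiff_iff_contDiffAt.2 fun y => ?_
  rcases le_or_gt (σ * (‖y‖ ^ 2 - 1)) 2 with h | h
  · refine ContDiffAt.mul ?_ (hu y h)
    refine ContDiff.contDiffAt ?_
    have h1 : ContDiff ℝ 2 step := contDiff_step.of_le (by norm_cast)
    exact Complex.ofRealCLM.contDiff.comp (contDiff_const.sub (h1.comp
      (contDiff_const.mul ((contDiff_norm_sq ℝ).sub contDiff_const))))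
  · refine (contDiffAt_const (c := (0 : ℂ))).congr_of_eventuallyEq ?_
    filter_upwards [(isOpen_lt continuous_const (continuous_shell (σ := σ))).mem_nhds h] with v hv
    exact glue_of_ge (le_of_lt hv)

/-- The glued function is harmonic before the transition and zero after it, so its Laplacian charges
only the shell. For `σ > 0` that shell lies outside the unit ball, for `σ < 0` inside, which lets
one argument serve both domains. -/
theorem tsupport_lap_glue (hl : ∀ y : E3, σ * (‖y‖ ^ 2 - 1) ≤ 1 → lap u y = 0) :
    tsupport (lap (glue σ u)) ⊆ {y : E3 | σ * (‖y‖ ^ 2 - 1) ∈ Set.Icc 1 2} := by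
  refine closure_minimal (fun y hy => ?_) (isClosed_Icc.preimage continuous_shell)
  by_contra hn
  refine hy ?_
  rcases lt_or_ge (σ * (‖y‖ ^ 2 - 1)) 1 with h | h
  · have : glue σ u =ᶠ[𝓝 y] u := by
      filter_upwards [(isOpen_lt (continuous_shell (σ := σ)) continuous_const).mem_nhds h] with v hv
      exact glue_of_le (le_of_lt hv)
    rw [lap_congr this, hl y h.le]
  · have h2 : 2 < σ * (‖y‖ ^ 2 - 1) := by
      by_contra! h2
      exact hn ⟨h, h2⟩
    have : glue σ u =ᶠ[𝓝 y] fun _ => 0 := by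
      filter_upwards [(isOpen_lt continuous_const (continuous_shell (σ := σ))).mem_nhds h2]
        with v hv
      exact glue_of_ge (le_of_lt hv)
    have hz : ∀ i, pd i (fun _ : E3 => (0 : ℂ)) = fun _ => 0 := fun i => by funext v; simp [pd]
    rw [lap_congr this]
    simp only [lap, hz]
    simp

theorem isCompact_shell (hσ : σ ≠ 0) : IsCompact {y : E3 | σ * (‖y‖ ^ 2 - 1) ∈ Set.Icc 1 2} := by
  refine (isCompact_closedBall (0 : E3) (2 * |σ|⁻¹ + 2)).of_isClosed_subset
    (isClosed_Icc.preimage continuous_shell) fun y hy => ?_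
  simp only [Metric.mem_closedBall, dist_zero_right]
  have hs : 0 < |σ| := abs_pos.2 hσ
  have h1 : |σ| * |‖y‖ ^ 2 - 1| ≤ 2 := by
    rw [← abs_mul]
    have h : σ * (‖y‖ ^ 2 - 1) ∈ Set.Icc 1 2 := hy
    rw [abs_of_nonneg (by linarith [h.1])]
    exact h.2
  have h2 : |‖y‖ ^ 2 - 1| ≤ 2 * |σ|⁻¹ := by
    rw [← div_eq_mul_inv, le_div_iff₀ hs, mul_comm]; exact h1
  have h3 := (abs_le.1 h2).2
  have h4 : 0 < |σ|⁻¹ := by positivity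
  nlinarith [norm_nonneg y]

/-- If `G` is orthogonal to the Newtonian kernels (normalized by `κ`) with poles in a shell, it is
orthogonal to functions that are harmonic up to that shell. -/
theorem integral_mul_eq_zero_of_poles (hσ : σ ≠ 0) {Ω : Set E3} (hΩ : MeasurableSet Ω)
    (hΩσ : ∀ x ∈ Ω, σ * (‖x‖ ^ 2 - 1) ≤ 0) {G κ : E3 → ℂ} {b : E3 → ℝ}
    (hG : AEStronglyMeasurable G (volume.restrict Ω)) (hκ : ContinuousOn κ Ω)
    (hb : ∀ x ∈ Ω, ∀ y : E3, σ * (‖y‖ ^ 2 - 1) ∈ Set.Icc 1 2 → ‖pole y 0 x - κ x‖ ≤ b x)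
    (hGb : Integrable (fun x => ‖G x‖ * b x) (volume.restrict Ω))
    (h0 : ∀ y : E3, σ * (‖y‖ ^ 2 - 1) ∈ Set.Icc 1 2 → ∫ x in Ω, G x * (pole y 0 x - κ x) = 0)
    (hu : ∀ y : E3, σ * (‖y‖ ^ 2 - 1) ≤ 2 → ContDiffAt ℝ 2 u y)
    (hl : ∀ y : E3, σ * (‖y‖ ^ 2 - 1) ≤ 1 → lap u y = 0)
    (hL : MemLp (glue σ u) 2 (volume.restrict exteriorBall)) :
    ∫ x in Ω, G x * u x = 0 := by
  set Y : Set E3 := {y : E3 | σ * (‖y‖ ^ 2 - 1) ∈ Set.Icc 1 2} with hY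
  have hYc : IsCompact Y := isCompact_shell hσ
  have hYm : MeasurableSet Y := hYc.isClosed.measurableSet
  have hφ := contDiff_glue hu
  have hts := tsupport_lap_glue hl
  have hw : HasCompactSupport (lap (glue σ u)) :=
    hYc.of_isClosed_subset (isClosed_tsupport _) hts
  have hwc := continuous_lap hφ
  obtain ⟨C, hC⟩ := hw.exists_bound_of_continuous hwc
  have hne : ∀ x ∈ Ω, ∀ y ∈ Y, x ≠ y := by
    rintro x hx y hy rfl
    linarith [hΩσ x hx, hy.1]
  -- At points of `Ω` the cutoff is still `1`, so the potential of the glued function reproduces `u`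
  -- there. The normalization `κ x` may vary with `x`, since the representation holds for each
  -- constant.
  have hrep : ∀ x ∈ Ω, newtonConst * u x =
      -∫ y in Y, (pole y 0 x - κ x) * lap (glue σ u) y := by
    intro x hx
    have hx0 := hΩσ x hx
    have h1 := newton_representation hφ hL hw (x := x)
      (fun h => hne x hx x (hts h) rfl) (κ x)
    rw [glue_of_le (by linarith)] at h1
    rw [h1, ← setIntegral_eq_integral_of_forall_compl_eq_zero (s := Y)]
    · congr 1
      refine setIntegral_congr_fun hYm fun y hy => ?_
      rw [pole_zero_eq (hne x hx y hy), norm_sub_rev]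
    · intro y hy
      rw [image_eq_zero_of_notMem_tsupport fun h => hy (hts h), mul_zero]
  have hC0 : 0 ≤ C := (norm_nonneg _).trans (hC 0)
  have hcont : ContinuousOn (fun p : E3 × E3 => (pole p.2 0 p.1 - κ p.1) * lap (glue σ u) p.2)
      (Ω ×ˢ Y) := by
    refine ContinuousOn.mul (ContinuousOn.sub ?_ ?_) (hwc.comp continuous_snd).continuousOn
    · have : ContinuousOn (fun p : E3 × E3 => ((‖p.1 - p.2‖⁻¹ : ℝ) : ℂ)) (Ω ×ˢ Y) := by
        refine Complex.continuous_ofReal.comp_continuousOn ?_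
        refine ContinuousOn.inv₀ (by fun_prop) fun p hp => ?_
        exact norm_ne_zero_iff.2 (sub_ne_zero.2 (hne _ hp.1 _ hp.2))
      exact this.congr fun p hp => pole_zero_eq (hne _ hp.1 _ hp.2)
    · exact hκ.comp continuousOn_fst fun p hp => hp.1
  have key := (orth_integral (ν := (volume : Measure E3)) (A := Y)
    (k := fun x y => (pole y 0 x - κ x) * lap (glue σ u) y) (b := fun x => b x * C) hΩ hYm
    hYc.measure_lt_top.ne hG hcont
    (fun x hx y hy => by
      rw [norm_mul]
      exact mul_le_mul (hb x hx y hy) (hC y) (norm_nonneg _)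
        ((norm_nonneg _).trans (hb x hx y hy)))
    ((hGb.mul_const C).congr (ae_of_all _ fun x => by simp only; ring))
    (fun y hy => by
      have e : ∀ x, G x * ((pole y 0 x - κ x) * lap (glue σ u) y) =
          (G x * (pole y 0 x - κ x)) * lap (glue σ u) y := fun x => by ring
      simp_rw [e]
      rw [integral_mul_const, h0 y hy, zero_mul])).2
  have e : ∀ x ∈ Ω, G x * ∫ y in Y, (pole y 0 x - κ x) * lap (glue σ u) y =
      (-(newtonConst : ℂ)) * (G x * u x) := fun x hx => by
    linear_combination G x * hrep x hx
  rw [setIntegral_congr_fun hΩ e, integral_const_mul] at key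
  refine (mul_eq_zero.1 key).resolve_left ?_
  simpa using newtonConst_pos.ne'

end Gluing

/-! ### The interior of the ball -/

section Interior

variable {f : E3 → ℍ[ℝ]}

theorem isFiniteMeasure_interiorBall : IsFiniteMeasure (volume.restrict interiorBall) := by
  refine ⟨?_⟩
  rw [Measure.restrict_apply_univ]
  refine lt_of_le_of_lt (measure_mono fun x hx => ?_)
    (isCompact_closedBall (0 : E3) 1).measure_lt_top
  have hx : ‖x‖ < 1 := hx
  simpa using hx.le

theorem norm_sub_ge_of_mem_interiorBall {x y : E3} (hx : x ∈ interiorBall) :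
    ‖y‖ - 1 ≤ ‖x - y‖ := by
  have hx : ‖x‖ < 1 := hx
  have := norm_sub_norm_le y x
  rw [norm_sub_rev] at this
  linarith

theorem ne_of_mem_interiorBall {x y : E3} (hx : x ∈ interiorBall) (hy : 1 < ‖y‖) : x ≠ y := by
  rintro rfl
  have hx : ‖x‖ < 1 := hx
  linarith

theorem IsContragenic.integral_re_mul_pd_pole_interior (hf : IsContragenic interiorBall f)
    {y : E3} (hy : 1 < ‖y‖) :
    ∫ x in interiorBall, ((f x).re : ℂ) * pd 0 (pole y 0) x = 0 := by
  have := isFiniteMeasure_interiorBall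
  refine hf.integral_re_mul_pd_complex isOpen_interiorBall
    (fun x hx => (contDiffAt_pole_zero (ne_of_mem_interiorBall hx hy)).contDiffWithinAt)
    (fun x hx => lap_pole_zero (ne_of_mem_interiorBall hx hy)) fun i => ?_
  refine MemLp.of_bound (C := ((‖y‖ - 1) ^ 2)⁻¹) ?_ ?_
  · refine ContinuousOn.aestronglyMeasurable (fun x hx => ?_) isOpen_interiorBall.measurableSet
    exact (contDiffAt_pd (contDiffAt_pole_zero (ne_of_mem_interiorBall hx hy) (n := 1)) (m := 0)
      (by norm_num) i).continuousAt.continuousWithinAt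
  · filter_upwards [ae_restrict_mem isOpen_interiorBall.measurableSet] with x hx
    refine (norm_pd_pole_zero_le (ne_of_mem_interiorBall hx hy) i).trans ?_
    have := norm_sub_ge_of_mem_interiorBall (y := y) hx
    have h1 : 0 < ‖y‖ - 1 := by linarith
    gcongr

theorem norm_add_smul_ge {y : E3} {T : ℝ} (h : 0 ≤ y 0 * T) :
    ‖y‖ ≤ ‖y + T • (EuclideanSpace.single 0 1 : E3)‖ ∧
    |T| ≤ ‖y + T • (EuclideanSpace.single 0 1 : E3)‖ := by
  have e : ‖y + T • (EuclideanSpace.single 0 1 : E3)‖ ^ 2 = ‖y‖ ^ 2 + 2 * (y 0 * T) + T ^ 2 := by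
    rw [norm_sq_eq, norm_sq_eq]
    simp
    ring
  constructor
  · refine le_of_sq_le_sq ?_ (norm_nonneg _)
    rw [e]; nlinarith [sq_nonneg T]
  · refine le_of_sq_le_sq ?_ (norm_nonneg _)
    rw [e, sq_abs]; nlinarith [sq_nonneg ‖y‖]

/-- The integral does not change when the pole is shifted parallel to the `x₀`-axis without meeting
the ball. The shifted kernel tends to zero uniformly on the ball, so the common value is zero. -/
theorem IsContragenic.integral_re_mul_pole_interior (hf : IsContragenic interiorBall f)
    {y : E3} (hy : 1 < ‖y‖) : ∫ x in interiorBall, ((f x).re : ℂ) * pole y 0 x = 0 := by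
  have := isFiniteMeasure_interiorBall
  have hL1 : Integrable (fun x => ((f x).re : ℂ)) (volume.restrict interiorBall) :=
    (hf.memLp_re.integrable (by norm_num)).ofReal
  -- The sign is chosen so that the shift does not decrease `|y|` and the pole cannot run into the
  -- ball.
  obtain ⟨s, hs, hs0⟩ : ∃ s : ℝ, |s| = 1 ∧ 0 ≤ y 0 * s := by
    rcases le_total 0 (y 0) with h | h
    · exact ⟨1, by simp, by simpa using h⟩
    · exact ⟨-1, by simp, by simpa using h⟩
  have hge : ∀ T : ℝ, 0 ≤ T → ‖y‖ ≤ ‖y + (T * s) • (EuclideanSpace.single 0 1 : E3)‖ ∧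
      T ≤ ‖y + (T * s) • (EuclideanSpace.single 0 1 : E3)‖ := fun T hT => by
    have h := norm_add_smul_ge (y := y) (T := T * s) (by nlinarith)
    rw [abs_mul, hs, mul_one, abs_of_nonneg hT] at h
    exact h
  have hpint : ∀ v : E3, 1 < ‖v‖ →
      Integrable (fun x => ((f x).re : ℂ) * pole v 0 x) (volume.restrict interiorBall) := by
    intro v hv
    refine hL1.mul_bdd (c := (‖v‖ - 1)⁻¹) ?_ ?_
    · refine ContinuousOn.aestronglyMeasurable (fun x hx => ?_) isOpen_interiorBall.measurableSet
      exact (contDiffAt_pole_zero (ne_of_mem_interiorBall hx hv)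
        (n := 0)).continuousAt.continuousWithinAt
    · filter_upwards [ae_restrict_mem isOpen_interiorBall.measurableSet] with x hx
      rw [norm_pole_zero (ne_of_mem_interiorBall hx hv)]
      exact inv_anti₀ (by linarith) (norm_sub_ge_of_mem_interiorBall hx)
  have hseg : ∀ n : ℕ, ∫ x in interiorBall, ((f x).re : ℂ) * pole y 0 x =
      ∫ x in interiorBall,
        ((f x).re : ℂ) * pole (y + ((n : ℝ) * s) • EuclideanSpace.single 0 1) 0 x := by
    intro n
    have hout : ∀ t ∈ Set.Icc (0 : ℝ) 1,
        ‖y‖ ≤ ‖y + (t * ((n : ℝ) * s)) • (EuclideanSpace.single 0 1 : E3)‖ := fun t ht => by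
      have := (hge (t * n) (mul_nonneg ht.1 (Nat.cast_nonneg n))).1
      rwa [mul_assoc] at this
    have h := (orth_pole_sub (y := y) (T := (n : ℝ) * s)
      (b := fun _ => ((‖y‖ - 1) ^ 2)⁻¹) isOpen_interiorBall.measurableSet hL1.1
      (fun t ht x hx => ne_of_mem_interiorBall hx (hy.trans_le (hout t ht)))
      (fun t ht x hx => by
        refine (norm_pd_pole_zero_le
          (ne_of_mem_interiorBall hx (hy.trans_le (hout t ht))) 0).trans ?_
        have h1 := norm_sub_ge_of_mem_interiorBall
          (y := y + (t * ((n : ℝ) * s)) • EuclideanSpace.single 0 1) hx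
        have h2 : 0 < ‖y‖ - 1 := by linarith
        have h3 := hout t ht
        gcongr
        linarith)
      (hL1.norm.mul_const _)
      (fun t ht => hf.integral_re_mul_pd_pole_interior (hy.trans_le (hout t ht)))).2
    have h2 : 1 < ‖y + ((n : ℝ) * s) • (EuclideanSpace.single 0 1 : E3)‖ :=
      hy.trans_le (hge n (Nat.cast_nonneg n)).1
    simp_rw [mul_sub] at h
    rw [integral_sub (hpint _ h2) (hpint y hy)] at h
    exact (sub_eq_zero.1 h).symm
  set A : ℝ := ∫ x in interiorBall, ‖((f x).re : ℂ)‖ with hA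
  have hbound : ∀ n : ℕ, 2 ≤ n →
      ‖∫ x in interiorBall, ((f x).re : ℂ) * pole y 0 x‖ ≤ A * ((n : ℝ) - 1)⁻¹ := by
    intro n hn
    have hn' : (2 : ℝ) ≤ n := by exact_mod_cast hn
    obtain ⟨h1, h2⟩ := hge n (Nat.cast_nonneg n)
    rw [hseg n, hA, ← integral_mul_const]
    refine norm_integral_le_of_norm_le (hL1.norm.mul_const _) ?_
    filter_upwards [ae_restrict_mem isOpen_interiorBall.measurableSet] with x hx
    rw [norm_mul, norm_pole_zero (ne_of_mem_interiorBall hx (hy.trans_le h1))]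
    have := norm_sub_ge_of_mem_interiorBall
      (y := y + ((n : ℝ) * s) • EuclideanSpace.single 0 1) hx
    have h3 : (0 : ℝ) < n - 1 := by linarith
    gcongr
    linarith
  have hlim : Tendsto (fun n : ℕ => A * ((n : ℝ) - 1)⁻¹) atTop (𝓝 (A * 0)) :=
    (tendsto_inv_atTop_zero.comp
      (tendsto_atTop_add_const_right _ (-1) tendsto_natCast_atTop_atTop)).const_mul A
  rw [mul_zero] at hlim
  exact norm_le_zero_iff.1 (ge_of_tendsto hlim
    ((eventually_ge_atTop 2).mono fun n hn => hbound n hn))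

theorem IsContragenic.harmonic_re_ofReal {Ω : Set E3} (hf : IsContragenic Ω f) {x : E3}
    (hx : x ∈ Ω) : ContDiffAt ℝ 2 (fun x => ((f x).re : ℂ)) x ∧
      lap (fun x => ((f x).re : ℂ)) x = 0 := by
  have h := hf.harmonic_re x hx
  refine ⟨Complex.ofRealCLM.contDiff.contDiffAt.comp x h.1, ?_⟩
  have := lap_clm_comp Complex.ofRealCLM h.1
  rw [lap_eq_zero_of_harmonicAt h, map_zero] at this
  exact this

theorem IsContragenic.dilation {Ω : Set E3} (hf : IsContragenic Ω f) {c : ℝ} {x : E3}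
    (hx : c • x ∈ Ω) : ContDiffAt ℝ 2 (fun x => ((f (c • x)).re : ℂ)) x ∧
      lap (fun x => ((f (c • x)).re : ℂ)) x = 0 := by
  obtain ⟨h1, h2⟩ := hf.harmonic_re_ofReal hx
  refine ⟨h1.comp x (f := fun x : E3 => c • x) (by fun_prop), ?_⟩
  have := lap_comp_smul h1
  rw [h2, mul_zero] at this
  exact this

/-- A dilation with `c < 1` is harmonic on the ball of radius `1/c`. This leaves room for a shell of
poles outside the closed unit ball, all of whose kernels are orthogonal to `Sc f`. -/
theorem IsContragenic.integral_re_mul_dilation_interior (hf : IsContragenic interiorBall f)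
    {c : ℝ} (hc0 : 0 < c) (hc : c < 1) :
    ∫ x in interiorBall, (f x).re * (f (c • x)).re = 0 := by
  have := isFiniteMeasure_interiorBall
  have hL1 : Integrable (fun x => ((f x).re : ℂ)) (volume.restrict interiorBall) :=
    (hf.memLp_re.integrable (by norm_num)).ofReal
  have hcc : 0 < (c ^ 2)⁻¹ - 1 := by
    have : 1 < (c ^ 2)⁻¹ := (one_lt_inv₀ (by positivity)).2 (by nlinarith)
    linarith
  -- With this choice the cutoff ends at `|y|² = 1 + (c⁻² - 1)/2`, still below `c⁻²`, the limit of
  -- harmonicity of the dilation.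
  set σ : ℝ := 4 / ((c ^ 2)⁻¹ - 1) with hσ
  have hσ0 : 0 < σ := by positivity
  have hmem : ∀ y : E3, σ * (‖y‖ ^ 2 - 1) ≤ 2 → c • y ∈ interiorBall := by
    intro y hy
    change ‖c • y‖ < 1
    rw [norm_smul, Real.norm_of_nonneg hc0.le]
    rw [hσ, div_mul_eq_mul_div, div_le_iff₀ hcc] at hy
    have h1 : ‖y‖ ^ 2 < (c ^ 2)⁻¹ := by linarith
    have h2 : (c * ‖y‖) ^ 2 < 1 := by
      rw [mul_pow, ← mul_inv_cancel₀ (by positivity : c ^ 2 ≠ 0)]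
      gcongr
    nlinarith [norm_nonneg y, mul_nonneg hc0.le (norm_nonneg y)]
  -- The inner radius of the shell; `ρ > 1` gives a kernel bound uniform over the ball.
  set ρ : ℝ := Real.sqrt (1 + 1 / σ) with hρ
  have hρ1 : 1 < ρ := by
    rw [hρ, Real.lt_sqrt (by norm_num)]
    have : 0 < 1 / σ := by positivity
    linarith
  have hY : ∀ y : E3, σ * (‖y‖ ^ 2 - 1) ∈ Set.Icc 1 2 → ρ ≤ ‖y‖ := by
    intro y hy
    rw [hρ, Real.sqrt_le_left (norm_nonneg y)]
    have := hy.1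
    rw [mul_comm, ← div_le_iff₀ hσ0] at this
    linarith
  have hu := fun y hy => hf.dilation (hmem y hy)
  have hcs : HasCompactSupport (glue σ fun x => ((f (c • x)).re : ℂ)) := by
    refine HasCompactSupport.of_support_subset_isCompact
      (isCompact_closedBall (0 : E3) (c⁻¹)) fun y hy => ?_
    have h1 : σ * (‖y‖ ^ 2 - 1) ≤ 2 := by
      by_contra! h
      exact hy (glue_of_ge h.le)
    have h2 : ‖c • y‖ < 1 := hmem y h1
    rw [norm_smul, Real.norm_of_nonneg hc0.le] at h2
    simp only [Metric.mem_closedBall, dist_zero_right]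
    rw [← one_div, le_div_iff₀ hc0]; linarith
  have key := integral_mul_eq_zero_of_poles (σ := σ) (Ω := interiorBall)
    (G := fun x => ((f x).re : ℂ)) (κ := fun _ => 0) (b := fun _ => (ρ - 1)⁻¹)
    (u := fun x => ((f (c • x)).re : ℂ)) hσ0.ne' isOpen_interiorBall.measurableSet
    (fun x hx => by
      have hx : ‖x‖ < 1 := hx
      have : ‖x‖ ^ 2 - 1 ≤ 0 := by nlinarith [norm_nonneg x]
      exact mul_nonpos_of_nonneg_of_nonpos hσ0.le this)
    hL1.1 continuousOn_const
    (fun x hx y hy => by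
      have h1 := hY y hy
      rw [sub_zero, norm_pole_zero (ne_of_mem_interiorBall hx (hρ1.trans_le h1))]
      have := norm_sub_ge_of_mem_interiorBall (y := y) hx
      exact inv_anti₀ (by linarith) (by linarith))
    (hL1.norm.mul_const _)
    (fun y hy => by
      simpa using hf.integral_re_mul_pole_interior (hρ1.trans_le (hY y hy)))
    (fun y hy => (hu y hy).1) (fun y hy => (hu y (hy.trans (by norm_num))).2)
    (((contDiff_glue fun y hy => (hu y hy).1).continuous.memLp_of_hasCompactSupport hcs).restrict _)
  have e : ∫ x in interiorBall, (((f x).re * (f (c • x)).re : ℝ) : ℂ) = 0 := by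
    simpa using key
  rw [integral_complex_ofReal] at e
  exact_mod_cast e

/-- If `G` is orthogonal to the dilations of `u` in a set `Ω` stable under them, it is orthogonal
to `u`. -/
theorem integral_mul_eq_zero_of_dilation {Ω : Set E3} (hΩ : MeasurableSet Ω) {G u : E3 → ℝ}
    (hG : MemLp G 2 (volume.restrict Ω)) (hu : MemLp u 2 (volume.restrict Ω)) {c : ℕ → ℝ}
    (hc : Tendsto c atTop (𝓝 1)) (hcΩ : ∀ n, ∀ x ∈ Ω, c n • x ∈ Ω)
    (h0 : ∀ n, ∫ x in Ω, G x * u (c n • x) = 0) : ∫ x in Ω, G x * u x = 0 := by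
  have hG' : MemLp (Ω.indicator G) 2 := (memLp_indicator_iff_restrict hΩ).2 hG
  have hu' : MemLp (Ω.indicator u) 2 := (memLp_indicator_iff_restrict hΩ).2 hu
  have hlim := tendsto_integral_mul_dilation hu' hG' hc
  have e : ∀ v : E3 → E3, (∀ x ∈ Ω, v x ∈ Ω) →
      ∫ x, Ω.indicator G x * Ω.indicator u (v x) = ∫ x in Ω, G x * u (v x) := by
    intro v hv
    rw [← integral_indicator hΩ]
    refine integral_congr_ae (ae_of_all _ fun x => ?_)
    by_cases hx : x ∈ Ω
    · simp [hx, hv x hx]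
    · simp [hx]
  have e1 := fun n => (e (fun x => c n • x) (hcΩ n)).trans (h0 n)
  have e2 := e (fun x => x) fun x hx => hx
  simp only [e1, e2] at hlim
  exact tendsto_nhds_unique hlim tendsto_const_nhds

/-- Letting the dilation factor tend to `1` gives `∫ (Sc f)² = 0`. Continuity of the harmonic scalar
part upgrades vanishing almost everywhere to vanishing at each point. -/
theorem IsContragenic.re_eq_zero_of_interior (hf : IsContragenic interiorBall f) :
    ∀ x ∈ interiorBall, (f x).re = 0 := by
  have hlim : Tendsto (fun n : ℕ => (1 : ℝ) - 1 / ((n : ℝ) + 2)) atTop (𝓝 1) := by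
    have : Tendsto (fun n : ℕ => 1 / ((n : ℝ) + 2)) atTop (𝓝 0) := by
      simp_rw [one_div]
      exact tendsto_inv_atTop_zero.comp
        (tendsto_atTop_add_const_right _ 2 tendsto_natCast_atTop_atTop)
    simpa using this.const_sub 1
  have hc : ∀ n : ℕ, 0 < (1 : ℝ) - 1 / ((n : ℝ) + 2) ∧ (1 : ℝ) - 1 / ((n : ℝ) + 2) < 1 := by
    intro n
    have h1 : 0 < 1 / ((n : ℝ) + 2) := by positivity
    have h2 : 1 / ((n : ℝ) + 2) < 1 := by
      rw [div_lt_one (by positivity)]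
      linarith [(Nat.cast_nonneg n : (0 : ℝ) ≤ n)]
    constructor <;> linarith
  have h0 := integral_mul_eq_zero_of_dilation isOpen_interiorBall.measurableSet hf.memLp_re
    hf.memLp_re hlim (fun n x hx => by
      have hx : ‖x‖ < 1 := hx
      change ‖_‖ < 1
      rw [norm_smul, Real.norm_of_nonneg (hc n).1.le]
      nlinarith [norm_nonneg x, (hc n).1, (hc n).2])
    (fun n => hf.integral_re_mul_dilation_interior (hc n).1 (hc n).2)
  have hint : Integrable (fun x => (f x).re * (f x).re) (volume.restrict interiorBall) :=
    MemLp.integrable_mul (p := 2) (q := 2) hf.memLp_re hf.memLp_re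
  have hae := (integral_eq_zero_iff_of_nonneg (fun x => mul_self_nonneg _) hint).1 h0
  have hcont : ContinuousOn (fun x => (f x).re) interiorBall := fun x hx =>
    (hf.harmonic_re x hx).1.continuousAt.continuousWithinAt
  have hae' : (fun x => (f x).re) =ᵐ[volume.restrict interiorBall] fun _ => 0 :=
    hae.mono fun x hx => mul_self_eq_zero.1 hx
  exact Measure.eqOn_open_of_ae_eq hae' isOpen_interiorBall hcont continuousOn_const

end Interior

/-! ### The complexified kernel in the exterior and its mixed difference -/

section ExteriorKernel

variable {ζ : ℂ} {σ τ : ℝ} {x : E3}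

/-- From `Re(z ζ̄) ≤ |x||ζ|` the real part is at least `(|x| - σ|ζ|)(|x| - τ|ζ|)`. So for
independent `σ` and `τ` the complexified distance stays in the right half-plane, where the principal
branch is smooth, and is comparable to `|x|²`. -/
theorem re_cdist_ge (hζ : ‖ζ‖ < 1) (hσ : σ ∈ Set.Icc (0 : ℝ) 1) (hτ : τ ∈ Set.Icc (0 : ℝ) 1)
    (hx : x ∈ exteriorBall) :
    ((1 - ‖ζ‖) * ‖x‖) ^ 2 ≤ (cdist 0 (σ * conj ζ) (τ * ζ) 0 x).re := by
  have hx : 1 < ‖x‖ := hx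
  have hre : (cdist 0 (σ * conj ζ) (τ * ζ) 0 x).re =
      ‖x‖ ^ 2 - (σ + τ) * (zc x * conj ζ).re + σ * τ * ‖ζ‖ ^ 2 := by
    rw [norm_sq_eq_zc, Complex.sq_norm, Complex.sq_norm, Complex.normSq_apply,
      Complex.normSq_apply]
    simp [cdist, pow_two]
    ring
  have hp : (zc x * conj ζ).re ≤ ‖x‖ * ‖ζ‖ := by
    refine (Complex.re_le_norm _).trans ?_
    rw [norm_mul, Complex.norm_conj]
    gcongr
    exact norm_zc_le x
  have h1 : (‖x‖ - σ * ‖ζ‖) * (‖x‖ - τ * ‖ζ‖) ≤ (cdist 0 (σ * conj ζ) (τ * ζ) 0 x).re := by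
    rw [hre]
    nlinarith [mul_le_mul_of_nonneg_left hp (add_nonneg hσ.1 hτ.1)]
  refine le_trans ?_ h1
  have hz := norm_nonneg ζ
  have h2 : ∀ s ∈ Set.Icc (0 : ℝ) 1, (1 - ‖ζ‖) * ‖x‖ ≤ ‖x‖ - s * ‖ζ‖ := fun s hs => by
    nlinarith [hs.1, hs.2, mul_le_mul_of_nonneg_right hs.2 hz]
  have h3 : 0 ≤ (1 - ‖ζ‖) * ‖x‖ := by
    have : 0 < 1 - ‖ζ‖ := by linarith
    positivity
  rw [pow_two]
  exact mul_le_mul (h2 σ hσ) (h2 τ hτ) h3 (h3.trans (h2 σ hσ))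

theorem cdist_exterior_mem (hζ : ‖ζ‖ < 1) (hσ : σ ∈ Set.Icc (0 : ℝ) 1)
    (hτ : τ ∈ Set.Icc (0 : ℝ) 1) (hx : x ∈ exteriorBall) :
    cdist 0 (σ * conj ζ) (τ * ζ) 0 x ∈ Complex.slitPlane := by
  refine Complex.mem_slitPlane_iff.2 (Or.inl (lt_of_lt_of_le ?_ (re_cdist_ge hζ hσ hτ hx)))
  have hx : 1 < ‖x‖ := hx
  have : 0 < 1 - ‖ζ‖ := by linarith
  positivity

theorem norm_newton_exterior_le (hζ : ‖ζ‖ < 1) (hσ : σ ∈ Set.Icc (0 : ℝ) 1)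
    (hτ : τ ∈ Set.Icc (0 : ℝ) 1) (hx : x ∈ exteriorBall) :
    ‖newton 0 (σ * conj ζ) (τ * ζ) 0 x‖ ≤ (1 - ‖ζ‖)⁻¹ * ‖x‖⁻¹ := by
  have hx1 : 1 < ‖x‖ := hx
  have h1 : 0 < 1 - ‖ζ‖ := by linarith
  rw [newton, norm_invSqrt (Complex.slitPlane_ne_zero (cdist_exterior_mem hζ hσ hτ hx)), ← mul_inv]
  refine inv_anti₀ (by positivity) (Real.le_sqrt_of_sq_le ?_)
  exact (re_cdist_ge hζ hσ hτ hx).trans (Complex.re_le_norm _)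

theorem norm_cdistGrad_exterior_le (hζ : ‖ζ‖ < 1) (hσ : σ ∈ Set.Icc (0 : ℝ) 1)
    (hτ : τ ∈ Set.Icc (0 : ℝ) 1) (hx : x ∈ exteriorBall) (i : Fin 3) :
    ‖cdistGrad 0 (σ * conj ζ) (τ * ζ) i x‖ ≤ 4 * ‖x‖ := by
  have hx1 : 1 < ‖x‖ := hx
  have hs : ∀ s ∈ Set.Icc (0 : ℝ) 1, ‖(s : ℂ) * ζ‖ ≤ ‖x‖ := fun s hs => by
    rw [norm_mul, Complex.norm_real, Real.norm_of_nonneg hs.1]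
    nlinarith [hs.1, hs.2, norm_nonneg ζ, mul_le_mul_of_nonneg_right hs.2 (norm_nonneg ζ)]
  have ha : ‖zc x - τ * ζ‖ ≤ 2 * ‖x‖ :=
    (norm_sub_le _ _).trans (by linarith [hs τ hτ, norm_zc_le x])
  have hb : ‖conj (zc x) - σ * conj ζ‖ ≤ 2 * ‖x‖ := by
    have e : conj (zc x) - σ * conj ζ = conj (zc x - σ * ζ) := by simp
    rw [e, Complex.norm_conj]
    exact (norm_sub_le _ _).trans (by linarith [hs σ hσ, norm_zc_le x])
  fin_cases i
  · simp [cdistGrad]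
    linarith [abs_coord_le x 0]
  · exact (norm_add_le _ _).trans (by linarith)
  · refine (norm_sub_le _ _).trans ?_
    rw [norm_mul, norm_mul, Complex.norm_I]
    linarith

theorem inv_pow_three_le (hx : x ∈ exteriorBall) : (‖x‖⁻¹) ^ 3 ≤ (‖x‖ ^ 2)⁻¹ := by
  have hx1 : 1 < ‖x‖ := hx
  rw [inv_pow]
  exact inv_anti₀ (by positivity) (pow_le_pow_right₀ hx1.le (by norm_num))

/-- A square-integrable `G` in the exterior that is orthogonal to `∂h/∂x₀` for harmonic `h` with
square-integrable gradient. -/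
def OrthDeriv (G : E3 → ℂ) : Prop :=
  ∀ h : E3 → ℂ, ContDiffOn ℝ ∞ h exteriorBall → (∀ x ∈ exteriorBall, lap h x = 0) →
    (∀ i, MemLp (pd i h) 2 (volume.restrict exteriorBall)) →
    ∫ x in exteriorBall, G x * pd 0 h x = 0

variable {G : E3 → ℂ}

/-- The integrand is `G ∂₀²N`, obtained from the test function `h = ∂₀N`. One derivative is spent on
decay: the gradient of `∂₀N` is of order `|x|⁻³`. -/
theorem integral_mul_pd_pd_newton (hP : OrthDeriv G) (hζ : ‖ζ‖ < 1)
    (hσ : σ ∈ Set.Icc (0 : ℝ) 1) (hτ : τ ∈ Set.Icc (0 : ℝ) 1) :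
    ∫ x in exteriorBall, G x * (-newton 0 (σ * conj ζ) (τ * ζ) 0 x ^ 3 +
      3 * (x 0 : ℂ) ^ 2 * newton 0 (σ * conj ζ) (τ * ζ) 0 x ^ 5) = 0 := by
  have hmem := fun x (hx : x ∈ exteriorBall) => cdist_exterior_mem hζ hσ hτ hx
  have hsm : ∀ x ∈ exteriorBall, ContDiffAt ℝ ∞ (pd 0 (newton 0 (σ * conj ζ) (τ * ζ) 0)) x :=
    fun x hx => contDiffAt_pd (contDiffAt_newton (hmem x hx) (n := ∞)) (by simp) 0
  have h := hP (pd 0 (newton 0 (σ * conj ζ) (τ * ζ) 0)) (fun x hx => (hsm x hx).contDiffWithinAt)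
    (fun x hx => lap_pd_newton (hmem x hx)) fun i => by
      set m := (1 - ‖ζ‖)⁻¹ with hm
      have hm0 : 0 ≤ m := inv_nonneg.2 (by linarith)
      refine memLp_exterior_of_bound (C := m ^ 3 + 6 * m ^ 5) (fun x hx => ?_) fun x hx => ?_
      · exact (contDiffAt_pd (hsm x hx) (m := ∞) (by simp) i).continuousAt.continuousWithinAt
      · rw [(hasPD_pd_newton (hmem x hx)).2 i]
        have hN := norm_newton_exterior_le hζ hσ hτ hx
        have hg := norm_cdistGrad_exterior_le hζ hσ hτ hx i
        have hx1 : 1 < ‖x‖ := hx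
        have hx0 : 0 < ‖x‖ := by linarith
        set N := newton 0 (σ * conj ζ) (τ * ζ) 0 x
        have h1 : ‖-(if i = 0 then (1 : ℂ) else 0) * N ^ 3‖ ≤ (m * ‖x‖⁻¹) ^ 3 := by
          rw [norm_mul, norm_pow, norm_neg]
          refine (mul_le_of_le_one_left (by positivity) ?_).trans (by gcongr)
          split_ifs <;> simp
        have h2 : ‖3 / 2 * ((x 0 : ℂ) - 0) * N ^ 5 * cdistGrad 0 (σ * conj ζ) (τ * ζ) i x‖ ≤
            3 / 2 * ‖x‖ * (m * ‖x‖⁻¹) ^ 5 * (4 * ‖x‖) := by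
          rw [norm_mul, norm_mul, norm_mul, norm_pow, sub_zero, Complex.norm_real]
          gcongr
          · norm_num
          · exact abs_coord_le x 0
        refine (norm_add_le _ _).trans ((add_le_add h1 h2).trans ?_)
        have e : (m * ‖x‖⁻¹) ^ 3 + 3 / 2 * ‖x‖ * (m * ‖x‖⁻¹) ^ 5 * (4 * ‖x‖) =
            (m ^ 3 + 6 * m ^ 5) * (‖x‖⁻¹) ^ 3 := by
          field_simp; ring
        rw [e]
        gcongr
        exact inv_pow_three_le hx
  refine Eq.trans (setIntegral_congr_fun isOpen_exteriorBall.measurableSet fun x hx => ?_) h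
  refine congrArg (G x * ·) ?_
  rw [(hasPD_pd_newton (hmem x hx)).2 0]
  simp [cdistGrad]
  ring

theorem hasDerivAt_newton_s (t v : ℂ) (r : ℝ)
    (h : cdist 0 ((r : ℂ) * v) t 0 x ∈ Complex.slitPlane) :
    HasDerivAt (fun r : ℝ => newton 0 ((r : ℂ) * v) t 0 x)
      (1 / 2 * v * (zc x - t) * newton 0 ((r : ℂ) * v) t 0 x ^ 3) r := by
  have h1 : HasDerivAt (fun r : ℝ => (r : ℂ) * v) (1 * v) r :=
    ((hasDerivAt_id r).ofReal_comp).mul_const v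
  have h2 := (((h1.const_sub (conj (zc x))).const_mul (zc x - t)).const_add
    (((x 0 : ℂ) - 0) ^ 2)).add_const (0 : ℂ)
  refine ((hasDerivAt_invSqrt h).comp r h2).congr_deriv ?_
  rw [newton]; ring

theorem hasDerivAt_newton_t (s v : ℂ) (r : ℝ)
    (h : cdist 0 s ((r : ℂ) * v) 0 x ∈ Complex.slitPlane) :
    HasDerivAt (fun r : ℝ => newton 0 s ((r : ℂ) * v) 0 x)
      (1 / 2 * v * (conj (zc x) - s) * newton 0 s ((r : ℂ) * v) 0 x ^ 3) r := by
  have h1 : HasDerivAt (fun r : ℝ => (r : ℂ) * v) (1 * v) r :=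
    ((hasDerivAt_id r).ofReal_comp).mul_const v
  have h2 := (((h1.const_sub (zc x)).mul_const (conj (zc x) - s)).const_add
    (((x 0 : ℂ) - 0) ^ 2)).add_const (0 : ℂ)
  refine ((hasDerivAt_invSqrt h).comp r h2).congr_deriv ?_
  rw [newton]; ring

theorem continuousOn_newton {α : Type*} [TopologicalSpace α] {A : Set α} {s t : α → ℂ}
    {X : α → E3} (hs : Continuous s) (ht : Continuous t) (hX : Continuous X)
    (h : ∀ p ∈ A, cdist 0 (s p) (t p) 0 (X p) ∈ Complex.slitPlane) :
    ContinuousOn (fun p => newton 0 (s p) (t p) 0 (X p)) A := by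
  intro p hp
  refine ContinuousAt.continuousWithinAt ?_
  have hc : Continuous fun p => cdist 0 (s p) (t p) 0 (X p) := by
    simp only [cdist, zc]; fun_prop
  exact ContinuousAt.comp (f := fun p => cdist 0 (s p) (t p) 0 (X p))
    (hasDerivAt_invSqrt (h p hp)).continuousAt hc.continuousAt

theorem integrable_norm_mul_inv_sq (hG : MemLp G 2 (volume.restrict exteriorBall)) (C : ℝ) :
    Integrable (fun x => ‖G x‖ * (C * (‖x‖ ^ 2)⁻¹)) (volume.restrict exteriorBall) :=
  MemLp.integrable_mul (p := 2) (q := 2) hG.norm (memLp_norm_inv_sq.const_mul C)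

theorem continuous_zc : Continuous zc := (contDiff_zc (n := 0)).continuous

/-- The mixed second difference of the complexified kernel is orthogonal to `G`. -/
theorem orth_mixed_difference (hG : MemLp G 2 (volume.restrict exteriorBall)) (hP : OrthDeriv G)
    (hζ : ‖ζ‖ < 1) : Orth exteriorBall G fun x =>
      (newton 0 (conj ζ) ζ 0 x - newton 0 0 ζ 0 x) -
        (newton 0 (conj ζ) 0 0 x - newton 0 0 0 0 x) := by
  set m := (1 - ‖ζ‖)⁻¹ with hm
  have hm0 : 0 ≤ m := inv_nonneg.2 (by linarith)
  have h0I : (0 : ℝ) ∈ Set.Icc (0 : ℝ) 1 := by simp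
  have h1I : (1 : ℝ) ∈ Set.Icc (0 : ℝ) 1 := by simp
  have hmemC := fun σ τ (hσ : σ ∈ Set.Icc (0 : ℝ) 1) (hτ : τ ∈ Set.Icc (0 : ℝ) 1) x
    (hx : x ∈ exteriorBall) => cdist_exterior_mem hζ hσ hτ hx
  -- the inner integration, in `σ`
  have inner : ∀ τ ∈ Set.Icc (0 : ℝ) 1, Orth exteriorBall G fun x =>
      1 / 2 * ζ * (conj (zc x) - ((1 : ℝ) : ℂ) * conj ζ) *
        newton 0 (((1 : ℝ) : ℂ) * conj ζ) (τ * ζ) 0 x ^ 3 -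
      1 / 2 * ζ * (conj (zc x) - ((0 : ℝ) : ℂ) * conj ζ) *
        newton 0 (((0 : ℝ) : ℂ) * conj ζ) (τ * ζ) 0 x ^ 3 := by
    intro τ hτ
    refine orth_sub_of_hasDerivAt
      (Φ := fun x σ => 1 / 2 * ζ * (conj (zc x) - (σ : ℂ) * conj ζ) *
        newton 0 ((σ : ℂ) * conj ζ) (τ * ζ) 0 x ^ 3)
      -- Up to the factor `ζζ̄`, this is `∂ₛ∂ₜN = -¼ ∂₀²N`: the kernel depends on `z - t` and `z̄ -
      -- s`, and the Laplacian is `∂₀² + 4∂_z∂_z̄`.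
      (k := fun x σ => -(1 / 4) * ζ * conj ζ * (-newton 0 (σ * conj ζ) (τ * ζ) 0 x ^ 3 +
        3 * (x 0 : ℂ) ^ 2 * newton 0 (σ * conj ζ) (τ * ζ) 0 x ^ 5))
      (b := fun x => (m ^ 3 + 3 * m ^ 5) * (‖x‖ ^ 2)⁻¹)
      isOpen_exteriorBall.measurableSet hG.1 ?_ ?_ ?_ (integrable_norm_mul_inv_sq hG _) ?_
    · intro σ hσ x hx
      have hmem := hmemC σ τ hσ hτ x hx
      have h1 : HasDerivAt (fun r : ℝ => (r : ℂ) * conj ζ) (1 * conj ζ) σ :=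
        ((hasDerivAt_id σ).ofReal_comp).mul_const (conj ζ)
      have h2 := hasDerivAt_newton_s (τ * ζ) (conj ζ) σ hmem
      refine (((h1.const_sub (conj (zc x))).const_mul (1 / 2 * ζ)).mul (h2.pow 3)).congr_deriv ?_
      have hS := invSqrt_sq_mul (Complex.slitPlane_ne_zero hmem)
      change newton 0 (σ * conj ζ) (τ * ζ) 0 x ^ 2 * _ = 1 at hS
      simp only [cdist] at hS
      simp only [Pi.pow_apply]
      set N := newton 0 (σ * conj ζ) (τ * ζ) 0 x
      push_cast
      linear_combination (3 / 4 * ζ * conj ζ * N ^ 3) * hS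
    · have hN := continuousOn_newton (A := exteriorBall ×ˢ Set.Icc (0 : ℝ) 1)
        (s := fun p : E3 × ℝ => (p.2 : ℂ) * conj ζ) (t := fun _ => τ * ζ) (X := Prod.fst)
        (by fun_prop) (by fun_prop) (by fun_prop) fun p hp => hmemC _ _ hp.2 hτ _ hp.1
      have hx0 : ContinuousOn (fun p : E3 × ℝ => 3 * (p.1 0 : ℂ) ^ 2)
        (exteriorBall ×ˢ Set.Icc (0 : ℝ) 1) := by fun_prop
      exact continuousOn_const.mul ((hN.pow 3).neg.add (hx0.mul (hN.pow 5)))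
    · intro σ hσ x hx
      have hN := norm_newton_exterior_le hζ hσ hτ hx
      have hx1 : 1 < ‖x‖ := hx
      have hx0 : 0 < ‖x‖ := by linarith
      set N := newton 0 (σ * conj ζ) (τ * ζ) 0 x
      have h1 : ‖-(1 / 4) * ζ * conj ζ‖ ≤ 1 := by
        rw [norm_mul, norm_mul, Complex.norm_conj]
        have : ‖(-(1 / 4) : ℂ)‖ = 1 / 4 := by norm_num
        rw [this]
        nlinarith [norm_nonneg ζ]
      have h2 : ‖-N ^ 3 + 3 * (x 0 : ℂ) ^ 2 * N ^ 5‖ ≤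
          (m * ‖x‖⁻¹) ^ 3 + 3 * ‖x‖ ^ 2 * (m * ‖x‖⁻¹) ^ 5 := by
        refine (norm_add_le _ _).trans (add_le_add ?_ ?_)
        · rw [norm_neg, norm_pow]; gcongr
        · rw [norm_mul, norm_mul, norm_pow, norm_pow, Complex.norm_real]
          gcongr
          · simp
          · exact abs_coord_le x 0
      rw [norm_mul]
      refine (mul_le_of_le_one_left (norm_nonneg _) h1).trans (h2.trans ?_)
      have e : (m * ‖x‖⁻¹) ^ 3 + 3 * ‖x‖ ^ 2 * (m * ‖x‖⁻¹) ^ 5 =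
          (m ^ 3 + 3 * m ^ 5) * (‖x‖⁻¹) ^ 3 := by
        field_simp
      rw [e]
      gcongr
      exact inv_pow_three_le hx
    · intro σ hσ
      have h := integral_mul_pd_pd_newton hP hζ hσ hτ
      have e : ∀ x, G x * (-(1 / 4) * ζ * conj ζ * (-newton 0 (σ * conj ζ) (τ * ζ) 0 x ^ 3 +
          3 * (x 0 : ℂ) ^ 2 * newton 0 (σ * conj ζ) (τ * ζ) 0 x ^ 5)) =
          (-(1 / 4) * ζ * conj ζ) * (G x * (-newton 0 (σ * conj ζ) (τ * ζ) 0 x ^ 3 +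
          3 * (x 0 : ℂ) ^ 2 * newton 0 (σ * conj ζ) (τ * ζ) 0 x ^ 5)) := fun x => by ring
      simp_rw [e]
      rw [integral_const_mul, h, mul_zero]
  -- Integration in `τ`: the derivative of the difference of the kernels at `σ = 1` and `σ = 0` is
  -- the function just shown to be orthogonal to `G`.
  have outer := orth_sub_of_hasDerivAt (Ω := exteriorBall) (G := G)
    (Φ := fun x τ => newton 0 (((1 : ℝ) : ℂ) * conj ζ) ((τ : ℂ) * ζ) 0 x -
      newton 0 (((0 : ℝ) : ℂ) * conj ζ) ((τ : ℂ) * ζ) 0 x)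
    (k := fun x τ => 1 / 2 * ζ * (conj (zc x) - ((1 : ℝ) : ℂ) * conj ζ) *
        newton 0 (((1 : ℝ) : ℂ) * conj ζ) (τ * ζ) 0 x ^ 3 -
      1 / 2 * ζ * (conj (zc x) - ((0 : ℝ) : ℂ) * conj ζ) *
        newton 0 (((0 : ℝ) : ℂ) * conj ζ) (τ * ζ) 0 x ^ 3)
    (b := fun x => (2 * m ^ 3) * (‖x‖ ^ 2)⁻¹)
    isOpen_exteriorBall.measurableSet hG.1
    (fun τ hτ x hx => (hasDerivAt_newton_t _ _ _ (hmemC 1 τ h1I hτ x hx)).sub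
      (hasDerivAt_newton_t _ _ _ (hmemC 0 τ h0I hτ x hx))) ?_ ?_
    (integrable_norm_mul_inv_sq hG _) (fun τ hτ => (inner τ hτ).2)
  · refine outer.congr isOpen_exteriorBall.measurableSet fun x _ => ?_
    simp
  · have hN := fun (s : ℝ) (hs : s ∈ Set.Icc (0 : ℝ) 1) =>
      continuousOn_newton (A := exteriorBall ×ˢ Set.Icc (0 : ℝ) 1)
        (s := fun _ : E3 × ℝ => (s : ℂ) * conj ζ) (t := fun p => (p.2 : ℂ) * ζ) (X := Prod.fst)
        (by fun_prop) (by fun_prop) (by fun_prop) fun p hp => hmemC _ _ hs hp.2 _ hp.1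
    have hz := fun s : ℝ => (((Complex.continuous_conj.comp (continuous_zc.comp
      continuous_fst)).sub continuous_const).const_mul (1 / 2 * ζ) : Continuous fun p : E3 × ℝ =>
        1 / 2 * ζ * (conj (zc p.1) - (s : ℂ) * conj ζ)).continuousOn
          (s := exteriorBall ×ˢ Set.Icc (0 : ℝ) 1)
    exact ((hz 1).mul ((hN 1 h1I).pow 3)).sub ((hz 0).mul ((hN 0 h0I).pow 3))
  · intro τ hτ x hx
    have hx1 : 1 < ‖x‖ := hx
    have hx0 : 0 < ‖x‖ := by linarith
    have hone : ∀ s ∈ Set.Icc (0 : ℝ) 1, ‖1 / 2 * ζ * (conj (zc x) - (s : ℂ) * conj ζ) *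
        newton 0 ((s : ℂ) * conj ζ) (τ * ζ) 0 x ^ 3‖ ≤ m ^ 3 * (‖x‖ ^ 2)⁻¹ := by
      intro s hs
      have hN := norm_newton_exterior_le hζ hs hτ hx
      have h1 : ‖conj (zc x) - (s : ℂ) * conj ζ‖ ≤ 2 * ‖x‖ := by
        refine (norm_sub_le _ _).trans ?_
        rw [norm_mul, Complex.norm_conj, Complex.norm_conj, Complex.norm_real,
          Real.norm_of_nonneg hs.1]
        nlinarith [norm_zc_le x, hs.1, hs.2, norm_nonneg ζ,
          mul_le_mul_of_nonneg_right hs.2 (norm_nonneg ζ)]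
      have h2 : ‖1 / 2 * ζ‖ ≤ 1 / 2 := by
        rw [norm_mul]
        norm_num
        linarith
      rw [norm_mul, norm_mul, norm_pow]
      calc _ ≤ 1 / 2 * (2 * ‖x‖) * (m * ‖x‖⁻¹) ^ 3 := by gcongr
        _ = m ^ 3 * (‖x‖ ^ 2)⁻¹ := by field_simp
    refine (norm_sub_le _ _).trans ?_
    linarith [hone 1 h1I, hone 0 h0I]

end ExteriorKernel


/-! ### Binomial expansion of the kernel in sectorial harmonics -/

section Series

theorem invSqrt_ofReal_mul {q : ℝ} (hq : 0 < q) {v : ℂ} (hv : v ≠ 0) :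
    invSqrt (q * v) = invSqrt q * invSqrt v := by
  have hq' : (q : ℂ) ≠ 0 := by exact_mod_cast hq.ne'
  rw [invSqrt, invSqrt, invSqrt, Complex.cpow_def_of_ne_zero (mul_ne_zero hq' hv),
    Complex.cpow_def_of_ne_zero hq', Complex.cpow_def_of_ne_zero hv, Complex.log_ofReal_mul hq hv,
    ← Complex.exp_add, Complex.ofReal_log hq.le]
  ring_nf

theorem one_sub_mem_slitPlane {w : ℂ} (hw : ‖w‖ < 1) : 1 - w ∈ Complex.slitPlane := by
  refine Complex.mem_slitPlane_iff.2 (Or.inl ?_)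
  simp only [Complex.sub_re, Complex.one_re]
  linarith [Complex.re_le_norm w]

theorem exists_hasSum_invSqrt :
    ∃ b : ℕ → ℂ, ∀ w : ℂ, ‖w‖ < 1 → HasSum (fun k => b k * w ^ k) (invSqrt (1 - w)) := by
  have hd : DifferentiableOn ℂ (fun w => invSqrt (1 - w)) (Metric.ball 0 1) := fun w hw => by
    have hw : ‖w‖ < 1 := by simpa using hw
    exact ((hasDerivAt_invSqrt (one_sub_mem_slitPlane hw)).comp w
      ((hasDerivAt_id w).const_sub 1)).differentiableAt.differentiableWithinAt
  refine ⟨fun k => ((k.factorial : ℂ))⁻¹ * iteratedDeriv k (fun w => invSqrt (1 - w)) 0,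
    fun w hw => ?_⟩
  have h := Complex.hasSum_taylorSeries_on_ball hd (z := w) (by simpa using hw)
  refine h.congr_fun fun k => ?_
  simp only [sub_zero, smul_eq_mul]
  ring

/-- Termwise integration: absolute summability of the coefficients and one bound `b` for all terms
dominate the series. -/
theorem orth_of_hasSum {Ω : Set E3} (hΩ : MeasurableSet Ω) {G v : E3 → ℂ} {S : ℕ → E3 → ℂ}
    {a : ℕ → ℂ} {b : E3 → ℝ} (hG : AEStronglyMeasurable G (volume.restrict Ω))
    (hGb : Integrable (fun x => ‖G x‖ * b x) (volume.restrict Ω))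
    (ha : Summable fun k => ‖a k‖) (hS : ∀ k, ContinuousOn (S k) Ω)
    (hSb : ∀ k, ∀ x ∈ Ω, ‖S k x‖ ≤ b x) (h0 : ∀ k, ∫ x in Ω, G x * S k x = 0)
    (hv : ContinuousOn v Ω) (hs : ∀ x ∈ Ω, HasSum (fun k => a k * S k x) (v x)) :
    Orth Ω G v := by
  have hle : ∀ k, ∀ x ∈ Ω, ‖G x * (a k * S k x)‖ ≤ ‖a k‖ * (‖G x‖ * b x) := fun k x hx => by
    rw [norm_mul, norm_mul]
    calc ‖G x‖ * (‖a k‖ * ‖S k x‖) ≤ ‖G x‖ * (‖a k‖ * b x) := by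
          gcongr; exact hSb k x hx
      _ = _ := by ring
  have hbi : Integrable (fun x => ∑' k, ‖a k‖ * (‖G x‖ * b x)) (volume.restrict Ω) := by
    simp_rw [tsum_mul_right]
    exact hGb.const_mul _
  have hs' : ∀ x ∈ Ω, HasSum (fun k => G x * (a k * S k x)) (G x * v x) := fun x hx =>
    (hs x hx).mul_left _
  have key := hasSum_integral_of_dominated_convergence (μ := volume.restrict Ω)
    (F := fun k x => G x * (a k * S k x)) (f := fun x => G x * v x)
    (fun k x => ‖a k‖ * (‖G x‖ * b x))
    (fun k => hG.mul (((hS k).aestronglyMeasurable hΩ).const_mul _))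
    (fun k => (ae_restrict_mem hΩ).mono fun x hx => hle k x hx)
    (ae_of_all _ fun x => ha.mul_right _) hbi ((ae_restrict_mem hΩ).mono hs')
  refine ⟨hbi.mono' (hG.mul (hv.aestronglyMeasurable hΩ))
    ((ae_restrict_mem hΩ).mono fun x hx => ?_), ?_⟩
  · rw [← (hs' x hx).tsum_eq]
    exact tsum_of_norm_bounded (ha.mul_right _).hasSum fun k => hle k x hx
  · have e : ∀ k, ∫ x in Ω, G x * (a k * S k x) = 0 := fun k => by
      have e1 : ∀ x, G x * (a k * S k x) = a k * (G x * S k x) := fun x => by ring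
      simp_rw [e1]
      rw [integral_const_mul, h0 k, mul_zero]
    simp only [e] at key
    exact key.unique hasSum_zero

variable {G : E3 → ℂ} {ζ : ℂ}

/-- A kernel that differs from `1 / |x|` by a series in the harmonics `S k` is orthogonal to `G` up
to `1 / |x|`. -/
theorem orth_newton_series (hG : MemLp G 2 (volume.restrict exteriorBall)) (hζ : ‖ζ‖ < 1)
    {Z : E3 → ℂ} (hZ : Continuous Z) (hZx : ∀ x, ‖Z x‖ ≤ ‖x‖)
    (h0 : ∀ k, ∫ x in exteriorBall,
      G x * (Z x ^ (k + 1) * (((‖x‖ ^ (2 * (k + 1) + 1))⁻¹ : ℝ) : ℂ)) = 0) :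
    Orth exteriorBall G fun x =>
      invSqrt ((‖x‖ ^ 2 : ℝ) - ζ * Z x) - invSqrt ((‖x‖ ^ 2 : ℝ) : ℂ) := by
  obtain ⟨b, hb⟩ := exists_hasSum_invSqrt
  have hw : ∀ x ∈ exteriorBall, ‖ζ * Z x / ((‖x‖ ^ 2 : ℝ) : ℂ)‖ < 1 := fun x hx => by
    have hx : 1 < ‖x‖ := hx
    rw [norm_div, norm_mul, Complex.norm_real, Real.norm_of_nonneg (by positivity),
      div_lt_one (by positivity)]
    nlinarith [hZx x, norm_nonneg ζ, norm_nonneg (Z x)]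
  have hq : ∀ x ∈ exteriorBall, 0 < ‖x‖ ^ 2 := fun x hx => by
    have hx : 1 < ‖x‖ := hx
    positivity
  have hfac : ∀ x ∈ exteriorBall, ((‖x‖ ^ 2 : ℝ) : ℂ) - ζ * Z x =
      ((‖x‖ ^ 2 : ℝ) : ℂ) * (1 - ζ * Z x / ((‖x‖ ^ 2 : ℝ) : ℂ)) := fun x hx => by
    have : ((‖x‖ ^ 2 : ℝ) : ℂ) ≠ 0 := by exact_mod_cast (hq x hx).ne'
    field_simp
  have hr : ∀ x ∈ exteriorBall, 0 < (((‖x‖ ^ 2 : ℝ) : ℂ) - ζ * Z x).re := fun x hx => by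
    have hx : 1 < ‖x‖ := hx
    have h1 := Complex.re_le_norm (ζ * Z x)
    rw [norm_mul] at h1
    rw [Complex.sub_re, Complex.ofReal_re]
    nlinarith [hZx x, norm_nonneg ζ, norm_nonneg (Z x)]
  refine orth_of_hasSum (S := fun k x => Z x ^ (k + 1) * (((‖x‖ ^ (2 * (k + 1) + 1))⁻¹ : ℝ) : ℂ))
    (a := fun k => b (k + 1) * ζ ^ (k + 1)) (b := fun x => 1 * (‖x‖ ^ 2)⁻¹)
    isOpen_exteriorBall.measurableSet hG.1 (integrable_norm_mul_inv_sq hG 1) ?_ ?_ ?_ h0 ?_ ?_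
  · exact (summable_nat_add_iff 1).2 (hb ζ hζ).summable.norm
  · intro k
    refine (hZ.pow (k + 1)).continuousOn.mul ?_
    refine Complex.continuous_ofReal.comp_continuousOn ?_
    refine ContinuousOn.inv₀ (by fun_prop) fun x hx => ?_
    exact pow_ne_zero _ (norm_ne_zero_iff.2 (ne_zero_of_mem_exteriorBall hx))
  · intro k x hx
    have hx : 1 < ‖x‖ := hx
    rw [norm_mul, norm_pow, Complex.norm_real, Real.norm_of_nonneg (by positivity), one_mul]
    calc ‖Z x‖ ^ (k + 1) * (‖x‖ ^ (2 * (k + 1) + 1))⁻¹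
        ≤ ‖x‖ ^ (k + 1) * (‖x‖ ^ (2 * (k + 1) + 1))⁻¹ := by gcongr; exact hZx x
      _ = (‖x‖ ^ (k + 2))⁻¹ := by field_simp; ring
      _ ≤ (‖x‖ ^ 2)⁻¹ := by
        gcongr
        · exact hx.le
        · omega
  · intro x hx
    refine ContinuousAt.continuousWithinAt (ContinuousAt.sub ?_ ?_)
    · exact ContinuousAt.comp (f := fun x : E3 => ((‖x‖ ^ 2 : ℝ) : ℂ) - ζ * Z x)
        (hasDerivAt_invSqrt (Complex.mem_slitPlane_iff.2 (Or.inl (hr x hx)))).continuousAt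
        (by fun_prop)
    · exact ContinuousAt.comp (f := fun x : E3 => ((‖x‖ ^ 2 : ℝ) : ℂ))
        (hasDerivAt_invSqrt (Complex.ofReal_mem_slitPlane.2 (hq x hx))).continuousAt
        (by fun_prop)
  · intro x hx
    have hx1 : 1 < ‖x‖ := hx
    have hx0 : (‖x‖ : ℂ) ≠ 0 := by exact_mod_cast (by linarith : ‖x‖ ≠ 0)
    have h1 := (hb _ (hw x hx)).mul_left (invSqrt ((‖x‖ ^ 2 : ℝ) : ℂ))
    rw [← invSqrt_ofReal_mul (hq x hx) (Complex.slitPlane_ne_zero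
      (one_sub_mem_slitPlane (hw x hx))), ← hfac x hx] at h1
    -- The zeroth term of the expansion is `1/|x|`. It is not square integrable, so it is split off
    -- and cancelled by the subtracted kernel.
    have hb0 : b 0 = 1 := by
      have := hb 0 (by simp)
      have h2 := hasSum_single (f := fun k => b k * (0 : ℂ) ^ k) 0 fun k hk => by simp [hk]
      have := this.unique h2
      simpa [invSqrt] using this.symm
    have h2 := (hasSum_nat_add_iff' 1).2 h1
    simp only [Finset.sum_range_one, pow_zero, mul_one, hb0] at h2
    refine h2.congr_fun fun k => ?_
    rw [div_pow, mul_pow, invSqrt_ofReal (hq x hx), Real.sqrt_sq (norm_nonneg x)]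
    push_cast
    field_simp
    ring

end Series

/-! ### Newtonian kernels with poles in the unit ball -/

section ExteriorPoles

variable {G : E3 → ℂ}

theorem norm_sub_ge_of_mem_exteriorBall {x y : E3} (hx : x ∈ exteriorBall) {ρ : ℝ}
    (hy : ‖y‖ ≤ ρ) : (1 - ρ) * ‖x‖ ≤ ‖x - y‖ := by
  have hx : 1 < ‖x‖ := hx
  have := norm_sub_norm_le x y
  nlinarith [norm_nonneg y]

theorem ne_of_mem_exteriorBall {x y : E3} (hx : x ∈ exteriorBall) (hy : ‖y‖ < 1) : x ≠ y := by
  rintro rfl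
  have hx : 1 < ‖x‖ := hx
  linarith

theorem norm_pd_pole_exterior_le {x y : E3} (hx : x ∈ exteriorBall) {ρ : ℝ} (hρ : ρ < 1)
    (hy : ‖y‖ ≤ ρ) (i : Fin 3) :
    ‖pd i (pole y 0) x‖ ≤ ((1 - ρ) ^ 2)⁻¹ * (‖x‖ ^ 2)⁻¹ := by
  have hx1 : 1 < ‖x‖ := hx
  have h1 : 0 < 1 - ρ := by linarith
  refine (norm_pd_pole_zero_le (ne_of_mem_exteriorBall hx (hy.trans_lt hρ)) i).trans ?_
  rw [← mul_inv, ← mul_pow]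
  have := norm_sub_ge_of_mem_exteriorBall hx hy
  gcongr

/-- Subtracting the kernel with pole `0` gains a power of decay: the distances `|x|` and `|x-y|`
differ by at most `|y| < 1`, so the difference is `O(|x|⁻²)` and thus square integrable. -/
theorem norm_pole_sub_pole_exterior_le {x y : E3} (hx : x ∈ exteriorBall) {ρ : ℝ} (hρ : ρ < 1)
    (hy : ‖y‖ ≤ ρ) : ‖pole y 0 x - pole 0 0 x‖ ≤ (1 - ρ)⁻¹ * (‖x‖ ^ 2)⁻¹ := by
  have hx1 : 1 < ‖x‖ := hx
  have h1 : 0 < 1 - ρ := by linarith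
  have h2 := norm_sub_ge_of_mem_exteriorBall hx hy
  have h3 : 0 < ‖x - y‖ := lt_of_lt_of_le (by positivity) h2
  rw [pole_zero_eq (ne_of_mem_exteriorBall hx (hy.trans_lt hρ)),
    pole_zero_eq (ne_zero_of_mem_exteriorBall hx), sub_zero, ← Complex.ofReal_sub,
    Complex.norm_real, inv_sub_inv h3.ne' (by linarith), norm_div, Real.norm_eq_abs,
    Real.norm_of_nonneg (by positivity), ← mul_inv, ← one_div]
  have h4 : |‖x‖ - ‖x - y‖| ≤ 1 := by
    refine (abs_norm_sub_norm_le _ _).trans ?_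
    rw [sub_sub_cancel]
    linarith
  refine div_le_div₀ zero_le_one h4 (by positivity) ?_
  nlinarith

theorem continuousOn_pole_zero {y : E3} (hy : ‖y‖ < 1) : ContinuousOn (pole y 0) exteriorBall :=
  fun _ hx => (contDiffAt_pole_zero (ne_of_mem_exteriorBall hx hy)
    (n := 0)).continuousAt.continuousWithinAt

/-- A square-integrable `G` in the exterior that is orthogonal to the sectorial harmonics. -/
def OrthSect (G : E3 → ℂ) : Prop :=
  ∀ k, (∫ x in exteriorBall, G x * sect (k + 1) x = 0) ∧
    ∫ x in exteriorBall, G x * conj (sect (k + 1) x) = 0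

theorem newton_zero_zero_eq_pole : newton 0 0 0 0 = pole 0 0 := by
  simp [pole, zc]

/-- With one of the two parameters zero, the distance is `|x|²` minus a multiple of `z` or of `z̄`
alone, so only powers of that variable occur in the expansion. -/
theorem orth_newton_axis (hG : MemLp G 2 (volume.restrict exteriorBall)) (hS : OrthSect G)
    {ζ : ℂ} (hζ : ‖ζ‖ < 1) :
    Orth exteriorBall G (fun x => newton 0 (conj ζ) 0 0 x - newton 0 0 0 0 x) ∧
    Orth exteriorBall G (fun x => newton 0 0 ζ 0 x - newton 0 0 0 0 x) := by
  have hsq : ∀ x : E3, ((‖x‖ ^ 2 : ℝ) : ℂ) = (x 0 : ℂ) ^ 2 + zc x * conj (zc x) := fun x => by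
    rw [norm_sq_eq_zc, Complex.mul_conj, Complex.normSq_eq_norm_sq]; push_cast; rfl
  constructor
  · refine (orth_newton_series hG (ζ := conj ζ) (Z := zc) (by simpa using hζ) continuous_zc
      norm_zc_le fun k => (hS k).1).congr isOpen_exteriorBall.measurableSet fun x _ => ?_
    rw [hsq, newton, newton, cdist, cdist]
    ring_nf
  · refine (orth_newton_series hG (ζ := ζ) (Z := fun x => conj (zc x)) hζ
      (Complex.continuous_conj.comp continuous_zc) (fun x => by simpa using norm_zc_le x)
      fun k => ?_).congr isOpen_exteriorBall.measurableSet fun x _ => ?_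
    · simpa [sect] using (hS k).2
    · rw [hsq, newton, newton, cdist, cdist]
      ring_nf

theorem integral_mul_pd_pole_exterior (hP : OrthDeriv G) {y : E3} (hy : ‖y‖ < 1) :
    ∫ x in exteriorBall, G x * pd 0 (pole y 0) x = 0 := by
  refine hP _ (fun x hx => (contDiffAt_pole_zero (ne_of_mem_exteriorBall hx hy)).contDiffWithinAt)
    (fun x hx => lap_pole_zero (ne_of_mem_exteriorBall hx hy)) fun i => ?_
  refine memLp_exterior_of_bound (C := ((1 - ‖y‖) ^ 2)⁻¹) (fun x hx => ?_) fun x hx =>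
    norm_pd_pole_exterior_le hx hy le_rfl i
  exact (contDiffAt_pd (contDiffAt_pole_zero (ne_of_mem_exteriorBall hx hy) (n := 1)) (m := 0)
    (by norm_num) i).continuousAt.continuousWithinAt

/-- The pole is first moved to the plane `y₀ = 0`. There the kernel splits into the mixed
difference, handled by `∂₀²N`, and two one-parameter kernels, handled by the sectorial harmonics. -/
theorem orth_pole_exterior (hG : MemLp G 2 (volume.restrict exteriorBall)) (hP : OrthDeriv G)
    (hS : OrthSect G) {y : E3} (hy : ‖y‖ < 1) :
    Orth exteriorBall G fun x => pole y 0 x - pole 0 0 x := by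
  -- Shrinking `|y₀|` to zero keeps the pole in the ball of radius `|y|`.
  have hle : ∀ t ∈ Set.Icc (0 : ℝ) 1,
      ‖y + (t * -(y 0)) • (EuclideanSpace.single 0 1 : E3)‖ ≤ ‖y‖ := fun t ht => by
    refine le_of_sq_le_sq ?_ (norm_nonneg _)
    rw [norm_sq_eq, norm_sq_eq]
    simp
    nlinarith [ht.1, ht.2, mul_nonneg ht.1 (sub_nonneg.2 ht.2), sq_nonneg (y 0),
      mul_nonneg ht.1 (sq_nonneg (y 0)),
      mul_nonneg (mul_nonneg ht.1 (sub_nonneg.2 ht.2)) (sq_nonneg (y 0))]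
  have h1 := orth_pole_sub (y := y) (T := -(y 0)) (b := fun x => ((1 - ‖y‖) ^ 2)⁻¹ * (‖x‖ ^ 2)⁻¹)
    isOpen_exteriorBall.measurableSet hG.1
    (fun t ht x hx => ne_of_mem_exteriorBall hx ((hle t ht).trans_lt hy))
    (fun t ht x hx => norm_pd_pole_exterior_le hx hy (hle t ht) 0)
    (integrable_norm_mul_inv_sq hG _)
    (fun t ht => integral_mul_pd_pole_exterior hP ((hle t ht).trans_lt hy))
  have hζ : ‖zc y‖ < 1 := (norm_zc_le y).trans_lt hy
  have e : pole (y + (-(y 0)) • EuclideanSpace.single 0 1) 0 = newton 0 (conj (zc y)) (zc y) 0 := by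
    have e0 : (y + (-(y 0)) • (EuclideanSpace.single 0 1 : E3)) 0 = 0 := by simp
    have e1 : zc (y + (-(y 0)) • (EuclideanSpace.single 0 1 : E3)) = zc y := by simp [zc]
    rw [pole, e0, e1, Complex.ofReal_zero]
  obtain ⟨h2, h3⟩ := orth_newton_axis hG hS hζ
  -- With `Nᵢⱼ` the kernel at `s = iζ̄`, `t = jζ`, the first three terms add up to `N₁₁ - N₀₀`, and
  -- the last exchanges `N₁₁` for the kernel with pole `y`.
  refine (((orth_mixed_difference hG hP hζ).add h2).add (h3.add h1.neg)).congr
    isOpen_exteriorBall.measurableSet fun x _ => ?_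
  rw [e, newton_zero_zero_eq_pole]
  ring

end ExteriorPoles

/-! ### Pairing with a contragenic scalar part in the exterior -/

section ExteriorPairing

variable {f : E3 → ℍ[ℝ]}

theorem smul_mem_exteriorBall {c : ℝ} (hc : 1 < c) {x : E3} (hx : x ∈ exteriorBall) :
    c • x ∈ exteriorBall := by
  have hx : 1 < ‖x‖ := hx
  change 1 < ‖c • x‖
  rw [norm_smul, Real.norm_of_nonneg (by linarith)]
  nlinarith

theorem memLp_dilation_exterior {F : Type*} [NormedAddCommGroup F] {u : E3 → F}
    (hu : MemLp u 2 (volume.restrict exteriorBall)) {c : ℝ} (hc : 1 < c) :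
    MemLp (fun x => u (c • x)) 2 (volume.restrict exteriorBall) := by
  have hc0 : c ≠ 0 := by linarith
  have hm := Measure.map_addHaar_smul (volume : Measure E3) hc0
  have hu' : MemLp (exteriorBall.indicator u) 2 :=
    (memLp_indicator_iff_restrict isOpen_exteriorBall.measurableSet).2 hu
  have h1 : MemLp (exteriorBall.indicator u) 2 (Measure.map (fun x : E3 => c • x) volume) := by
    rw [hm]
    exact hu'.smul_measure ENNReal.ofReal_ne_top
  have h2 := ((memLp_map_measure_iff h1.1 (measurable_const_smul c).aemeasurable).1 h1).restrict
    exteriorBall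
  refine h2.ae_eq ((ae_restrict_mem isOpen_exteriorBall.measurableSet).mono fun x hx => ?_)
  simp [smul_mem_exteriorBall hc hx]

/-- For `c > 1` the dilation is harmonic down to radius `1/c`, so it is represented in the exterior
by poles in a shell inside the unit ball, each kernel being normalized by `1/|x|`. -/
theorem IsContragenic.integral_mul_dilation_exterior (hf : IsContragenic exteriorBall f)
    {g : E3 → ℝ} (hg : MemLp g 2 (volume.restrict exteriorBall))
    (hP : OrthDeriv fun x => (g x : ℂ)) (hS : OrthSect fun x => (g x : ℂ)) {c : ℝ} (hc : 1 < c) :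
    ∫ x in exteriorBall, g x * (f (c • x)).re = 0 := by
  have hG : MemLp (fun x => (g x : ℂ)) 2 (volume.restrict exteriorBall) := hg.ofReal
  have hc0 : 0 < c := by linarith
  have hcc : 0 < 1 - (c ^ 2)⁻¹ := by
    have : (c ^ 2)⁻¹ < 1 := inv_lt_one_of_one_lt₀ (by nlinarith)
    linarith
  set d : ℝ := 1 - (c ^ 2)⁻¹ with hd
  -- The negative sign puts the shell inside the ball. Its inner edge `|y|² = 1 - d/2` exceeds `c⁻²
  -- = 1 - d`, and its outer radius is the `ρ < 1` defined below.
  set σ : ℝ := -(4 / d) with hσ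
  have hσ0 : 0 < 4 / d := by positivity
  have hmem : ∀ y : E3, σ * (‖y‖ ^ 2 - 1) ≤ 2 → c • y ∈ exteriorBall := by
    intro y hy
    change 1 < ‖c • y‖
    rw [norm_smul, Real.norm_of_nonneg hc0.le]
    have hy' : 4 * (1 - ‖y‖ ^ 2) ≤ 2 * d := by
      rw [← div_le_iff₀ hcc]
      calc _ = σ * (‖y‖ ^ 2 - 1) := by rw [hσ]; ring
        _ ≤ 2 := hy
    have h1 : (c ^ 2)⁻¹ < ‖y‖ ^ 2 := by linarith
    have h2 : 1 < (c * ‖y‖) ^ 2 := by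
      rw [mul_pow, ← mul_inv_cancel₀ (by positivity : c ^ 2 ≠ 0)]
      gcongr
    by_contra! h3
    have := mul_nonneg hc0.le (norm_nonneg y)
    nlinarith
  set ρ : ℝ := Real.sqrt (1 - d / 4) with hρ
  have hd1 : d < 1 := by
    have : 0 < (c ^ 2)⁻¹ := by positivity
    linarith
  have hρ1 : ρ < 1 := by
    rw [hρ, Real.sqrt_lt' one_pos]
    linarith
  have hY : ∀ y : E3, σ * (‖y‖ ^ 2 - 1) ∈ Set.Icc 1 2 → ‖y‖ ≤ ρ := by
    intro y hy
    refine Real.le_sqrt_of_sq_le ?_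
    have h1 : d ≤ 4 * (1 - ‖y‖ ^ 2) := by
      rw [← one_le_div hcc]
      calc 1 ≤ σ * (‖y‖ ^ 2 - 1) := hy.1
        _ = _ := by rw [hσ]; ring
    linarith
  have hu := fun y hy => hf.dilation (hmem y hy)
  have hL := (memLp_dilation_exterior hf.memLp_re hc).ofReal (K := ℂ)
  have key := integral_mul_eq_zero_of_poles (σ := σ) (Ω := exteriorBall)
    (G := fun x => (g x : ℂ)) (κ := pole 0 0) (b := fun x => (1 - ρ)⁻¹ * (‖x‖ ^ 2)⁻¹)
    (u := fun x => ((f (c • x)).re : ℂ)) (neg_ne_zero.2 hσ0.ne') isOpen_exteriorBall.measurableSet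
    (fun x hx => by
      have hx : 1 < ‖x‖ := hx
      have : 0 ≤ ‖x‖ ^ 2 - 1 := by nlinarith [norm_nonneg x]
      exact mul_nonpos_of_nonpos_of_nonneg (neg_nonpos.2 hσ0.le) this)
    hG.1 (continuousOn_pole_zero (by simp))
    (fun x hx y hy => norm_pole_sub_pole_exterior_le hx hρ1 (hY y hy))
    (integrable_norm_mul_inv_sq hG _)
    (fun y hy => (orth_pole_exterior hG hP hS ((hY y hy).trans_lt hρ1)).2)
    (fun y hy => (hu y hy).1) (fun y hy => (hu y (hy.trans (by norm_num))).2)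
    (hL.mono (contDiff_glue fun y hy => (hu y hy).1).continuous.aestronglyMeasurable
      (ae_of_all _ fun y => norm_glue_le y))
  have e : ∫ x in exteriorBall, ((g x * (f (c • x)).re : ℝ) : ℂ) = 0 := by
    simpa using key
  rw [integral_complex_ofReal] at e
  exact_mod_cast e

theorem IsContragenic.integral_mul_re_exterior (hf : IsContragenic exteriorBall f)
    {g : E3 → ℝ} (hg : MemLp g 2 (volume.restrict exteriorBall))
    (hP : OrthDeriv fun x => (g x : ℂ)) (hS : OrthSect fun x => (g x : ℂ)) :
    ∫ x in exteriorBall, g x * (f x).re = 0 := by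
  have hlim : Tendsto (fun n : ℕ => (1 : ℝ) + 1 / ((n : ℝ) + 1)) atTop (𝓝 1) := by
    simpa using tendsto_one_div_add_atTop_nhds_zero_nat.const_add (1 : ℝ)
  have hc : ∀ n : ℕ, 1 < (1 : ℝ) + 1 / ((n : ℝ) + 1) := fun n => by
    have : 0 < 1 / ((n : ℝ) + 1) := by positivity
    linarith
  exact integral_mul_eq_zero_of_dilation isOpen_exteriorBall.measurableSet hg hf.memLp_re hlim
    (fun n x hx => smul_mem_exteriorBall (hc n) hx)
    fun n => hf.integral_mul_dilation_exterior hg hP hS (hc n)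

end ExteriorPairing


/-! ### Sectorial harmonics as `U_{n,-n-1}^±`, and the orthogonal decomposition -/

section ExtremalHarmonics

/-- By Rodrigues' formula this is a multiple of the `2k`-th derivative of a monic polynomial of
degree `2k`. Hence `P_k^k(cos θ)` is a nonzero multiple of `sin^k θ`, which makes the harmonic with
`m = -n-1` sectorial. -/
theorem iterate_derivative_legendre (k : ℕ) :
    ∃ c : ℝ, c ≠ 0 ∧ Polynomial.derivative^[k] (legendre k) = Polynomial.C c := by
  set p : Polynomial ℝ := (Polynomial.X ^ 2 - 1) ^ k with hp
  have hdeg : (Polynomial.X ^ 2 - 1 : Polynomial ℝ).natDegree = 2 := by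
    compute_degree!
  have hmon : (Polynomial.X ^ 2 - 1 : Polynomial ℝ).Monic := by
    monicity!
  have hpd : p.natDegree = 2 * k := by rw [hp, hmon.natDegree_pow, hdeg, mul_comm]
  have hpm : p.coeff (2 * k) = 1 := by
    rw [← hpd]; exact (hmon.pow k)
  have hD : Polynomial.derivative^[2 * k] p = Polynomial.C ((2 * k).factorial : ℝ) := by
    have h0 : (Polynomial.derivative^[2 * k] p).natDegree ≤ 0 :=
      (Polynomial.natDegree_iterate_derivative p (2 * k)).trans (by omega)
    rw [Polynomial.eq_C_of_natDegree_le_zero h0, Polynomial.coeff_iterate_derivative, zero_add, hpm,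
      Nat.descFactorial_self]
    simp
  refine ⟨1 / (2 ^ k * (k.factorial : ℝ)) * ((2 * k).factorial : ℝ), by positivity, ?_⟩
  rw [legendre, Polynomial.iterate_derivative_C_mul, ← Function.iterate_add_apply, ← two_mul, hD,
    ← Polynomial.C_mul]

theorem norm_pow_mul_cos_sin (z : ℂ) (k : ℕ) :
    ‖z‖ ^ k * Real.cos (k * z.arg) = (z ^ k).re ∧ ‖z‖ ^ k * Real.sin (k * z.arg) = (z ^ k).im := by
  have h : z ^ k = ((‖z‖ ^ k : ℝ) : ℂ) * Complex.exp (((k * z.arg : ℝ) : ℂ) * Complex.I) := by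
    conv_lhs => rw [← Complex.norm_mul_exp_arg_mul_I z]
    rw [mul_pow, ← Complex.exp_nat_mul]
    push_cast
    ring_nf
  rw [h, Complex.re_ofReal_mul, Complex.im_ofReal_mul, Complex.exp_ofReal_mul_I_re,
    Complex.exp_ofReal_mul_I_im]
  exact ⟨rfl, rfl⟩

/-- The extremal exterior harmonics are multiples of the real and imaginary parts of `sect`. -/
theorem exists_solidHarmonic_eq (k : ℕ) : ∃ c : ℝ, c ≠ 0 ∧ ∀ x : E3, x ≠ 0 →
    solidHarmonic (Int.negSucc k) k Parity.plus x = c * (sect k x).re ∧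
    solidHarmonic (Int.negSucc k) k Parity.minus x = c * (sect k x).im := by
  obtain ⟨c, hc, h⟩ := iterate_derivative_legendre k
  refine ⟨(-1) ^ k * c, mul_ne_zero (pow_ne_zero _ (by norm_num)) hc, fun x hx => ?_⟩
  have hx0 : 0 < ‖x‖ := norm_pos_iff.2 hx
  have hz : (⟨x 1, x 2⟩ : ℂ) = zc x := by rw [Complex.mk_eq_add_mul_I, zc]
  have hs : Real.sqrt (1 - (x 0 / ‖x‖) ^ 2) = ‖zc x‖ / ‖x‖ := by
    have e : 1 - (x 0 / ‖x‖) ^ 2 = (‖zc x‖ / ‖x‖) ^ 2 := by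
      have := norm_sq_eq_zc x
      field_simp
      linarith
    rw [e, Real.sqrt_sq (by positivity)]
  obtain ⟨h1, h2⟩ := norm_pow_mul_cos_sin (zc x) k
  have hp : ‖x‖ ^ (Int.negSucc k) * (((-1) ^ k * (‖zc x‖ / ‖x‖) ^ k) * c) =
      (-1) ^ k * c * (‖zc x‖ ^ k * (‖x‖ ^ (2 * k + 1))⁻¹) := by
    rw [zpow_negSucc, div_pow]
    field_simp
    ring
  simp only [solidHarmonic, assocLegendre, assocLegendreNat, angular, hz, hs, h,
    Polynomial.eval_C, hp, sect, Complex.re_mul_ofReal, Complex.im_mul_ofReal, ← h1, ← h2]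
  constructor <;> ring

theorem inner_eq_integral {μ : Measure E3} (u v : Lp ℝ 2 μ) : ⟪u, v⟫_ℝ = ∫ x, u x * v x ∂μ := by
  rw [L2.inner_def]
  refine integral_congr_ae (ae_of_all _ fun x => ?_)
  simp [mul_comm]

theorem integral_ofReal_mul_eq_zero_iff {μ : Measure E3} {g : E3 → ℝ} {H : E3 → ℂ}
    (hg : MemLp g 2 μ) (hH : MemLp H 2 μ) : ∫ x, (g x : ℂ) * H x ∂μ = 0 ↔
      (∫ x, g x * (H x).re ∂μ = 0) ∧ ∫ x, g x * (H x).im ∂μ = 0 := by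
  have hi : Integrable (fun x => (g x : ℂ) * H x) μ :=
    MemLp.integrable_mul (p := 2) (q := 2) hg.ofReal hH
  have h1 := Complex.reCLM.integral_comp_comm hi
  have h2 := Complex.imCLM.integral_comp_comm hi
  simp only [Complex.reCLM_apply, Complex.imCLM_apply, Complex.re_ofReal_mul,
    Complex.im_ofReal_mul] at h1 h2
  rw [h1, h2, Complex.ext_iff]
  rfl

theorem inner_eq_zero_of_mem_extremalSpan {v u : Lp ℝ 2 (volume.restrict exteriorBall)}
    (hv : ∀ k, (∫ x in exteriorBall, v x * (sect (k + 1) x).re = 0) ∧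
      ∫ x in exteriorBall, v x * (sect (k + 1) x).im = 0) (hu : u ∈ extremalSpan) :
    ⟪v, u⟫_ℝ = 0 := by
  rw [← Submodule.mem_orthogonal_singleton_iff_inner_right]
  refine Submodule.topologicalClosure_minimal _ (Submodule.span_le.2 ?_)
    (Submodule.isClosed_orthogonal _) hu
  rintro w ⟨n, m, s, hn, hm, hw⟩
  -- The conditions `n ≤ -2` and `m = -n-1` force `m ≥ 1`.
  obtain ⟨k, rfl⟩ : ∃ k, m = k + 1 := ⟨m - 1, by omega⟩
  obtain rfl : n = Int.negSucc (k + 1) := by omega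
  obtain ⟨c, _, h⟩ := exists_solidHarmonic_eq (k + 1)
  rw [SetLike.mem_coe, Submodule.mem_orthogonal_singleton_iff_inner_right, inner_eq_integral]
  have key : ∀ S : E3 → ℝ, (∫ x in exteriorBall, v x * S x = 0) →
      (∀ x ∈ exteriorBall, solidHarmonic (Int.negSucc (k + 1)) (k + 1) s x = c * S x) →
      ∫ x in exteriorBall, v x * w x = 0 := fun S h0 hS => by
    have e : ∀ᵐ x ∂volume.restrict exteriorBall, v x * w x = c * (v x * S x) := by
      filter_upwards [hw, ae_restrict_mem isOpen_exteriorBall.measurableSet] with x hx hxe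
      rw [hx, hS x hxe]; ring
    rw [integral_congr_ae e, integral_const_mul, h0, mul_zero]
  cases s with
  | plus => exact key _ (hv k).1 fun x hx => (h x (ne_zero_of_mem_exteriorBall hx)).1
  | minus => exact key _ (hv k).2 fun x hx => (h x (ne_zero_of_mem_exteriorBall hx)).2

theorem integral_mul_sect_eq_zero {v : Lp ℝ 2 (volume.restrict exteriorBall)}
    (hv : v ∈ extremalSpanᗮ) (k : ℕ) : (∫ x in exteriorBall, v x * (sect (k + 1) x).re = 0) ∧
      ∫ x in exteriorBall, v x * (sect (k + 1) x).im = 0 := by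
  obtain ⟨c, hc, h⟩ := exists_solidHarmonic_eq (k + 1)
  have key : ∀ (s : Parity) (S : E3 → ℝ), MemLp S 2 (volume.restrict exteriorBall) →
      (∀ x ∈ exteriorBall, solidHarmonic (Int.negSucc (k + 1)) (k + 1) s x = c * S x) →
      ∫ x in exteriorBall, v x * S x = 0 := fun s S hSL hS => by
    have hL := hSL.const_mul c
    have hmem : hL.toLp _ ∈ extremalSpan := by
      refine Submodule.le_topologicalClosure _ (Submodule.subset_span
        ⟨Int.negSucc (k + 1), k + 1, s, by omega, by omega, ?_⟩)
      filter_upwards [hL.coeFn_toLp, ae_restrict_mem isOpen_exteriorBall.measurableSet]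
        with x hx hxe
      rw [hx, hS x hxe]
    have h0 := (Submodule.mem_orthogonal' _ _).1 hv _ hmem
    rw [inner_eq_integral] at h0
    have e : ∀ᵐ x ∂volume.restrict exteriorBall, v x * hL.toLp _ x = c * (v x * S x) := by
      filter_upwards [hL.coeFn_toLp] with x hx
      rw [hx]; ring
    rw [integral_congr_ae e, integral_const_mul] at h0
    exact (mul_eq_zero.1 h0).resolve_left hc
  exact ⟨key Parity.plus _ (memLp_sect k).re fun x hx =>
      (h x (ne_zero_of_mem_exteriorBall hx)).1,
    key Parity.minus _ (memLp_sect k).im fun x hx => (h x (ne_zero_of_mem_exteriorBall hx)).2⟩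

theorem orthSect_of_mem_orthogonal {v : Lp ℝ 2 (volume.restrict exteriorBall)}
    (hv : v ∈ extremalSpanᗮ) : OrthSect fun x => (v x : ℂ) := fun k => by
  obtain ⟨h1, h2⟩ := integral_mul_sect_eq_zero hv k
  refine ⟨(integral_ofReal_mul_eq_zero_iff (Lp.memLp v) (memLp_sect k)).2 ⟨h1, h2⟩, ?_⟩
  refine (integral_ofReal_mul_eq_zero_iff (Lp.memLp v)
    (Complex.conjCLE.toContinuousLinearMap.comp_memLp' (memLp_sect k))).2 ⟨?_, ?_⟩
  · simpa using h1
  · simpa [integral_neg] using h2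

/-- Each sectorial harmonic is orthogonal to `∂₀h`, and the orthogonal complement of a fixed `L²`
function is a closed subspace, so the property passes to the closed span. -/
theorem orthDeriv_of_mem_extremalSpan {u : Lp ℝ 2 (volume.restrict exteriorBall)}
    (hu : u ∈ extremalSpan) : OrthDeriv fun x => (u x : ℂ) := by
  intro h hh hlap hL
  have hsect := fun k => integral_re_im_sect_mul_pd hh hlap (hL 0) k
  have hre := fun k => (integral_ofReal_mul_eq_zero_iff (memLp_sect k).re (hL 0)).1 (hsect k).1
  have him := fun k => (integral_ofReal_mul_eq_zero_iff (memLp_sect k).im (hL 0)).1 (hsect k).2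
  have key : ∀ S : E3 → ℝ, MemLp S 2 (volume.restrict exteriorBall) →
      (∀ k, (∫ x in exteriorBall, (sect (k + 1) x).re * S x = 0) ∧
        ∫ x in exteriorBall, (sect (k + 1) x).im * S x = 0) →
      ∫ x in exteriorBall, u x * S x = 0 := fun S hS h0 => by
    have e : ∀ w : E3 → ℝ, ∫ x in exteriorBall, hS.toLp S x * w x =
        ∫ x in exteriorBall, w x * S x := fun w => integral_congr_ae (by
      filter_upwards [hS.coeFn_toLp] with x hx
      rw [hx, mul_comm])
    have h1 := inner_eq_zero_of_mem_extremalSpan (v := hS.toLp S)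
      (fun k => ⟨(e _).trans (h0 k).1, (e _).trans (h0 k).2⟩) hu
    rwa [inner_eq_integral, e] at h1
  exact (integral_ofReal_mul_eq_zero_iff (Lp.memLp u) (hL 0)).2
    ⟨key _ (hL 0).re fun k => ⟨(hre k).1, (him k).1⟩, key _ (hL 0).im fun k => ⟨(hre k).2, (him k).2⟩⟩

/-- The component `g` of `Sc f` orthogonal to the closed span inherits orthogonality to all `∂₀h`
from `Sc f` and from the other component `s`. The kernel argument then gives `⟪g, Sc f⟫ = 0`, and
`⟪g, s⟫ = 0` leaves `‖g‖² = 0`. -/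
theorem IsContragenic.toLp_re_mem_extremalSpan {f : E3 → ℍ[ℝ]}
    (hf : IsContragenic exteriorBall f) : hf.memLp_re.toLp (fun x => (f x).re) ∈ extremalSpan := by
  have : CompleteSpace extremalSpan := by unfold extremalSpan; infer_instance
  set F := hf.memLp_re.toLp (fun x => (f x).re) with hF
  obtain ⟨s, hs, g, hg, hsum⟩ := extremalSpan.exists_add_mem_mem_orthogonal F
  have hFx := hf.memLp_re.coeFn_toLp
  have hP : OrthDeriv fun x => (g x : ℂ) := by
    intro h hh hlap hL
    have h1 := hf.integral_re_mul_pd_complex isOpen_exteriorBall hh hlap hL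
    have h2 := orthDeriv_of_mem_extremalSpan hs h hh hlap hL
    have i1 : Integrable (fun x => ((f x).re : ℂ) * pd 0 h x) (volume.restrict exteriorBall) :=
      MemLp.integrable_mul (p := 2) (q := 2) hf.memLp_re.ofReal (hL 0)
    have i2 : Integrable (fun x => (s x : ℂ) * pd 0 h x) (volume.restrict exteriorBall) :=
      MemLp.integrable_mul (p := 2) (q := 2) (Lp.memLp s).ofReal (hL 0)
    have e : ∀ᵐ x ∂volume.restrict exteriorBall, (g x : ℂ) * pd 0 h x =
        ((f x).re : ℂ) * pd 0 h x - (s x : ℂ) * pd 0 h x := by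
      have hadd := Lp.coeFn_add s g
      rw [← hsum] at hadd
      filter_upwards [hadd, hFx] with x hx hx'
      rw [← hx', hx, Pi.add_apply]
      push_cast
      ring
    rw [integral_congr_ae e, integral_sub i1 i2, h1, h2, sub_zero]
  have h0 := hf.integral_mul_re_exterior (Lp.memLp g) hP (orthSect_of_mem_orthogonal hg)
  have hgF : ⟪g, F⟫_ℝ = 0 := by
    rw [inner_eq_integral, ← h0]
    refine integral_congr_ae ?_
    filter_upwards [hFx] with x hx
    rw [hx]
  have hgs : ⟪g, s⟫_ℝ = 0 := (Submodule.mem_orthogonal' _ _).1 hg s hs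
  have hg0 : g = 0 := by
    rw [hsum, inner_add_right, hgs, zero_add] at hgF
    exact inner_self_eq_zero.1 hgF
  rw [hsum, hg0, add_zero]
  exact hs

end ExtremalHarmonics

end Contragenic

theorem mainTheorem3 :
    (∀ f : Contragenic.E3 → Quaternion ℝ,
      Contragenic.IsContragenic Contragenic.exteriorBall f →
        ∃ h : MeasureTheory.MemLp (fun x => (f x).re) 2
            (MeasureTheory.volume.restrict Contragenic.exteriorBall),
          h.toLp (fun x => (f x).re) ∈ Contragenic.extremalSpan) ∧
    (∀ f : Contragenic.E3 → Quaternion ℝ,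
      Contragenic.IsContragenic Contragenic.interiorBall f →
        ∀ x ∈ Contragenic.interiorBall, (f x).re = 0) := by
  exact ⟨fun f hf => ⟨hf.memLp_re, hf.toLp_re_mem_extremalSpan⟩,
    fun f hf => hf.re_eq_zero_of_interior⟩
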